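/- For a unital $C^*$-algebra $A$ let $\mathrm{T}(A)$ be the convex set of tracial states of $A$ with the weak-* topology. For $\varphi\in \mathrm{T}(A)$ let $\pi_\varphi$ be its GNS representation. Call $\varphi$ finite-dimensional if the von Neumann algebra $\pi_\varphi(A)''$ is finite-dimensional, and let $\mathrm{T}_{\mathrm{fd}}(A)$ be the set of finite-dimensional traces. A finite-dimensional trace that is an extreme point of $\mathrm{T}(A)$ has dimension $k$ if $\pi_\varphi(A)''\cong M_k(\mathbb{C})$. Let $A$ be either the full group $C^*$-algebra $C^*(F_d)$ of the free group on $d$ generators, where $2\le d<\infty$, or the $d$-fold universal unital free product $C^*$-algebra $M_n(\mathbb{C})*\cdots*M_n(\mathbb{C})$, where $n\ge 3$ and $2\le d<\infty$. Then: 1. for every $m\in\mathbb{N}$, the set of extreme finite-dimensional traces of dimension at least $m$ is dense in $\mathrm{T}_{\mathrm{fd}}(A)$; 2. the closure $\overline{\mathrm{T}_{\mathrm{fd}}(A)}$ is a face of $\mathrm{T}(A)$, and it is the Poulsen simplex, that is: it is an infinite, compact, convex, metrizable set in which every point is the barycenter of a unique Borel probability measure supported on the set of extreme points, and its extreme points are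 dense in it. -/

import Mathlib

open scoped ComplexOrder

noncomputable section

namespace TraceSimplex

/-! ### Star structures on complex algebras -/

section ConjOp

variable (B : Type*) [Ring B]

/-- The opposite ring of `B`, regarded as a complex algebra with the conjugate scalar action.
An algebra homomorphism `B →ₐ[ℂ] ConjOp B` is the same thing as a conjugate-linear,
anti-multiplicative unital map `B → B`. -/
def ConjOp : Type _ := Bᵐᵒᵖ

instance : Ring (ConjOp B) := inferInstanceAs (Ring Bᵐᵒᵖ)

instance [Algebra ℂ B] : Algebra ℂ (ConjOp B) :=
  RingHom.toAlgebra' (((algebraMap ℂ Bᵐᵒᵖ).comp (starRingEnd ℂ) : ℂ →+* Bᵐᵒᵖ))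
    (fun c x => Algebra.commutes (R := ℂ) (A := Bᵐᵒᵖ) (starRingEnd ℂ c) x)

variable {B}

/-- The element of `ConjOp B` given by an element of `B`. -/
def ConjOp.mk (b : B) : ConjOp B := MulOpposite.op b

/-- The element of `B` underlying an element of `ConjOp B`. -/
def ConjOp.get (b : ConjOp B) : B := MulOpposite.unop b

theorem ConjOp.get_mul (a b : ConjOp B) : (a * b).get = b.get * a.get := rfl
theorem ConjOp.get_add (a b : ConjOp B) : (a + b).get = a.get + b.get := rfl
variable [Algebra ℂ B]

theorem ConjOp.get_smul (c : ℂ) (a : ConjOp B) : (c • a).get = (starRingEnd ℂ c) • a.get := by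
  rw [Algebra.smul_def, ConjOp.get_mul, Algebra.smul_def, Algebra.commutes]
  rfl

theorem ConjOp.mk_smul (c : ℂ) (a : B) : ConjOp.mk ((starRingEnd ℂ c) • a) = c • ConjOp.mk a := by
  have h := ConjOp.get_smul c (ConjOp.mk a)
  exact (congrArg ConjOp.mk h).symm

/-- A homomorphism `B →ₐ[ℂ] ConjOp B` that squares to the identity makes `B` a star ring. -/
abbrev starRingOfHom (φ : B →ₐ[ℂ] ConjOp B) (h : ∀ x, (φ (φ x).get).get = x) : StarRing B where
  star x := (φ x).get
  star_involutive := h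
  star_mul a b := by rw [map_mul, ConjOp.get_mul]
  star_add a b := by rw [map_add, ConjOp.get_add]

/-- The homomorphism obtained by applying a homomorphism to `ConjOp B` twice. -/
def sqHom (φ : B →ₐ[ℂ] ConjOp B) : B →ₐ[ℂ] B where
  toFun x := (φ (φ x).get).get
  map_one' := by
    have h1 : (φ 1).get = 1 := by rw [map_one]; rfl
    rw [h1, h1]
  map_mul' a b := by rw [map_mul, ConjOp.get_mul, map_mul, ConjOp.get_mul]
  map_zero' := by
    have h1 : (φ 0).get = 0 := by rw [map_zero]; rfl
    rw [h1, h1]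
  map_add' a b := by rw [map_add, ConjOp.get_add, map_add, ConjOp.get_add]
  commutes' c := by
    have h1 : ∀ c : ℂ, (φ (algebraMap ℂ B c)).get = algebraMap ℂ B (starRingEnd ℂ c) := by
      intro c; rw [AlgHom.commutes]; rfl
    rw [h1, h1, Complex.conj_conj]

end ConjOp

/-! ### The group algebra as a star algebra -/

section GroupAlgebra

variable (G : Type*) [Group G]

/-- `c • g ↦ conj c • g⁻¹` on the group algebra. -/
def groupStarHom : MonoidAlgebra ℂ G →ₐ[ℂ] ConjOp (MonoidAlgebra ℂ G) :=
  MonoidAlgebra.lift ℂ (ConjOp (MonoidAlgebra ℂ G)) G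
    { toFun := fun g => ConjOp.mk (MonoidAlgebra.of ℂ G g⁻¹)
      map_one' := by rw [inv_one, map_one]; rfl
      map_mul' := fun a b => by rw [mul_inv_rev, map_mul]; rfl }

theorem groupStarHom_of (g : G) :
    (groupStarHom G (MonoidAlgebra.of ℂ G g)).get = MonoidAlgebra.of ℂ G g⁻¹ := by
  rw [groupStarHom, MonoidAlgebra.lift_of]
  rfl

/-- The usual involution of the complex group algebra, `g* = g⁻¹` for `g ∈ G`. -/
instance : StarRing (MonoidAlgebra ℂ G) :=
  starRingOfHom (groupStarHom G) (fun x => by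
    have h : sqHom (groupStarHom G) = AlgHom.id ℂ _ := by
      apply MonoidAlgebra.algHom_ext'
      · ext g : 1
        change (groupStarHom G (groupStarHom G (MonoidAlgebra.of ℂ G g)).get).get
          = MonoidAlgebra.of ℂ G g
        rw [groupStarHom_of, groupStarHom_of, inv_inv]
      · exact Subsingleton.elim _ _
    exact DFunLike.congr_fun h x)

theorem star_of (g : G) :
    star (MonoidAlgebra.of ℂ G g) = MonoidAlgebra.of ℂ G g⁻¹ := groupStarHom_of G g

instance : StarModule ℂ (MonoidAlgebra ℂ G) where
  star_smul c x := by
    change (groupStarHom G (c • x)).get = _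
    rw [map_smul, ConjOp.get_smul]
    rfl

end GroupAlgebra

/-! ### The algebraic free product of star algebras -/

section AlgFreeProduct

variable {I : Type*} [DecidableEq I] (A : I → Type*) [∀ i, Ring (A i)] [∀ i, Algebra ℂ (A i)]

/-- The algebraic unital free product (coproduct of unital complex algebras). -/
def AlgFreeProduct : Type _ := LinearAlgebra.FreeProduct ℂ A

instance : Ring (AlgFreeProduct A) := inferInstanceAs (Ring (LinearAlgebra.FreeProduct ℂ A))
instance : Algebra ℂ (AlgFreeProduct A) :=
  inferInstanceAs (Algebra ℂ (LinearAlgebra.FreeProduct ℂ A))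

/-- The canonical maps into the free product. -/
def AlgFreeProduct.ι (i : I) : A i →ₐ[ℂ] AlgFreeProduct A := LinearAlgebra.FreeProduct.ι ℂ A i

variable {A}

/-- Homomorphisms out of the free product that agree on all factors are equal. -/
theorem AlgFreeProduct.hom_ext {C : Type*} [Ring C] [Algebra ℂ C]
    {f g : AlgFreeProduct A →ₐ[ℂ] C}
    (h : ∀ i a, f (AlgFreeProduct.ι A i a) = g (AlgFreeProduct.ι A i a)) : f = g := by
  have hf := LinearAlgebra.FreeProduct.lift_unique ℂ A
    (maps := fun {i} => (AlgHom.comp g (AlgFreeProduct.ι A i))) f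
    (fun i => AlgHom.ext fun a => h i a)
  have hg := LinearAlgebra.FreeProduct.lift_unique ℂ A
    (maps := fun {i} => (AlgHom.comp g (AlgFreeProduct.ι A i))) g
    (fun i => AlgHom.ext fun a => rfl)
  exact hf.trans hg.symm

/-- Induction principle for the free product. -/
theorem AlgFreeProduct.mem_of_ι_mem (S : Subalgebra ℂ (AlgFreeProduct A))
    (h : ∀ i a, AlgFreeProduct.ι A i a ∈ S) (x : AlgFreeProduct A) : x ∈ S := by
  let f : AlgFreeProduct A →ₐ[ℂ] S := LinearAlgebra.FreeProduct.lift ℂ A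
    (fun {i} => (AlgFreeProduct.ι A i).codRestrict S (h i))
  have hf : S.val.comp f = AlgHom.id ℂ _ := by
    apply AlgFreeProduct.hom_ext
    intro i a
    have h2 := LinearAlgebra.FreeProduct.lift_comp_ι (i := i) ℂ A
      (maps := fun {i} => (AlgFreeProduct.ι A i).codRestrict S (h i))
    exact congrArg Subtype.val (DFunLike.congr_fun h2 a)
  have := (f x).2
  rwa [show ((f x : S) : AlgFreeProduct A) = x from DFunLike.congr_fun hf x] at this

variable [∀ i, StarRing (A i)] [∀ i, StarModule ℂ (A i)] (A)

/-- `a ↦ a*` from a factor to the conjugate-opposite of the free product. -/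
def factorStarHom (i : I) : A i →ₐ[ℂ] ConjOp (AlgFreeProduct A) where
  toFun a := ConjOp.mk (AlgFreeProduct.ι A i (star a))
  map_one' := by rw [star_one, map_one]; rfl
  map_mul' a b := by rw [star_mul, map_mul]; rfl
  map_zero' := by rw [star_zero, map_zero]; rfl
  map_add' a b := by rw [star_add, map_add]; rfl
  commutes' c := by
    rw [Algebra.algebraMap_eq_smul_one, Algebra.algebraMap_eq_smul_one, star_smul, star_one,
      map_smul, map_one]
    exact ConjOp.mk_smul c 1

/-- `a₁ a₂ ⋯ aₖ ↦ aₖ* ⋯ a₂* a₁*` on the free product. -/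
def freeStarHom : AlgFreeProduct A →ₐ[ℂ] ConjOp (AlgFreeProduct A) :=
  LinearAlgebra.FreeProduct.lift ℂ A (fun {i} => factorStarHom A i)

theorem freeStarHom_ι (i : I) (a : A i) :
    (freeStarHom A (AlgFreeProduct.ι A i a)).get = AlgFreeProduct.ι A i (star a) := by
  have h := LinearAlgebra.FreeProduct.lift_comp_ι (i := i) ℂ A
    (maps := fun {i} => factorStarHom A i)
  exact congrArg ConjOp.get (DFunLike.congr_fun h a)

/-- The involution of the free product extending the involutions of the factors. -/
instance : StarRing (AlgFreeProduct A) :=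
  starRingOfHom (freeStarHom A) (fun x => by
    have h : sqHom (freeStarHom A) = AlgHom.id ℂ _ := by
      apply AlgFreeProduct.hom_ext
      intro i a
      change (freeStarHom A (freeStarHom A (AlgFreeProduct.ι A i a)).get).get
        = AlgFreeProduct.ι A i a
      rw [freeStarHom_ι, freeStarHom_ι, star_star]
    exact DFunLike.congr_fun h x)

theorem star_ι (i : I) (a : A i) :
    star (AlgFreeProduct.ι A i a) = AlgFreeProduct.ι A i (star a) := freeStarHom_ι A i a

instance : StarModule ℂ (AlgFreeProduct A) where
  star_smul c x := by
    change (freeStarHom A (c • x)).get = _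
    rw [map_smul, ConjOp.get_smul]
    rfl

end AlgFreeProduct

/-! ### C⋆-seminorms and the universal C⋆-algebra of a star algebra -/

section Universal

/-- A C⋆-seminorm on a complex star algebra. -/
structure CStarSeminorm (B : Type*) [Ring B] [StarRing B] [Algebra ℂ B] extends
    Seminorm ℂ B where
  mul_le' : ∀ a b, toFun (a * b) ≤ toFun a * toFun b
  star_mul_self' : ∀ a, toFun (star a * a) = toFun a * toFun a

variable {B : Type*} [Ring B] [StarRing B] [Algebra ℂ B]

/-- The star algebra `B` equipped with the topology of a C⋆-seminorm `p`. -/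
@[nolint unusedArguments]
def CStarSeminorm.Carrier (_ : CStarSeminorm B) : Type _ := B

namespace CStarSeminorm

variable (p : CStarSeminorm B)

theorem le_star (a : B) : p.toSeminorm a ≤ p.toSeminorm (star a) := by
  have h1 : p.toSeminorm (star a * a) = p.toSeminorm a * p.toSeminorm a := p.star_mul_self' a
  have h2 : p.toSeminorm (star a * a) ≤ p.toSeminorm (star a) * p.toSeminorm a :=
    p.mul_le' (star a) a
  have h3 := apply_nonneg p.toSeminorm a
  have h4 := apply_nonneg p.toSeminorm (star a)
  rw [h1] at h2
  rcases h3.eq_or_lt with h | h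
  · rw [← h]; exact h4
  · exact le_of_mul_le_mul_right h2 h

theorem apply_star (a : B) : p.toSeminorm (star a) = p.toSeminorm a := by
  refine le_antisymm ?_ (p.le_star a)
  simpa using p.le_star (star a)

instance : Ring p.Carrier := inferInstanceAs (Ring B)
instance : StarRing p.Carrier := inferInstanceAs (StarRing B)
instance : Algebra ℂ p.Carrier := inferInstanceAs (Algebra ℂ B)
instance [StarModule ℂ B] : StarModule ℂ p.Carrier := inferInstanceAs (StarModule ℂ B)

instance : SeminormedRing p.Carrier where
  __ := (inferInstance : Ring p.Carrier)
  norm a := p.toSeminorm (show B from a)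
  dist a b := p.toSeminorm (-(show B from a) + (show B from b))
  dist_self a := by
    rw [neg_add_cancel, map_zero]
  dist_comm a b := by
    rw [← map_neg_eq_map p.toSeminorm (-(show B from a) + (show B from b))]
    congr 1
    abel
  dist_triangle a b c := by
    refine le_of_eq_of_le ?_ (map_add_le_add p.toSeminorm _ _)
    congr 1
    abel
  dist_eq a b := rfl
  norm_mul_le a b := p.mul_le' a b

theorem norm_def (a : p.Carrier) : ‖a‖ = p.toSeminorm (show B from a) := rfl

instance : NormedAlgebra ℂ p.Carrier where
  __ := (inferInstance : Algebra ℂ p.Carrier)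
  norm_smul_le c a := (map_smul_eq_mul p.toSeminorm c (show B from a)).le

instance : NormedStarGroup p.Carrier where
  norm_star_le a := (p.apply_star a).le

open UniformSpace in
/-- The C⋆-algebra obtained from `B` by separation and completion with respect to a C⋆-seminorm. -/
def Completion : Type _ := UniformSpace.Completion p.Carrier

namespace Completion

open UniformSpace.Completion

instance : NormedRing p.Completion := inferInstanceAs (NormedRing (UniformSpace.Completion _))
instance : CompleteSpace p.Completion :=
  inferInstanceAs (CompleteSpace (UniformSpace.Completion p.Carrier))

instance : NormedAlgebra ℂ p.Completion where
  __ := (inferInstanceAs (Algebra ℂ (UniformSpace.Completion p.Carrier)) :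
    Algebra ℂ p.Completion)
  norm_smul_le c x := norm_smul_le c (show UniformSpace.Completion p.Carrier from x)

/-- The canonical map from `B` to its completion. -/
def of : B →+* p.Completion := (coeRingHom : p.Carrier →+* UniformSpace.Completion p.Carrier)

theorem uniformContinuous_star : UniformContinuous (star : p.Carrier → p.Carrier) :=
  (LipschitzWith.of_dist_le_mul (K := 1) (fun a b => by
    rw [dist_eq_norm, dist_eq_norm, ← star_sub, norm_star, NNReal.coe_one, one_mul])).uniformContinuous

instance : Star p.Completion where
  star := UniformSpace.Completion.map (star : p.Carrier → p.Carrier)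

theorem continuous_star : Continuous (star : p.Completion → p.Completion) :=
  UniformSpace.Completion.continuous_map

theorem star_of (a : B) : star (of p a) = of p (star a) :=
  UniformSpace.Completion.map_coe (uniformContinuous_star p) _

theorem norm_of (a : B) : ‖of p a‖ = p.toSeminorm a :=
  UniformSpace.Completion.norm_coe (E := p.Carrier) a

theorem induction {P : p.Completion → Prop} (x : p.Completion) (hp : IsClosed {x | P x})
    (ih : ∀ a, P (of p a)) : P x :=
  UniformSpace.Completion.induction_on x hp ih

instance : StarRing p.Completion where
  star_involutive x := by
    refine induction p (P := fun x => star (star x) = x) x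
      (isClosed_eq ((continuous_star p).comp (continuous_star p)) continuous_id) fun a => ?_
    rw [star_of, star_of, star_star]
  star_mul x y := by
    refine induction p (P := fun x => star (x * y) = star y * star x) x ?_ fun a =>
      induction p (P := fun y => star (of p a * y) = star y * star (of p a)) y ?_ fun b => ?_
    · exact isClosed_eq ((continuous_star p).comp (continuous_mul_const y))
        ((continuous_const_mul (star y)).comp (continuous_star p))
    · exact isClosed_eq ((continuous_star p).comp (continuous_const_mul (of p a)))
        ((continuous_mul_const (star (of p a))).comp (continuous_star p))
    · rw [← map_mul, star_of, star_of, star_of, ← map_mul, star_mul]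
  star_add x y := by
    refine induction p (P := fun x => star (x + y) = star x + star y) x ?_ fun a =>
      induction p (P := fun y => star (of p a + y) = star (of p a) + star y) y ?_ fun b => ?_
    · exact isClosed_eq ((continuous_star p).comp (continuous_add_const y))
        ((continuous_add_const (star y)).comp (continuous_star p))
    · exact isClosed_eq ((continuous_star p).comp (continuous_const_add (of p a)))
        ((continuous_const_add (star (of p a))).comp (continuous_star p))
    · rw [← map_add, star_of, star_of, star_of, ← map_add, star_add]

theorem of_smul (c : ℂ) (a : B) : of p (c • a) = c • of p a :=
  UniformSpace.Completion.coe_smul (X := p.Carrier) c a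

instance [StarModule ℂ B] : StarModule ℂ p.Completion where
  star_smul c x := by
    refine induction p (P := fun x => star (c • x) = star c • star x) x ?_ fun a => ?_
    · exact isClosed_eq ((continuous_star p).comp (continuous_const_smul c))
        ((continuous_const_smul (star c)).comp (continuous_star p))
    · rw [← of_smul, star_of, star_of, ← of_smul, star_smul]

instance : CStarRing p.Completion where
  norm_mul_self_le x := by
    refine induction p (P := fun x => ‖x‖ * ‖x‖ ≤ ‖star x * x‖) x ?_ fun a => ?_
    · exact isClosed_le (continuous_norm.mul continuous_norm)
        (continuous_norm.comp ((continuous_star p).mul continuous_id))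
    · rw [star_of, ← map_mul, norm_of, norm_of]
      exact (p.star_mul_self' a).ge

instance [StarModule ℂ B] : CStarAlgebra p.Completion where

end Completion

/-- The pullback of a C⋆-seminorm along a unital star homomorphism. -/
def comap {B' : Type*} [Ring B'] [StarRing B'] [Algebra ℂ B'] (f : B' →⋆ₐ[ℂ] B) :
    CStarSeminorm B' where
  toSeminorm := p.toSeminorm.comp f.toAlgHom.toLinearMap
  mul_le' a b := by
    change p.toSeminorm (f (a * b)) ≤ p.toSeminorm (f a) * p.toSeminorm (f b)
    rw [map_mul]
    exact p.mul_le' _ _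
  star_mul_self' a := by
    change p.toSeminorm (f (star a * a)) = p.toSeminorm (f a) * p.toSeminorm (f a)
    rw [map_mul, map_star f]
    exact p.star_mul_self' _

/-- On a C⋆-algebra every C⋆-seminorm is bounded by the norm. -/
theorem le_norm {C : Type*} [CStarAlgebra C] (p : CStarSeminorm C) (c : C) :
    p.toSeminorm c ≤ ‖c‖ := by
  let f : C →⋆ₐ[ℂ] p.Completion :=
    { Completion.of p with
      commutes' := fun z => by
        change Completion.of p (algebraMap ℂ C z) = algebraMap ℂ p.Completion z
        rw [Algebra.algebraMap_eq_smul_one, Completion.of_smul, map_one,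
          Algebra.algebraMap_eq_smul_one]
      map_star' := fun a => (Completion.star_of p a).symm }
  have h : ‖f c‖ ≤ ‖c‖ := NonUnitalStarAlgHom.norm_apply_le f c
  have h2 : ‖f c‖ = p.toSeminorm c := Completion.norm_of p c
  rwa [h2] at h

instance : Nonempty (CStarSeminorm B) :=
  ⟨{ toSeminorm := 0
     mul_le' := fun _ _ => (mul_zero (0 : ℝ)).ge
     star_mul_self' := fun _ => (mul_zero (0 : ℝ)).symm }⟩

end CStarSeminorm

/-- The C⋆-seminorms on `B` are pointwise bounded, so that there is a largest one. -/
class IsCStarBounded (B : Type*) [Ring B] [StarRing B] [Algebra ℂ B] : Prop where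
  bddAbove : ∀ b : B, BddAbove (Set.range fun p : CStarSeminorm B => p.toSeminorm b)

section Max

variable (B) [hB : IsCStarBounded B]

/-- The largest C⋆-seminorm on `B`. -/
def maxCStarSeminorm : CStarSeminorm B where
  toFun b := ⨆ p : CStarSeminorm B, p.toSeminorm b
  map_zero' := by simp
  add_le' a b := ciSup_le fun p => (map_add_le_add p.toSeminorm a b).trans
    (add_le_add (le_ciSup (hB.bddAbove a) p) (le_ciSup (hB.bddAbove b) p))
  neg' a := by simp
  smul' c a := by
    simp only [map_smul_eq_mul]
    rw [Real.mul_iSup_of_nonneg (norm_nonneg c)]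
  mul_le' a b := ciSup_le fun p => (p.mul_le' a b).trans
    (mul_le_mul (le_ciSup (hB.bddAbove a) p) (le_ciSup (hB.bddAbove b) p)
      (apply_nonneg p.toSeminorm b)
      (Real.iSup_nonneg fun q => apply_nonneg q.toSeminorm a))
  star_mul_self' a := by
    have h0 : 0 ≤ ⨆ p : CStarSeminorm B, p.toSeminorm a :=
      Real.iSup_nonneg fun q => apply_nonneg q.toSeminorm a
    refine le_antisymm (ciSup_le fun p => ?_) ?_
    · refine (p.star_mul_self' a).le.trans ?_
      exact mul_le_mul (le_ciSup (hB.bddAbove a) p) (le_ciSup (hB.bddAbove a) p)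
        (apply_nonneg p.toSeminorm a) h0
    · change (⨆ p : CStarSeminorm B, p.toSeminorm a) * (⨆ p : CStarSeminorm B, p.toSeminorm a)
        ≤ ⨆ p : CStarSeminorm B, p.toSeminorm (star a * a)
      rw [Real.mul_iSup_of_nonneg h0]
      refine ciSup_le fun p => ?_
      rw [Real.iSup_mul_of_nonneg (apply_nonneg p.toSeminorm a)]
      refine ciSup_le fun q => ?_
      rcases le_total (p.toSeminorm a) (q.toSeminorm a) with h | h
      · calc q.toSeminorm a * p.toSeminorm a ≤ q.toSeminorm a * q.toSeminorm a :=
              mul_le_mul_of_nonneg_left h (apply_nonneg _ _)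
          _ = q.toSeminorm (star a * a) := (q.star_mul_self' a).symm
          _ ≤ _ := le_ciSup (hB.bddAbove (star a * a)) q
      · calc q.toSeminorm a * p.toSeminorm a ≤ p.toSeminorm a * p.toSeminorm a :=
              mul_le_mul_of_nonneg_right h (apply_nonneg _ _)
          _ = p.toSeminorm (star a * a) := (p.star_mul_self' a).symm
          _ ≤ _ := le_ciSup (hB.bddAbove (star a * a)) p

/-- The universal (enveloping) C⋆-algebra of the star algebra `B`: the completion of `B` in its
largest C⋆-seminorm. -/
abbrev UniversalCStar : Type _ := (maxCStarSeminorm B).Completion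

end Max

/-- If the elements on which all C⋆-seminorms are bounded contain a generating set, then the
C⋆-seminorms are pointwise bounded. -/
theorem IsCStarBounded.of_adjoin (s : Set B) (hs : ∀ x, x ∈ Algebra.adjoin ℂ s)
    (h : ∀ b ∈ s, ∃ K, ∀ p : CStarSeminorm B, p.toSeminorm b ≤ K) : IsCStarBounded B where
  bddAbove b := by
    have key : ∃ K, ∀ p : CStarSeminorm B, p.toSeminorm b ≤ K := by
      have h1 : ∀ p : CStarSeminorm B, p.toSeminorm 1 ≤ 1 := fun p => by
        have h2 : p.toSeminorm (star 1 * 1) = p.toSeminorm 1 * p.toSeminorm 1 :=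
          p.star_mul_self' 1
        rw [star_one, mul_one] at h2
        nlinarith [apply_nonneg p.toSeminorm (1 : B)]
      induction hs b using Algebra.adjoin_induction with
      | mem x hx => exact h x hx
      | algebraMap c =>
        refine ⟨‖c‖ * 1, fun p => ?_⟩
        rw [Algebra.algebraMap_eq_smul_one, map_smul_eq_mul]
        exact mul_le_mul_of_nonneg_left (h1 p) (norm_nonneg c)
      | add x y _ _ hx hy =>
        obtain ⟨K, hK⟩ := hx
        obtain ⟨L, hL⟩ := hy
        exact ⟨K + L, fun p => (map_add_le_add p.toSeminorm x y).trans (add_le_add (hK p) (hL p))⟩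
      | mul x y _ _ hx hy =>
        obtain ⟨K, hK⟩ := hx
        obtain ⟨L, hL⟩ := hy
        exact ⟨K * L, fun p => (p.mul_le' x y).trans (mul_le_mul (hK p) (hL p)
          (apply_nonneg p.toSeminorm y) ((apply_nonneg p.toSeminorm x).trans (hK p)))⟩
    obtain ⟨K, hK⟩ := key
    exact ⟨K, by rintro _ ⟨p, rfl⟩; exact hK p⟩

end Universal

/-! ### Group C⋆-algebras and free products of C⋆-algebras -/

section GroupCStar

variable (G : Type*) [Group G]

instance : IsCStarBounded (MonoidAlgebra ℂ G) :=
  IsCStarBounded.of_adjoin (Set.range (MonoidAlgebra.of ℂ G))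
    (fun x => by
      induction x using MonoidAlgebra.induction_on with
      | of g => exact Algebra.subset_adjoin ⟨g, rfl⟩
      | add x y hx hy => exact add_mem hx hy
      | smul c x hx => exact Subalgebra.smul_mem _ hx c)
    (by
      rintro _ ⟨g, rfl⟩
      refine ⟨1, fun p => ?_⟩
      have h2 := p.star_mul_self' (MonoidAlgebra.of ℂ G g)
      have h3 := p.star_mul_self' 1
      rw [star_of, ← map_mul, inv_mul_cancel, map_one] at h2
      rw [star_one, mul_one] at h3
      change p.toSeminorm 1 = p.toSeminorm _ * p.toSeminorm _ at h2
      change p.toSeminorm 1 = p.toSeminorm _ * p.toSeminorm _ at h3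
      have h4 : p.toSeminorm 1 ≤ 1 := by
        nlinarith [apply_nonneg p.toSeminorm (1 : MonoidAlgebra ℂ G)]
      rw [h2, ← sq] at h4
      exact (sq_le_one_iff₀ (apply_nonneg p.toSeminorm _)).1 h4)

/-- The full (maximal) group C⋆-algebra `C*(G)` of a discrete group. -/
abbrev GroupCStarAlgebra : Type _ := UniversalCStar (MonoidAlgebra ℂ G)

end GroupCStar

section FreeProduct

variable {I : Type*} [DecidableEq I] (A : I → Type*) [∀ i, CStarAlgebra (A i)]

/-- The canonical star homomorphism from a factor to the free product. -/
def factorHom (i : I) : A i →⋆ₐ[ℂ] AlgFreeProduct A where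
  __ := AlgFreeProduct.ι A i
  map_star' a := (star_ι A i a).symm

instance : IsCStarBounded (AlgFreeProduct A) :=
  IsCStarBounded.of_adjoin (⋃ i, Set.range (AlgFreeProduct.ι A i))
    (AlgFreeProduct.mem_of_ι_mem _ fun i a =>
      Algebra.subset_adjoin (Set.mem_iUnion.2 ⟨i, a, rfl⟩))
    (by
      intro b hb
      obtain ⟨i, a, rfl⟩ := Set.mem_iUnion.1 hb
      exact ⟨‖a‖, fun p => (p.comap (factorHom A i)).le_norm a⟩)

/-- The universal unital free product of unital C⋆-algebras (their coproduct). -/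
abbrev CStarFreeProduct : Type _ := UniversalCStar (AlgFreeProduct A)

end FreeProduct

/-! ### Traces -/

section Traces

/-- The set `T(A)` of tracial states of a unital C⋆-algebra, in the dual of `A` with the
weak-* topology. -/
def traceSpace (A : Type*) [CStarAlgebra A] : Set (WeakDual ℂ A) :=
  {φ | φ 1 = 1 ∧ (∀ a : A, 0 ≤ φ (star a * a)) ∧ ∀ a b : A, φ (a * b) = φ (b * a)}

section GNS

variable {A : Type*} [CStarAlgebra A] [PartialOrder A] [StarOrderedRing A]

/-- A trace as a positive linear functional. -/
def tracePositive (φ : traceSpace A) : A →ₚ[ℂ] ℂ where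
  toLinearMap := (WeakDual.toStrongDual φ.1).toLinearMap
  monotone' a b hab := by
    have h : ∀ x ∈ AddSubmonoid.closure (Set.range fun s : A => star s * s),
        0 ≤ φ.1 x := by
      intro x hx
      induction hx using AddSubmonoid.closure_induction with
      | mem x hx => obtain ⟨s, rfl⟩ := hx; exact φ.2.2.1 s
      | zero => rw [map_zero]
      | add x y _ _ hx hy => rw [map_add]; exact add_nonneg hx hy
    obtain ⟨p, hp, rfl⟩ := StarOrderedRing.le_iff a b |>.1 hab
    change φ.1 a ≤ φ.1 (a + p)
    rw [map_add]
    exact le_add_of_nonneg_right (h p hp)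

/-- The von Neumann algebra `π(A)''` of a trace, where `π` is its GNS representation. -/
def traceVonNeumannAlgebra (φ : traceSpace A) :
    StarSubalgebra ℂ ((tracePositive φ).GNS →L[ℂ] (tracePositive φ).GNS) :=
  StarSubalgebra.centralizer ℂ
    (StarSubalgebra.centralizer ℂ (Set.range (tracePositive φ).gnsStarAlgHom) :
      Set ((tracePositive φ).GNS →L[ℂ] (tracePositive φ).GNS))

end GNS

variable {A : Type*} [CStarAlgebra A]

/-- A trace is finite-dimensional if its von Neumann algebra is finite-dimensional. -/
def IsFiniteDimensionalTrace (φ : traceSpace A) : Prop :=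
  letI := CStarAlgebra.spectralOrder A
  haveI := CStarAlgebra.spectralOrderedRing A
  FiniteDimensional ℂ (traceVonNeumannAlgebra φ)

/-- A trace is a factor trace of dimension `k` if its von Neumann algebra is isomorphic to the
algebra of `k × k` complex matrices. -/
def HasMatrixDimension (φ : traceSpace A) (k : ℕ) : Prop :=
  letI := CStarAlgebra.spectralOrder A
  haveI := CStarAlgebra.spectralOrderedRing A
  Nonempty (traceVonNeumannAlgebra φ ≃⋆ₐ[ℂ] Matrix (Fin k) (Fin k) ℂ)

variable (A)

/-- The set of finite-dimensional traces. -/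
def finiteDimensionalTraces : Set (WeakDual ℂ A) :=
  {φ | ∃ h : φ ∈ traceSpace A, IsFiniteDimensionalTrace ⟨φ, h⟩}

/-- The set of extreme traces that are finite-dimensional, of dimension at least `m`. -/
def extremeFiniteDimensionalTraces (m : ℕ) : Set (WeakDual ℂ A) :=
  {φ | φ ∈ Set.extremePoints ℝ (traceSpace A) ∧ φ ∈ finiteDimensionalTraces A ∧
    ∃ h : φ ∈ traceSpace A, ∃ k, m ≤ k ∧ HasMatrixDimension ⟨φ, h⟩ k}

end Traces

/-! ### Simplices -/

section Simplex

variable {E : Type*} [AddCommGroup E] [Module ℝ E] [TopologicalSpace E]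

/-- `F` is a face of the convex set `K`. -/
def IsFace (K F : Set E) : Prop := Convex ℝ F ∧ IsExtreme ℝ K F

/-- `μ` is a Borel probability measure on `K`, supported on the extreme points of `K`, with
barycenter `x`. -/
structure IsBoundaryMeasure (K : Set E) (x : E) (μ : @MeasureTheory.Measure K (borel K)) :
    Prop where
  prob : μ Set.univ = 1
  support : μ {y : K | (y : E) ∉ Set.extremePoints ℝ K} = 0
  barycenter : ∀ f : E →L[ℝ] ℝ,
    @MeasureTheory.integral K ℝ _ _ (borel K) μ (fun y => f y) = f x

/-- A metrizable Choquet simplex: a compact convex metrizable set in which every point is the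
barycenter of a unique Borel probability measure supported on the extreme points. -/
structure IsMetrizableChoquetSimplex (K : Set E) : Prop where
  isCompact : IsCompact K
  convex : Convex ℝ K
  metrizable : TopologicalSpace.MetrizableSpace K
  existsUnique_measure : ∀ x ∈ K, ∃! μ : @MeasureTheory.Measure K (borel K),
    IsBoundaryMeasure K x μ

/-- `K` is the Poulsen simplex: an infinite metrizable Choquet simplex whose extreme points are
dense. -/
structure IsPoulsenSimplex (K : Set E) : Prop where
  simplex : IsMetrizableChoquetSimplex K
  infinite : K.Infinite
  dense : K ⊆ closure (Set.extremePoints ℝ K)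

end Simplex

end TraceSimplex

end

open TraceSimplex

/-!
The algebras in question are treated together as algebras with a `MatrixModel`: their matrix
representations `R_u` are parametrised by tuples `u` of unitaries on `ℂⁿ ⊗ ℂᵏ`. For the group algebra
of a free group `n = 1` and the unitaries are the images of the generators (`freeGroupModel`). For
`Mₙ * ⋯ * Mₙ` the `i`th factor acts by `x ↦ uᵢ (x ⊗ 1) uᵢ*` (`matrixFreeProductModel`). Let `D` be the
set of normalised traces of matrix representations (`matrixTraces`). The closure of `D` turns out to
be the closure of the set of finite-dimensional traces.

*Domination.* The main point is that the closure of `D` contains every trace `φ₁` with `t φ₁ ≤ φ` for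
some `t > 0` and some `φ` in the closure (`mem_closure_matrixTraces_of_dominated`). By
`exists_almost_central_density` one has `t φ₁ ≈ φ(b ·)` on a finite set, with `0 ≤ b ≤ 1` almost
central in the `L²`-seminorm of `φ`; here `b` almost minimises a quadratic function, and no von
Neumann algebra is needed. The trace `φ` can be replaced by that of a representation `R_u`. Then
`R_u(b)` almost commutes with `R_u`, in the normalised Hilbert–Schmidt norm, and can be straightened
to a diagonal matrix `1 ⊗ Λ` almost commuting with unitaries `v` for which `R_v` is equivalent to
`R_u`. If the unitaries `v ⊗ 1` on `ℂⁿ ⊗ ℂᵏ ⊗ ℂᴹ` are compressed to the coordinates below the graph of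
`M Λ`, they remain almost unitary, and nearby unitaries give a representation whose trace is close to
`Tr(Λ R_v ·) / Tr(Λ) ≈ φ₁` (`exists_unitary_below`, `exists_matrixTrace_near`). Straightening is
diagonalisation for the free group; for `Mₙ * ⋯ * Mₙ` it compares the spectra of the compressions of
`R_u(b)` to the commutants of the `d` factors, by an inequality of Hoffman–Wielandt type
(`exists_perm_near`, `exists_straightening`).

Domination shows that the closure of `D` is convex, as a convex combination of two matrix traces is
dominated by a multiple of the trace of the direct sum; that it is a face of the trace space; and
that it contains the finite-dimensional traces, as such a trace is dominated by a multiple of the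
trace of its GNS representation (`convex_closure_matrixTraces`, `isExtreme_closure_matrixTraces`,
`finiteDimensionalTraces_subset_closure`).

*Irreducible representations.* After an amplification, which makes the dimension large without
changing the trace, the tuple `u` is joined by an analytic path to a tuple that defines an irreducible
representation. Triviality of the commutant is the nonvanishing of an analytic function, hence holds
at points of the path arbitrarily close to `u` (`exists_irreducible_near`). The trace of an
irreducible representation on `ℂᵏ` is extreme, and its von Neumann algebra is `M_k`
(`matrixTrace_mem_extremePoints`, `nonempty_traceVonNeumannAlgebra_equiv`). So the extreme
finite-dimensional traces of dimension at least `m` are dense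
(`matrixTraces_subset_closure_extreme`). The irreducible tuples of `Mₙ * ⋯ * Mₙ` are where `n ≥ 3` is
used.

*Choquet theory.* A compact face of the trace space of a separable C⋆-algebra is a metrizable
Choquet simplex (`isMetrizableChoquetSimplex_of_isExtreme`). A representing measure on the extreme
points is found by maximising the integral of a strictly convex function (`exists_boundary_measure`).
For uniqueness, a self-adjoint `a` is averaged over unitary conjugates to a sequence that is
asymptotically central for the barycenter `φ` (`exists_central_sequence`). At almost every point of
a representing measure the sequence is still asymptotically central, and if that point `ψ` is an
extreme trace, then it converges in `L²` to the scalar `ψ(a)` (`tendsto_extreme_scalar`). So `φ`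
determines the integrals of all products of evaluations `ψ ↦ ψ(a)` (`integral_prod_eq_of_extreme`),
and hence the measure, by the Stone–Weierstrass theorem (`eq_of_barycenter_eq`).
-/

namespace TraceSimplex

open Filter Topology

/-! ### Tracial states -/

section TraceBasics

variable {A : Type*} [CStarAlgebra A] {φ ψ : WeakDual ℂ A}

/-- The `L²`-seminorm `‖a‖_φ = φ(a* a)^{1/2}` of a trace. -/
noncomputable def traceNorm (φ : WeakDual ℂ A) (a : A) : ℝ := √(φ (star a * a)).re

theorem trace_comm (hφ : φ ∈ traceSpace A) (a b : A) : φ (a * b) = φ (b * a) := hφ.2.2 a b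

theorem trace_nonneg [PartialOrder A] [StarOrderedRing A] (hφ : φ ∈ traceSpace A) {a : A}
    (ha : 0 ≤ a) : 0 ≤ φ a := by
  obtain ⟨b, rfl⟩ := CStarAlgebra.nonneg_iff_eq_star_mul_self.1 ha
  exact hφ.2.1 b

theorem trace_mono [PartialOrder A] [StarOrderedRing A] (hφ : φ ∈ traceSpace A) {a b : A}
    (h : a ≤ b) : φ a ≤ φ b := by
  have := trace_nonneg hφ (sub_nonneg.2 h)
  rwa [map_sub, sub_nonneg] at this

theorem trace_star (hφ : φ ∈ traceSpace A) (a : A) : φ (star a) = star (φ a) := by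
  let := CStarAlgebra.spectralOrder A
  have := CStarAlgebra.spectralOrderedRing A
  exact map_star (tracePositive ⟨φ, hφ⟩) a

theorem trace_im_eq_zero (hφ : φ ∈ traceSpace A) {a : A} (ha : IsSelfAdjoint a) :
    (φ a).im = 0 := by
  have h := trace_star hφ a
  rw [ha.star_eq] at h
  exact Complex.conj_eq_iff_im.1 h.symm

theorem trace_eq_re (hφ : φ ∈ traceSpace A) {a : A} (ha : IsSelfAdjoint a) :
    φ a = ((φ a).re : ℂ) :=
  Complex.ext rfl (by simpa using trace_im_eq_zero hφ ha)

theorem traceNorm_nonneg (φ : WeakDual ℂ A) (a : A) : 0 ≤ traceNorm φ a := Real.sqrt_nonneg _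

theorem traceNorm_sq (hφ : φ ∈ traceSpace A) (a : A) :
    traceNorm φ a ^ 2 = (φ (star a * a)).re :=
  Real.sq_sqrt (Complex.nonneg_iff.1 (hφ.2.1 a)).1

theorem traceNorm_add_le (hφ : φ ∈ traceSpace A) (a b : A) :
    traceNorm φ (a + b) ≤ traceNorm φ a + traceNorm φ b := by
  let := CStarAlgebra.spectralOrder A
  have := CStarAlgebra.spectralOrderedRing A
  exact norm_add_le ((tracePositive ⟨φ, hφ⟩).toPreGNS a) ((tracePositive ⟨φ, hφ⟩).toPreGNS b)

theorem traceNorm_smul (φ : WeakDual ℂ A) (c : ℂ) (a : A) :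
    traceNorm φ (c • a) = ‖c‖ * traceNorm φ a := by
  have h : φ (star (c • a) * (c • a)) = ((‖c‖ ^ 2 : ℝ) : ℂ) * φ (star a * a) := by
    rw [star_smul, smul_mul_smul_comm, map_smul, smul_eq_mul, ← Complex.normSq_eq_norm_sq,
      Complex.normSq_eq_conj_mul_self]
    rfl
  rw [traceNorm, traceNorm, h, Complex.re_ofReal_mul, Real.sqrt_mul (by positivity),
    Real.sqrt_sq (norm_nonneg c)]

theorem traceNorm_star (hφ : φ ∈ traceSpace A) (a : A) :
    traceNorm φ (star a) = traceNorm φ a := by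
  rw [traceNorm, traceNorm, star_star, trace_comm hφ]

theorem norm_trace_star_mul_le (hφ : φ ∈ traceSpace A) (a b : A) :
    ‖φ (star a * b)‖ ≤ traceNorm φ a * traceNorm φ b := by
  let := CStarAlgebra.spectralOrder A
  have := CStarAlgebra.spectralOrderedRing A
  exact norm_inner_le_norm (𝕜 := ℂ) ((tracePositive ⟨φ, hφ⟩).toPreGNS a)
    ((tracePositive ⟨φ, hφ⟩).toPreGNS b)

theorem norm_trace_mul_le (hφ : φ ∈ traceSpace A) (a b : A) :
    ‖φ (a * b)‖ ≤ traceNorm φ a * traceNorm φ b := by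
  have := norm_trace_star_mul_le hφ (star a) b
  rwa [star_star, traceNorm_star hφ] at this

theorem traceNorm_mul_le (hφ : φ ∈ traceSpace A) (a b : A) :
    traceNorm φ (a * b) ≤ ‖a‖ * traceNorm φ b := by
  let := CStarAlgebra.spectralOrder A
  have := CStarAlgebra.spectralOrderedRing A
  rw [traceNorm, traceNorm, ← Real.sqrt_sq (norm_nonneg a), ← Real.sqrt_mul (by positivity)]
  refine Real.sqrt_le_sqrt ?_
  have h1 : star (a * b) * (a * b) ≤ (‖a‖ ^ 2) • (star b * b) := by
    have := CStarAlgebra.star_left_conjugate_le_norm_smul (a := b) (b := star a * a)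
      (IsSelfAdjoint.star_mul_self a)
    rw [CStarRing.norm_star_mul_self, ← sq] at this
    simpa [star_mul, mul_assoc] using this
  have h2 := (Complex.le_def.1 (trace_mono hφ h1)).1
  rwa [← Complex.coe_smul, map_smul, smul_eq_mul, Complex.re_ofReal_mul] at h2

theorem traceNorm_one (hφ : φ ∈ traceSpace A) : traceNorm φ 1 = 1 := by
  rw [traceNorm, star_one, mul_one, hφ.1, Complex.one_re, Real.sqrt_one]

theorem traceNorm_le_norm (hφ : φ ∈ traceSpace A) (a : A) : traceNorm φ a ≤ ‖a‖ := by
  have := traceNorm_mul_le hφ a 1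
  rwa [mul_one, traceNorm_one hφ, mul_one] at this

theorem norm_trace_le_traceNorm (hφ : φ ∈ traceSpace A) (a : A) : ‖φ a‖ ≤ traceNorm φ a := by
  have := norm_trace_mul_le hφ 1 a
  rwa [one_mul, traceNorm_one hφ, one_mul] at this

theorem norm_trace_le (hφ : φ ∈ traceSpace A) (a : A) : ‖φ a‖ ≤ ‖a‖ :=
  (norm_trace_le_traceNorm hφ a).trans (traceNorm_le_norm hφ a)

theorem continuous_eval (a : A) : Continuous fun φ : WeakDual ℂ A => φ a :=
  WeakDual.eval_continuous a

theorem isClosed_traceSpace : IsClosed (traceSpace A) := by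
  have : traceSpace A = {φ | φ 1 = 1} ∩ ((⋂ a : A, {φ | 0 ≤ φ (star a * a)}) ∩
      ⋂ a : A, ⋂ b : A, {φ | φ (a * b) = φ (b * a)}) := by
    ext φ; simp [traceSpace]
  rw [this]
  refine (isClosed_eq (continuous_eval 1) continuous_const).inter
    ((isClosed_iInter fun a => isClosed_le continuous_const (continuous_eval _)).inter
    (isClosed_iInter fun a => isClosed_iInter fun b =>
      isClosed_eq (continuous_eval _) (continuous_eval _)))

theorem isCompact_traceSpace : IsCompact (traceSpace A) := by
  refine (WeakDual.isCompact_closedBall (𝕜 := ℂ) (E := A) 0 1).of_isClosed_subset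
    isClosed_traceSpace fun φ hφ => ?_
  simp only [Set.mem_preimage, mem_closedBall_zero_iff]
  refine ContinuousLinearMap.opNorm_le_bound _ zero_le_one fun a => ?_
  rw [one_mul]
  exact norm_trace_le hφ a

theorem weakDual_add_apply (φ ψ : WeakDual ℂ A) (a : A) : (φ + ψ) a = φ a + ψ a := rfl

theorem weakDual_real_smul_apply (r : ℝ) (φ : WeakDual ℂ A) (a : A) :
    (r • φ) a = (r : ℂ) * φ a := rfl

theorem weakDual_ext {φ ψ : WeakDual ℂ A} (h : ∀ a, φ a = ψ a) : φ = ψ := DFunLike.ext _ _ h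

theorem convex_traceSpace : Convex ℝ (traceSpace A) := by
  intro φ hφ ψ hψ s t hs ht hst
  refine ⟨?_, fun a => ?_, fun a b => ?_⟩
  · rw [weakDual_add_apply, weakDual_real_smul_apply, weakDual_real_smul_apply, hφ.1, hψ.1,
      mul_one, mul_one]
    exact_mod_cast hst
  · rw [weakDual_add_apply, weakDual_real_smul_apply, weakDual_real_smul_apply]
    exact add_nonneg (mul_nonneg (by exact_mod_cast hs) (hφ.2.1 a))
      (mul_nonneg (by exact_mod_cast ht) (hψ.2.1 a))
  · simp only [weakDual_add_apply, weakDual_real_smul_apply]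
    rw [hφ.2.2 a b, hψ.2.2 a b]

/-- Approximation criterion for the closure of a set of traces: as traces are contractive, the
values on a dense set suffice. -/
theorem mem_closure_of_approx {D : Set (WeakDual ℂ A)} (hD : D ⊆ traceSpace A)
    (hφ : φ ∈ traceSpace A) {S : Set A} (hS : Dense S)
    (h : ∀ F : Finset A, (F : Set A) ⊆ S → ∀ ε > 0, ∃ ψ ∈ D, ∀ a ∈ F, ‖ψ a - φ a‖ < ε) :
    φ ∈ closure D := by
  rw [mem_closure_iff_nhds]
  intro U hU
  have hind : Topology.IsInducing (fun (φ : WeakDual ℂ A) (a : A) => φ a) := ⟨rfl⟩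
  obtain ⟨V, hV, hVU⟩ := (hind.nhds_eq_comap φ ▸ hU : U ∈ comap _ _)
  rw [nhds_pi, Filter.mem_pi] at hV
  obtain ⟨I, hI, t, ht, htV⟩ := hV
  have h1 : ∃ ε > 0, ∀ a ∈ I, Metric.ball (φ a) ε ⊆ t a := by
    choose e he using fun a => Metric.mem_nhds_iff.1 (ht a)
    obtain rfl | hne := I.eq_empty_or_nonempty
    · exact ⟨1, one_pos, by simp⟩
    · have hne' : hI.toFinset.Nonempty := by simpa using hne
      refine ⟨hI.toFinset.inf' hne' e, ?_, fun a ha => ?_⟩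
      · rw [gt_iff_lt, Finset.lt_inf'_iff]; exact fun a _ => (he a).1
      · exact (Metric.ball_subset_ball (Finset.inf'_le _ (by simpa using ha))).trans (he a).2
  obtain ⟨ε, hε, hball⟩ := h1
  have h2 : ∀ a : A, ∃ b ∈ S, ‖a - b‖ < ε / 4 := fun a => by
    obtain ⟨b, hb, hab⟩ := hS.exists_dist_lt a (by positivity : 0 < ε / 4)
    exact ⟨b, hb, by rwa [← dist_eq_norm]⟩
  choose g hgS hg using h2
  classical
  obtain ⟨ψ, hψ, hψF⟩ := h (hI.toFinset.image g) (by
    intro x hx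
    obtain ⟨a, -, rfl⟩ := Finset.mem_image.1 (Finset.mem_coe.1 hx)
    exact hgS a) (ε / 4) (by positivity)
  refine ⟨ψ, hVU (htV ?_), hψ⟩
  intro a ha
  refine hball a ha ?_
  rw [Metric.mem_ball, dist_eq_norm]
  have e1 : ψ a - φ a = ψ (a - g a) + (ψ (g a) - φ (g a)) - φ (a - g a) := by
    simp only [map_sub]; ring
  have e2 := hψF (g a) (Finset.mem_image_of_mem _ (by simpa using ha))
  have e3 := norm_trace_le (hD hψ) (a - g a)
  have e4 := norm_trace_le hφ (a - g a)
  calc ‖ψ a - φ a‖ ≤ ‖ψ (a - g a)‖ + ‖ψ (g a) - φ (g a)‖ + ‖φ (a - g a)‖ := by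
        rw [e1]; exact (norm_sub_le _ _).trans (by gcongr; exact norm_add_le _ _)
    _ < ε := by linarith [hg a]

end TraceBasics

open MeasureTheory

/-! ### Central sequences in extreme traces -/

section Averaging

variable {A : Type*} [CStarAlgebra A] {φ ψ : WeakDual ℂ A}

theorem traceNorm_parallelogram (hφ : φ ∈ traceSpace A) (x y : A) :
    traceNorm φ (x - y) ^ 2 = 2 * traceNorm φ x ^ 2 + 2 * traceNorm φ y ^ 2
      - 4 * traceNorm φ ((1 / 2 : ℝ) • x + (1 / 2 : ℝ) • y) ^ 2 := by
  have h : (1 / 2 : ℝ) • x + (1 / 2 : ℝ) • y = (1 / 2 : ℂ) • (x + y) := by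
    rw [← smul_add, ← Complex.coe_smul]; norm_num
  rw [h, traceNorm_smul, mul_pow]
  simp only [traceNorm_sq hφ, star_add, star_sub, add_mul, mul_add, sub_mul, mul_sub, map_add,
    map_sub, Complex.add_re, Complex.sub_re]
  norm_num
  ring

/-- The convex hull of the unitary orbit of `a`. -/
def unitaryHull (a : A) : Set A :=
  convexHull ℝ (Set.range fun u : unitary A => (u : A) * a * star (u : A))

theorem unitaryHull_subset {a : A} {s : Set A} (hs : Convex ℝ s)
    (h : ∀ u ∈ unitary A, u * a * star u ∈ s) : unitaryHull a ⊆ s :=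
  convexHull_min (by rintro _ ⟨u, rfl⟩; exact h u u.2) hs

theorem conj_mem_unitaryHull {a x : A} (hx : x ∈ unitaryHull a) {v : A} (hv : v ∈ unitary A) :
    v * x * star v ∈ unitaryHull a := by
  have : unitaryHull a ⊆ {x | v * x * star v ∈ unitaryHull a} := by
    refine unitaryHull_subset ?_ fun u hu => subset_convexHull ℝ _ ⟨⟨v * u, mul_mem hv hu⟩, ?_⟩
    · intro x hx y hy s t hs ht hst
      have := convex_convexHull ℝ _ hx hy hs ht hst
      simpa [unitaryHull, mul_add, add_mul] using this
    · simp [mul_assoc]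
  exact this hx

theorem isSelfAdjoint_of_mem_unitaryHull {a x : A} (ha : IsSelfAdjoint a)
    (hx : x ∈ unitaryHull a) : IsSelfAdjoint x := by
  refine unitaryHull_subset (s := {x | IsSelfAdjoint x}) ?_ (fun u _ => ?_) hx
  · intro x hx y hy s t _ _ _
    exact (IsSelfAdjoint.smul (.all s) hx).add (IsSelfAdjoint.smul (.all t) hy)
  · simpa using ha.conjugate u

theorem norm_le_of_mem_unitaryHull {a x : A} (hx : x ∈ unitaryHull a) : ‖x‖ ≤ ‖a‖ := by
  have h := unitaryHull_subset (a := a) (convex_closedBall (0 : A) ‖a‖) (fun u hu => by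
    rw [mem_closedBall_zero_iff, CStarRing.norm_mul_mem_unitary _ (Unitary.star_mem hu),
      CStarRing.norm_mem_unitary_mul _ hu]) hx
  simpa using h

theorem trace_eq_of_mem_unitaryHull {a x : A} (hx : x ∈ unitaryHull a) (hψ : ψ ∈ traceSpace A) :
    ψ x = ψ a := by
  refine unitaryHull_subset (s := {x | ψ x = ψ a}) ?_ (fun u hu => ?_) hx
  · intro x hx y hy s t _ _ hst
    simp only [Set.mem_ofPred_eq] at hx hy ⊢
    rw [map_add, ← Complex.coe_smul, ← Complex.coe_smul, map_smul, map_smul, hx, hy, ← add_smul]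
    rw_mod_cast [hst]
    simp
  · change ψ (u * a * star u) = ψ a
    rw [trace_comm hψ, ← mul_assoc, Unitary.star_mul_self_of_mem hu, one_mul]

/-- A sequence of unitary averages of `a` which converges, fast in the `L²`-seminorm of `φ`, to an
element that commutes with everything: a minimising sequence for the `L²`-seminorm on the convex
hull of the unitary orbit. -/
theorem exists_central_sequence (hφ : φ ∈ traceSpace A) {a : A} (ha : IsSelfAdjoint a) :
    ∃ c : ℕ → A, (∀ n, IsSelfAdjoint (c n)) ∧ (∀ n, ‖c n‖ ≤ ‖a‖) ∧
      (∀ n, ∀ ψ ∈ traceSpace A, ψ (c n) = ψ a) ∧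
      (∀ n, traceNorm φ (c (n + 1) - c n) ^ 2 ≤ 4 * (1 / 4) ^ n) ∧
      ∀ u ∈ unitary A, ∀ n, traceNorm φ (c n * u - u * c n) ^ 2 ≤ 4 * (1 / 4) ^ n := by
  set q : A → ℝ := fun x => traceNorm φ x ^ 2 with hq
  have hmem : a ∈ unitaryHull a := subset_convexHull ℝ _ ⟨1, by simp⟩
  have hbdd : BddBelow (q '' unitaryHull a) := ⟨0, by rintro _ ⟨x, -, rfl⟩; positivity⟩
  -- By the parallelogram identity, two elements of the hull which almost minimise `q` are close.
  set m := sInf (q '' unitaryHull a) with hm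
  have key : ∀ {x y : A} {δ : ℝ}, x ∈ unitaryHull a → y ∈ unitaryHull a → q x ≤ m + δ →
      q y ≤ m + δ → q (x - y) ≤ 4 * δ := by
    intro x y δ hx hy h1 h2
    have h3 : m ≤ q ((1 / 2 : ℝ) • x + (1 / 2 : ℝ) • y) :=
      csInf_le hbdd ⟨_, convex_convexHull ℝ _ hx hy (by norm_num) (by norm_num) (by norm_num), rfl⟩
    have h4 := traceNorm_parallelogram hφ x y
    simp only [hq] at *
    linarith
  have hex : ∀ n : ℕ, ∃ x ∈ unitaryHull a, q x ≤ m + (1 / 4) ^ n := fun n => by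
    obtain ⟨_, ⟨x, hx, rfl⟩, h⟩ := exists_lt_of_csInf_lt (s := q '' unitaryHull a)
      ⟨_, a, hmem, rfl⟩ (show m < m + (1 / 4) ^ n from lt_add_of_pos_right _ (by positivity))
    exact ⟨x, hx, h.le⟩
  choose c hc hcq using hex
  refine ⟨c, fun n => isSelfAdjoint_of_mem_unitaryHull ha (hc n),
    fun n => norm_le_of_mem_unitaryHull (hc n),
    fun n ψ hψ => trace_eq_of_mem_unitaryHull (hc n) hψ, fun n => ?_, fun u hu n => ?_⟩
  · refine key (hc _) (hc n) ((hcq (n + 1)).trans ?_) (hcq n)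
    have : ((1 / 4 : ℝ)) ^ (n + 1) ≤ (1 / 4) ^ n :=
      pow_le_pow_of_le_one (by norm_num) (by norm_num) (Nat.le_succ n)
    linarith
  · have h1 : q (u * c n * star u) = q (c n) := by
      simp only [hq, traceNorm_sq hφ]
      have : star (u * c n * star u) * (u * c n * star u)
          = u * (star (c n) * c n * star u) := by
        simp only [star_mul, star_star, mul_assoc]
        rw [← mul_assoc (star u) u, Unitary.star_mul_self_of_mem hu, one_mul]
      rw [this, trace_comm hφ, mul_assoc, Unitary.star_mul_self_of_mem hu, mul_one]
    -- A unitary conjugate of `c n` lies in the hull and has the same seminorm, hence is close to `c n`.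
    have h2 := key (hc n) (conj_mem_unitaryHull (hc n) hu) (hcq n) (h1.le.trans (hcq n))
    refine le_trans (le_of_eq ?_) h2
    have h3 : c n * u - u * c n = (c n - u * c n * star u) * u := by
      rw [sub_mul, mul_assoc _ (star u), Unitary.star_mul_self_of_mem hu, mul_one]
    simp only [hq]
    generalize c n - u * c n * star u = x at h3
    rw [h3, traceNorm_sq hφ, traceNorm_sq hφ, star_mul, mul_assoc, trace_comm hφ, mul_assoc,
      mul_assoc, Unitary.mul_star_self_of_mem hu, mul_one]

/-- The functional `ψ(c ·)` is dominated by `‖c‖ ψ`. -/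
theorem norm_trace_mul_star_mul_self_le (hψ : ψ ∈ traceSpace A) {c : A} (b : A) :
    ‖ψ (c * (star b * b))‖ ≤ ‖c‖ * (ψ (star b * b)).re := by
  rw [← mul_assoc, ← traceNorm_sq hψ, sq, ← mul_assoc]
  refine (norm_trace_mul_le hψ _ _).trans
    (mul_le_mul_of_nonneg_right ?_ (traceNorm_nonneg _ _))
  rw [← traceNorm_star hψ b]
  exact traceNorm_mul_le hψ c (star b)

end Averaging

section ExtremeTrace

variable {A : Type*} [CStarAlgebra A] {φ ψ : WeakDual ℂ A}

/-- Completeness of the GNS space, without reference to it. -/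
theorem traceNorm_cauchy_of_summable (hψ : ψ ∈ traceSpace A) {c : ℕ → A}
    (h : Summable fun n => traceNorm ψ (c (n + 1) - c n)) {ε : ℝ} (hε : 0 < ε) :
    ∃ N, ∀ m ≥ N, ∀ n ≥ N, traceNorm ψ (c m - c n) < ε := by
  let := CStarAlgebra.spectralOrder A
  have := CStarAlgebra.spectralOrderedRing A
  have h1 : CauchySeq fun n => (tracePositive ⟨ψ, hψ⟩).toPreGNS (c n) := by
    refine cauchySeq_of_summable_dist (h.congr fun n => ?_)
    rw [dist_comm, dist_eq_norm]
    rfl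
  obtain ⟨N, hN⟩ := Metric.cauchySeq_iff.1 h1 ε hε
  refine ⟨N, fun m hm n hn => ?_⟩
  have := hN m hm n hn
  rw [dist_eq_norm] at this
  exact this

/-- In an extreme trace, a bounded self-adjoint sequence that converges in `L²` and asymptotically
commutes with the algebra decorrelates from every element: its `L²`-limit times the trace is a
tracial functional dominated by the trace. -/
theorem tendsto_extreme_mul (hψ : ψ ∈ Set.extremePoints ℝ (traceSpace A)) {c : ℕ → A} {M : ℝ}
    (hsa : ∀ n, IsSelfAdjoint (c n)) (hM : ∀ n, ‖c n‖ ≤ M) {α : ℝ} (hα : ∀ n, ψ (c n) = α)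
    (hcau : Summable fun n => traceNorm ψ (c (n + 1) - c n)) {S : Set A} (hS : Dense S)
    (hcomm : ∀ b ∈ S, Tendsto (fun n => traceNorm ψ (c n * b - b * c n)) atTop (𝓝 0)) (b : A) :
    Tendsto (fun n => ψ (c n * b)) atTop (𝓝 (α * ψ b)) := by
  have hT := hψ.1
  have hM0 : 0 ≤ M := (norm_nonneg _).trans (hM 0)
  -- The functionals `ψ(c n ·)` converge pointwise; `ω` denotes the limit.
  let g : ℕ → A →L[ℂ] ℂ := fun n => (WeakDual.toStrongDual ψ).comp (ContinuousLinearMap.mul ℂ A (c n))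
  have hg : ∀ n b, g n b = ψ (c n * b) := fun n b => rfl
  have hlim : ∀ b, ∃ y, Tendsto (fun n => g n b) atTop (𝓝 y) := fun b => by
    refine cauchySeq_tendsto_of_complete (Metric.cauchySeq_iff.2 fun ε hε => ?_)
    obtain ⟨N, hN⟩ := traceNorm_cauchy_of_summable hT hcau
      (show 0 < ε / (‖b‖ + 1) by positivity)
    refine ⟨N, fun m hm n hn => ?_⟩
    rw [dist_eq_norm, hg, hg, ← map_sub, ← sub_mul]
    calc _ ≤ traceNorm ψ (c m - c n) * traceNorm ψ b := norm_trace_mul_le hT _ _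
      _ ≤ traceNorm ψ (c m - c n) * (‖b‖ + 1) := by
        gcongr
        · exact traceNorm_nonneg _ _
        · linarith [traceNorm_le_norm hT b]
      _ < ε := by rw [← lt_div_iff₀ (by positivity)]; exact hN m hm n hn
  choose f hf using hlim
  let ω : A →L[ℂ] ℂ := continuousLinearMapOfTendsto g (tendsto_pi_nhds.2 hf)
  have hω : ∀ b, Tendsto (fun n => ψ (c n * b)) atTop (𝓝 (ω b)) := hf
  -- `ω` is tracial
  have hcomm' : ∀ b ∈ S, ∀ b', ω (b * b') = ω (b' * b) := by
    intro b hb b'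
    have h1 : Tendsto (fun n => ψ (c n * (b * b')) - ψ (c n * (b' * b))) atTop
        (𝓝 (ω (b * b') - ω (b' * b))) := (hω _).sub (hω _)
    have h2 : Tendsto (fun n => ψ (c n * (b * b')) - ψ (c n * (b' * b))) atTop (𝓝 0) := by
      refine squeeze_zero_norm (a := fun n => traceNorm ψ (c n * b - b * c n) * traceNorm ψ b')
        (fun n => ?_) (by simpa using (hcomm b hb).mul_const (traceNorm ψ b'))
      have h3 : ψ (c n * (b * b')) - ψ (c n * (b' * b)) = ψ ((c n * b - b * c n) * b') := by
        rw [sub_mul, map_sub, mul_assoc, mul_assoc b, trace_comm hT b, ← mul_assoc (c n) b' b]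
      rw [h3]
      exact norm_trace_mul_le hT _ _
    exact sub_eq_zero.1 (tendsto_nhds_unique h1 h2)
  have hωtr : ∀ b b', ω (b * b') = ω (b' * b) := by
    intro b b'
    have hcl : IsClosed {b | ω (b * b') = ω (b' * b)} := isClosed_eq (by fun_prop) (by fun_prop)
    have := hcl.closure_subset_iff.2 (fun b hb => hcomm' b hb b')
    exact this (hS b)
  have hω1 : ω 1 = α := by
    have h1 := hω 1
    simp only [mul_one, hα] at h1
    exact tendsto_nhds_unique h1 tendsto_const_nhds
  have hωbd : ∀ b, ‖ω (star b * b)‖ ≤ M * (ψ (star b * b)).re := by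
    intro b
    refine le_of_tendsto (hω _).norm (Eventually.of_forall fun n => ?_)
    refine (norm_trace_mul_star_mul_self_le hT b).trans ?_
    exact mul_le_mul_of_nonneg_right (hM n) (Complex.nonneg_iff.1 (hT.2.1 b)).1
  have hωre : ∀ b, (ω (star b * b)).im = 0 := by
    intro b
    have h1 : ∀ n, (ψ (c n * (star b * b))).im = 0 := fun n => by
      have h2 := trace_star hT (c n * (star b * b))
      rw [star_mul, star_mul, star_star, (hsa n).star_eq, trace_comm hT] at h2
      exact Complex.conj_eq_iff_im.1 h2.symm
    have h2 := (Complex.continuous_im.tendsto _).comp (hω (star b * b))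
    simp only [Function.comp_def, h1] at h2
    exact tendsto_nhds_unique h2 tendsto_const_nhds
  have hαM : |α| ≤ M := by
    have := norm_trace_le hT (c 0)
    rw [hα, Complex.norm_real] at this
    exact this.trans (hM 0)
  -- The perturbations `ψ ± (ω - α ψ) / (2 (M + 1))` are traces.
  let D : WeakDual ℂ A := WeakDual.toStrongDual.symm ω - (α : ℂ) • ψ
  have hD : ∀ b, D b = ω b - α * ψ b := fun b => rfl
  have hpert : ∀ t : ℝ, |t| * (2 * (M + 1)) ≤ 1 → ψ + t • D ∈ traceSpace A := by
    intro t ht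
    refine ⟨?_, fun b => ?_, fun a b => ?_⟩
    · rw [weakDual_add_apply, weakDual_real_smul_apply, hD, hω1, hT.1]; simp
    · rw [weakDual_add_apply, weakDual_real_smul_apply, hD]
      have hp := Complex.nonneg_iff.1 (hT.2.1 b)
      rw [Complex.nonneg_iff]
      have e1 : (ω (star b * b)).re ≤ M * (ψ (star b * b)).re :=
        (Complex.re_le_norm _).trans (hωbd b)
      have e2 : -(M * (ψ (star b * b)).re) ≤ (ω (star b * b)).re :=
        (neg_le_neg (hωbd b)).trans (neg_le_of_abs_le (Complex.abs_re_le_norm _))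
      set p := (ψ (star b * b)).re
      set w := (ω (star b * b)).re
      have him : (ψ (star b * b)).im = 0 := hp.2.symm
      constructor
      · simp only [Complex.add_re, Complex.re_ofReal_mul, Complex.sub_re]
        have e3 : |w - α * p| ≤ 2 * M * p := by
          have := abs_le.1 hαM
          rw [abs_le]; constructor <;> nlinarith [hp.1]
        have e4 : |t * (w - α * p)| ≤ p := by
          rw [abs_mul]
          calc _ ≤ |t| * (2 * M * p) := by gcongr
            _ ≤ |t| * (2 * (M + 1) * p) := by
              gcongr
              · exact hp.1
              · linarith
            _ = |t| * (2 * (M + 1)) * p := by ring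
            _ ≤ 1 * p := by gcongr; exact hp.1
            _ = p := one_mul p
        linarith [(abs_le.1 e4).1]
      · simp [him, hωre]
    · simp only [weakDual_add_apply, weakDual_real_smul_apply, hD, hωtr a b, hT.2.2 a b]
  set t : ℝ := 1 / (2 * (M + 1)) with htdef
  have ht0 : 0 < t := by positivity
  have ht1 : |t| * (2 * (M + 1)) ≤ 1 := by
    rw [abs_of_pos ht0, htdef]; field_simp; rfl
  -- As `ψ` is the midpoint of `ψ + t D` and `ψ - t D`, extremality forces `D = 0`.
  have h1 := hψ.2 (hpert t ht1) (hpert (-t) (by rwa [abs_neg])) (by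
    refine ⟨1 / 2, 1 / 2, by norm_num, by norm_num, by norm_num, ?_⟩
    refine weakDual_ext fun b => ?_
    simp only [weakDual_add_apply, weakDual_real_smul_apply]
    push_cast
    ring)
  have h2 : D b = 0 := by
    have h3 := DFunLike.congr_fun h1 b
    rw [weakDual_add_apply, weakDual_real_smul_apply, add_eq_left, mul_eq_zero] at h3
    exact h3.resolve_left (by exact_mod_cast ht0.ne')
  rw [hD, sub_eq_zero] at h2
  rw [← h2]
  exact hω b

/-- In an extreme trace `ψ`, an asymptotically central sequence as in `tendsto_extreme_mul`
converges in `L²` to a scalar: decorrelation of `c n` from `c N` gives `ψ(c n²) → ψ(c n)²`. -/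
theorem tendsto_extreme_scalar (hψ : ψ ∈ Set.extremePoints ℝ (traceSpace A)) {c : ℕ → A} {M : ℝ}
    (hsa : ∀ n, IsSelfAdjoint (c n)) (hM : ∀ n, ‖c n‖ ≤ M) {α : ℝ} (hα : ∀ n, ψ (c n) = α)
    (hcau : Summable fun n => traceNorm ψ (c (n + 1) - c n)) {S : Set A} (hS : Dense S)
    (hcomm : ∀ b ∈ S, Tendsto (fun n => traceNorm ψ (c n * b - b * c n)) atTop (𝓝 0)) :
    Tendsto (fun n => traceNorm ψ (c n - (α : ℂ) • 1)) atTop (𝓝 0) := by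
  have hT := hψ.1
  have hM0 : 0 ≤ M := (norm_nonneg _).trans (hM 0)
  have hsq : ∀ n, traceNorm ψ (c n - (α : ℂ) • 1) ^ 2 = (ψ (c n * c n)).re - α ^ 2 := fun n => by
    rw [traceNorm_sq hT, star_sub, star_smul, star_one, (hsa n).star_eq]
    simp only [sub_mul, mul_sub, smul_mul_assoc, one_mul, mul_smul_comm, mul_one, map_sub, map_smul,
      hα, hT.1, Complex.star_def, Complex.conj_ofReal, smul_eq_mul, Complex.sub_re,
      Complex.re_ofReal_mul, Complex.ofReal_re]
    simp
    ring
  have hlim : Tendsto (fun n => (ψ (c n * c n)).re - α ^ 2) atTop (𝓝 0) := by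
    rw [Metric.tendsto_atTop]
    intro ε hε
    obtain ⟨N, hN⟩ := traceNorm_cauchy_of_summable hT hcau (show 0 < ε / (2 * (M + 1)) by positivity)
    have h1 := tendsto_extreme_mul hψ hsa hM hα hcau hS hcomm (c N)
    rw [hα] at h1
    obtain ⟨N', hN'⟩ := Metric.tendsto_atTop.1 h1 (ε / 2) (by positivity)
    refine ⟨max N N', fun n hn => ?_⟩
    have h2 := hN' n (le_of_max_le_right hn)
    have h3 := hN n (le_of_max_le_left hn) N le_rfl
    rw [dist_eq_norm] at h2
    have h4 : ‖ψ (c n * (c n - c N))‖ ≤ ε / 2 := by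
      refine (norm_trace_mul_le hT _ _).trans ?_
      calc _ ≤ (M + 1) * (ε / (2 * (M + 1))) := by
            gcongr
            · exact traceNorm_nonneg _ _
            · linarith [(traceNorm_le_norm hT (c n)).trans (hM n)]
        _ = ε / 2 := by field_simp
    rw [dist_zero_right, Real.norm_eq_abs]
    have h5 : (ψ (c n * c n)).re - α ^ 2
        = (ψ (c n * (c n - c N)) + (ψ (c n * c N) - α * α)).re := by
      rw [mul_sub, map_sub, sub_add_sub_cancel, Complex.sub_re, Complex.re_ofReal_mul,
        Complex.ofReal_re, sq]
    rw [h5]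
    refine (Complex.abs_re_le_norm _).trans_lt ((norm_add_le _ _).trans_lt ?_)
    linarith
  have h := (Real.continuous_sqrt.tendsto _).comp hlim
  rw [Real.sqrt_zero] at h
  refine h.congr fun n => ?_
  rw [Function.comp_apply, ← hsq, Real.sqrt_sq (traceNorm_nonneg _ _)]

/-- Products of asymptotically scalar sequences are asymptotically the products of the scalars. -/
theorem tendsto_trace_list_prod (hψ : ψ ∈ traceSpace A) {ι : Type*} {c : ι → ℕ → A} {M α : ι → ℝ}
    (hM : ∀ i n, ‖c i n‖ ≤ M i) (l : List ι)
    (h : ∀ i ∈ l, Tendsto (fun n => traceNorm ψ (c i n - (α i : ℂ) • 1)) atTop (𝓝 0)) :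
    Tendsto (fun n => ψ (l.map (c · n)).prod) atTop (𝓝 ((l.map α).prod : ℝ)) := by
  induction l with
  | nil => simp [hψ.1]
  | cons i l ih =>
    simp only [List.mem_cons, forall_eq_or_imp] at h
    simp only [List.map_cons, List.prod_cons]
    have hb : ∃ B, ∀ n, ‖(l.map (c · n)).prod‖ ≤ B := by
      clear ih h
      induction l with
      | nil => exact ⟨‖(1 : A)‖, fun n => by simp⟩
      | cons j l ih =>
        obtain ⟨B, hB⟩ := ih
        refine ⟨M j * B, fun n => ?_⟩
        rw [List.map_cons, List.prod_cons]
        exact (norm_mul_le _ _).trans (mul_le_mul (hM j n) (hB n) (norm_nonneg _)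
          ((norm_nonneg _).trans (hM j n)))
    obtain ⟨B, hB⟩ := hb
    have h1 : Tendsto (fun n => ψ ((c i n - (α i : ℂ) • 1) * (l.map (c · n)).prod)) atTop (𝓝 0) := by
      refine squeeze_zero_norm (a := fun n => traceNorm ψ (c i n - (α i : ℂ) • 1) * B)
        (fun n => ?_) (by simpa using h.1.mul_const B)
      refine (norm_trace_mul_le hψ _ _).trans ?_
      exact mul_le_mul_of_nonneg_left ((traceNorm_le_norm hψ _).trans (hB n)) (traceNorm_nonneg _ _)
    have h2 := h1.add ((ih h.2).const_mul (α i : ℂ))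
    rw [zero_add] at h2
    push_cast
    push_cast at h2
    refine h2.congr fun n => ?_
    rw [sub_mul, map_sub, smul_mul_assoc, one_mul, map_smul, smul_eq_mul, sub_add_cancel]

end ExtremeTrace

/-! ### Measures on the extreme traces are determined by the barycenter -/

section BoundaryMeasure

variable {A : Type*} [CStarAlgebra A] {φ : WeakDual ℂ A}

/-- Real part of the evaluation at `a`, as a real continuous functional on the weak-* dual. -/
noncomputable def evalRe (a : A) : WeakDual ℂ A →L[ℝ] ℝ where
  toFun φ := (φ a).re
  map_add' φ ψ := by simp [weakDual_add_apply]
  map_smul' r φ := by simp [weakDual_real_smul_apply]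
  cont := Complex.continuous_re.comp (continuous_eval a)

theorem evalRe_apply (a : A) (φ : WeakDual ℂ A) : evalRe a φ = (φ a).re := rfl

variable {K : Set (WeakDual ℂ A)}

theorem continuous_traceNorm (a : A) : Continuous fun ψ : K => traceNorm (ψ : WeakDual ℂ A) a :=
  Real.continuous_sqrt.comp (Complex.continuous_re.comp
    ((continuous_eval _).comp continuous_subtype_val))

theorem continuous_evalRe (a : A) : Continuous fun ψ : K => evalRe a ψ :=
  (evalRe a).continuous.comp continuous_subtype_val

variable [MeasurableSpace K] [BorelSpace K] {μ : Measure K} [IsFiniteMeasure μ]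

theorem integrable_of_continuous [CompactSpace K] {f : K → ℝ} (hf : Continuous f) :
    Integrable f μ :=
  hf.integrable_of_hasCompactSupport (HasCompactSupport.of_compactSpace f)

/-- If the elements `x n` tend to zero geometrically in the `L²`-seminorm of the barycenter, then
their `L²`-seminorms are summable at almost every point. -/
theorem ae_summable_traceNorm [CompactSpace K] (hK : K ⊆ traceSpace A)
    (hbar : ∀ a : A, ∫ ψ : K, evalRe a (ψ : WeakDual ℂ A) ∂μ = (φ a).re)
    (hφ : φ ∈ traceSpace A) {x : ℕ → A}
    (hx : ∀ n, traceNorm φ (x n) ^ 2 ≤ 4 * (1 / 4) ^ n) :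
    ∀ᵐ ψ : K ∂μ, Summable fun n => traceNorm (ψ : WeakDual ℂ A) (x n) := by
  have hint : ∀ n, Integrable (fun ψ : K => traceNorm (ψ : WeakDual ℂ A) (x n)) μ :=
    fun n => integrable_of_continuous (continuous_traceNorm _)
  have h1 : ∀ n, ∫ ψ : K, traceNorm (ψ : WeakDual ℂ A) (x n) ∂μ
      ≤ (4 + μ.real Set.univ) * (1 / 2) ^ n := by
    intro n
    -- `t ≤ 2ⁿ t² + 2⁻ⁿ` turns the bound on the squares, whose integral is known, into a bound
    -- on the seminorms.
    have h2 : ∀ ψ : K, traceNorm (ψ : WeakDual ℂ A) (x n)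
        ≤ 2 ^ n * evalRe (star (x n) * x n) (ψ : WeakDual ℂ A) + (1 / 2) ^ n := fun ψ => by
      rw [evalRe_apply, ← traceNorm_sq (hK ψ.2)]
      set t := traceNorm (ψ : WeakDual ℂ A) (x n)
      have h3 : (2 : ℝ) ^ n * (1 / 2) ^ n = 1 := by rw [← mul_pow]; norm_num
      have h4 : (0 : ℝ) < 2 ^ n := by positivity
      have h5 : (0 : ℝ) < (1 / 2) ^ n := by positivity
      have h6 := mul_nonneg h4.le (sq_nonneg (t - (1 / 2) ^ n))
      have ht : 0 ≤ t := traceNorm_nonneg _ _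
      nlinarith
    have hint2 : Integrable (fun ψ : K => 2 ^ n * evalRe (star (x n) * x n) (ψ : WeakDual ℂ A)) μ :=
      (integrable_of_continuous (continuous_evalRe _)).const_mul _
    refine (integral_mono (hint n) (hint2.add (integrable_const _)) h2).trans ?_
    rw [integral_add' hint2 (integrable_const _), integral_const_mul, hbar, integral_const,
      ← traceNorm_sq hφ, smul_eq_mul, add_mul]
    refine add_le_add_left ?_ _
    calc _ ≤ (2 : ℝ) ^ n * (4 * (1 / 4) ^ n) := by gcongr; exact hx n
      _ = 4 * (1 / 2) ^ n := by
        rw [mul_left_comm, ← mul_pow]; norm_num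
  have h2 : ∫⁻ ψ : K, ∑' n, ENNReal.ofReal (traceNorm (ψ : WeakDual ℂ A) (x n)) ∂μ ≠ ⊤ := by
    rw [lintegral_tsum fun n => (continuous_traceNorm _).measurable.ennreal_ofReal.aemeasurable]
    have h3 : ∀ n, ∫⁻ ψ : K, ENNReal.ofReal (traceNorm (ψ : WeakDual ℂ A) (x n)) ∂μ
        ≤ ENNReal.ofReal ((4 + μ.real Set.univ) * (1 / 2) ^ n) := fun n => by
      rw [← ofReal_integral_eq_lintegral_ofReal (hint n)
        (Eventually.of_forall fun ψ => traceNorm_nonneg _ _)]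
      exact ENNReal.ofReal_le_ofReal (h1 n)
    refine ((ENNReal.tsum_le_tsum h3).trans_lt ?_).ne
    rw [← ENNReal.ofReal_tsum_of_nonneg (fun n => by positivity)
      (summable_geometric_two.mul_left _)]
    exact ENNReal.ofReal_lt_top
  have h3 := ae_lt_top (Measurable.tsum fun n =>
    (continuous_traceNorm (K := K) (x n)).measurable.ennreal_ofReal) h2
  filter_upwards [h3] with ψ hψ
  have := ENNReal.summable_toReal hψ.ne
  simpa [ENNReal.toReal_ofReal (traceNorm_nonneg _ _)] using this

variable [TopologicalSpace.SeparableSpace A]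

/-- The moments of a measure supported on extreme traces are determined by its barycenter. -/
theorem integral_prod_eq_of_extreme [CompactSpace K] (hK : K ⊆ traceSpace A)
    (hbar : ∀ a : A, ∫ ψ : K, evalRe a (ψ : WeakDual ℂ A) ∂μ = (φ a).re)
    (hφ : φ ∈ traceSpace A)
    (hext : ∀ᵐ ψ : K ∂μ, (ψ : WeakDual ℂ A) ∈ Set.extremePoints ℝ (traceSpace A))
    {c : selfAdjoint A → ℕ → A}
    (hsa : ∀ a n, IsSelfAdjoint (c a n)) (hM : ∀ a n, ‖c a n‖ ≤ ‖a‖)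
    (htr : ∀ a n, ∀ ψ ∈ traceSpace A, ψ (c a n) = ψ a)
    (hcau : ∀ a n, traceNorm φ (c a (n + 1) - c a n) ^ 2 ≤ 4 * (1 / 4) ^ n)
    (hcomm : ∀ a, ∀ u ∈ unitary A, ∀ n,
      traceNorm φ (c a n * u - u * c a n) ^ 2 ≤ 4 * (1 / 4) ^ n) (l : List (selfAdjoint A)) :
    Tendsto (fun n => (φ (l.map (c · n)).prod).re) atTop
      (𝓝 (∫ ψ : K, (l.map fun a : selfAdjoint A => evalRe (a : A) (ψ : WeakDual ℂ A)).prod ∂μ)) := by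
  obtain ⟨S, hSc, hSd⟩ := TopologicalSpace.exists_countable_dense A
  -- At almost every `ψ` the central sequences converge to scalars; by separability it suffices to
  -- consider commutators with countably many elements.
  have hae : ∀ᵐ ψ : K ∂μ, ∀ a ∈ {a | a ∈ l},
      Tendsto (fun n => traceNorm (ψ : WeakDual ℂ A)
        (c a n - ((evalRe (a : A) (ψ : WeakDual ℂ A) : ℝ) : ℂ) • 1)) atTop (𝓝 0) := by
    refine (ae_ball_iff (List.finite_toSet l).countable).2 fun a _ => ?_
    -- Every element of the algebra is a linear combination of unitaries.
    have hcomm' : ∀ b : A, ∀ᵐ ψ : K ∂μ,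
        Tendsto (fun n => traceNorm (ψ : WeakDual ℂ A) (c a n * b - b * c a n)) atTop (𝓝 0) := by
      intro b
      have hb : b ∈ Submodule.span ℂ (unitary A : Set A) := by
        rw [CStarAlgebra.span_unitary]; trivial
      induction hb using Submodule.span_induction with
      | mem u hu =>
        filter_upwards [ae_summable_traceNorm hK hbar hφ (hcomm a u hu)] with ψ hψ
        exact hψ.tendsto_atTop_zero
      | zero => exact Eventually.of_forall fun ψ => by simp [traceNorm]
      | add x y _ _ hx hy =>
        filter_upwards [hx, hy] with ψ hx hy
        refine squeeze_zero (fun n => traceNorm_nonneg _ _) (fun n => ?_)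
          (by simpa using hx.add hy)
        rw [show c a n * (x + y) - (x + y) * c a n
          = (c a n * x - x * c a n) + (c a n * y - y * c a n) by noncomm_ring]
        exact traceNorm_add_le (hK ψ.2) _ _
      | smul z x _ hx =>
        filter_upwards [hx] with ψ hx
        have h := hx.const_mul ‖z‖
        rw [mul_zero] at h
        refine h.congr fun n => ?_
        rw [← traceNorm_smul, smul_sub, mul_smul_comm, smul_mul_assoc]
    filter_upwards [hext, ae_summable_traceNorm hK hbar hφ (hcau a),
      (ae_ball_iff hSc).2 fun b _ => hcomm' b] with ψ h1 h2 h3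
    refine tendsto_extreme_scalar h1 (hsa a) (hM a) (fun n => ?_) h2 hSd h3
    rw [htr a n _ (hK ψ.2), evalRe_apply, ← trace_eq_re (hK ψ.2) a.2]
  have h1 : ∀ n, (φ (l.map (c · n)).prod).re
      = ∫ ψ : K, evalRe (l.map (c · n)).prod (ψ : WeakDual ℂ A) ∂μ := fun n => (hbar _).symm
  simp_rw [h1]
  obtain ⟨B, hB⟩ : ∃ B, ∀ n, ‖(l.map (c · n)).prod‖ ≤ B := by
    clear hae h1
    induction l with
    | nil => exact ⟨‖(1 : A)‖, fun n => by simp⟩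
    | cons j l ih =>
      obtain ⟨B, hB⟩ := ih
      refine ⟨‖j‖ * B, fun n => ?_⟩
      rw [List.map_cons, List.prod_cons]
      exact (norm_mul_le _ _).trans (mul_le_mul (hM j n) (hB n) (norm_nonneg _)
        (norm_nonneg _))
  refine tendsto_integral_of_dominated_convergence (fun _ => B)
    (fun n => (continuous_evalRe _).aestronglyMeasurable) (integrable_const _)
    (fun n => Eventually.of_forall fun ψ => ?_) ?_
  · rw [evalRe_apply, Real.norm_eq_abs]
    exact (Complex.abs_re_le_norm _).trans ((norm_trace_le (hK ψ.2) _).trans (hB n))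
  · filter_upwards [hae] with ψ hψ
    have := tendsto_trace_list_prod (hK ψ.2) hM l hψ
    exact (Complex.continuous_re.tendsto _).comp this

/-- A trace is the barycenter of at most one measure supported on extreme traces. -/
theorem eq_of_barycenter_eq [CompactSpace K] (hK : K ⊆ traceSpace A) (hφ : φ ∈ traceSpace A)
    {ν : Measure K} [IsFiniteMeasure ν]
    (hμ : ∀ a : A, ∫ ψ : K, evalRe a (ψ : WeakDual ℂ A) ∂μ = (φ a).re)
    (hν : ∀ a : A, ∫ ψ : K, evalRe a (ψ : WeakDual ℂ A) ∂ν = (φ a).re)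
    (hμe : ∀ᵐ ψ : K ∂μ, (ψ : WeakDual ℂ A) ∈ Set.extremePoints ℝ (traceSpace A))
    (hνe : ∀ᵐ ψ : K ∂ν, (ψ : WeakDual ℂ A) ∈ Set.extremePoints ℝ (traceSpace A)) : μ = ν := by
  have : TopologicalSpace.MetrizableSpace K :=
    WeakDual.metrizable_of_isCompact ℂ A K (isCompact_iff_compactSpace.2 inferInstance)
  choose c hsa hM htr hcau hcomm using fun a : selfAdjoint A => exists_central_sequence hφ a.2
  have hlist : ∀ l : List (selfAdjoint A),
      ∫ ψ : K, (l.map fun a : selfAdjoint A => evalRe (a : A) (ψ : WeakDual ℂ A)).prod ∂μ =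
      ∫ ψ : K, (l.map fun a : selfAdjoint A => evalRe (a : A) (ψ : WeakDual ℂ A)).prod ∂ν := fun l =>
    tendsto_nhds_unique
      (integral_prod_eq_of_extreme hK hμ hφ hμe hsa hM htr hcau hcomm l)
      (integral_prod_eq_of_extreme hK hν hφ hνe hsa hM htr hcau hcomm l)
  let ev : selfAdjoint A → C(K, ℝ) := fun a => ⟨_, continuous_evalRe (a : A)⟩
  let 𝒜 : Subalgebra ℝ C(K, ℝ) := Algebra.adjoin ℝ (Set.range ev)
  -- By the Stone–Weierstrass theorem the polynomials in the evaluations are dense in `C(K)`, and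
  -- `hlist` is the equality of the integrals of monomials.
  have hsep : 𝒜.SeparatesPoints := by
    intro ψ χ hne
    by_contra hcon
    refine hne (Subtype.ext (weakDual_ext fun a => ?_))
    have hreal : ∀ a : selfAdjoint A, ψ.1 (a : A) = χ.1 (a : A) := fun a => by
      rw [trace_eq_re (hK ψ.2) a.2, trace_eq_re (hK χ.2) a.2]
      by_contra h
      refine hcon ⟨_, ⟨ev a, Algebra.subset_adjoin ⟨a, rfl⟩, rfl⟩, fun h' => h ?_⟩
      exact congrArg _ h'
    rw [← realPart_add_I_smul_imaginaryPart a, map_add, map_add, map_smul, map_smul, hreal, hreal]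
  have hdense : 𝒜.topologicalClosure = ⊤ :=
    ContinuousMap.subalgebra_topologicalClosure_eq_top_of_separatesPoints 𝒜 hsep
  have hintc : ∀ (ρ : Measure K) [IsFiniteMeasure ρ],
      Continuous fun f : C(K, ℝ) => ∫ ψ, f ψ ∂ρ := fun ρ _ => by
    refine (LipschitzWith.of_dist_le_mul (K := (ρ Set.univ).toNNReal) fun f g => ?_).continuous
    have hf := integrable_of_continuous (μ := ρ) f.continuous
    have hg := integrable_of_continuous (μ := ρ) g.continuous
    rw [dist_eq_norm, ← integral_sub hf hg, mul_comm]
    refine norm_integral_le_of_norm_le_const (Eventually.of_forall fun ψ => ?_)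
    rw [← dist_eq_norm]
    exact ContinuousMap.dist_apply_le_dist ψ
  have hmem : ∀ f ∈ 𝒜, ∫ ψ, f ψ ∂μ = ∫ ψ, f ψ ∂ν := by
    intro f hf
    rw [← Subalgebra.mem_toSubmodule, Algebra.adjoin_eq_span] at hf
    induction hf using Submodule.span_induction with
    | mem f hf =>
      obtain ⟨L, hL, rfl⟩ := Submonoid.exists_list_of_mem_closure hf
      have : ∃ l : List (selfAdjoint A), l.map ev = L := by
        clear hf
        induction L with
        | nil => exact ⟨[], rfl⟩
        | cons f L ih =>
          obtain ⟨l, hl⟩ := ih fun g hg => hL g (List.mem_cons_of_mem _ hg)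
          obtain ⟨a, ha⟩ := hL f List.mem_cons_self
          exact ⟨a :: l, by simp [hl, ha]⟩
      obtain ⟨l, rfl⟩ := this
      have h : ∀ ψ : K, (l.map ev).prod ψ
          = (l.map fun a : selfAdjoint A => evalRe (a : A) (ψ : WeakDual ℂ A)).prod := fun ψ => by
        clear hL hf
        induction l with
        | nil => rfl
        | cons a l ih => simp only [List.map_cons, List.prod_cons, ContinuousMap.mul_apply, ih]; rfl
      simp_rw [h]
      exact hlist l
    | zero => simp
    | add f g _ _ hf hg =>
      simp only [ContinuousMap.add_apply]
      rw [integral_add (integrable_of_continuous f.continuous)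
        (integrable_of_continuous g.continuous), integral_add
        (integrable_of_continuous f.continuous) (integrable_of_continuous g.continuous), hf, hg]
    | smul r f _ hf =>
      simp only [ContinuousMap.smul_apply]
      rw [integral_smul, integral_smul, hf]
  refine ext_of_forall_integral_eq_of_IsFiniteMeasure fun f => ?_
  have hcl : IsClosed {f : C(K, ℝ) | ∫ ψ, f ψ ∂μ = ∫ ψ, f ψ ∂ν} := isClosed_eq (hintc μ) (hintc ν)
  have h : f.toContinuousMap ∈ 𝒜.topologicalClosure := hdense ▸ Algebra.mem_top
  exact hcl.closure_subset_iff.2 hmem h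

end BoundaryMeasure

/-! ### Existence of boundary measures -/

section Choquet

/-- A point of a convex set that is not extreme is the midpoint of two distinct points. -/
theorem exists_midpoint_of_notMem_extremePoints {E : Type*} [AddCommGroup E] [Module ℝ E]
    {K : Set E} (hK : Convex ℝ K) {m : E} (hm : m ∈ K) (h : m ∉ Set.extremePoints ℝ K) :
    ∃ y ∈ K, ∃ z ∈ K, y ≠ z ∧ m + m = y + z := by
  simp only [Set.extremePoints, Set.mem_ofPred_eq, not_and, not_forall] at h
  obtain ⟨x₁, h₁, x₂, h₂, ⟨s, t, hs, ht, hst, rfl⟩, hne⟩ := h hm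
  have hx : x₁ ≠ x₂ := by
    rintro rfl
    exact hne (by rw [← add_smul, hst, one_smul])
  obtain ⟨r, hr, hrs, hrt⟩ : ∃ r : ℝ, 0 < r ∧ r ≤ s ∧ r ≤ t :=
    ⟨min s t, lt_min hs ht, min_le_left _ _, min_le_right _ _⟩
  refine ⟨(s + r) • x₁ + (t - r) • x₂, hK h₁ h₂ (by linarith) (by linarith) (by linarith),
    (s - r) • x₁ + (t + r) • x₂, hK h₁ h₂ (by linarith) (by linarith) (by linarith), ?_, by module⟩
  intro heq
  have h3 : (2 * r) • (x₁ - x₂) = 0 := by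
    rw [← sub_eq_zero] at heq
    rw [← heq]; module
  rw [smul_eq_zero, sub_eq_zero] at h3
  exact h3.elim (by positivity) hx

variable {X : Type*} [TopologicalSpace X] [CompactSpace X] [TopologicalSpace.MetrizableSpace X]
  [MeasurableSpace X] [BorelSpace X]

/-- Splitting a fixed proportion of a measure by a (not necessarily measurable) choice of pairs:
if every point `y` is assigned a pair `σ y` then some measure `ν` satisfies, for all continuous
`g` that do not change under the splitting, `∫ g dν = ∫ g dμ`, and increases the integral
of `f` if the splitting increases `f` on a closed set of positive measure. -/
theorem exists_split_measure (μ : ProbabilityMeasure X) {F : Set X} (hF : IsClosed F)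
    (σ₁ σ₂ : X → X) {f : C(X, ℝ)} {δ : ℝ}
    (hσ : ∀ y, 2 * f y ≤ f (σ₁ y) + f (σ₂ y)) (hσF : ∀ y ∈ F, 2 * f y + δ ≤ f (σ₁ y) + f (σ₂ y)) :
    ∃ ν : ProbabilityMeasure X,
      (∀ g : C(X, ℝ), (∀ y, g (σ₁ y) + g (σ₂ y) = 2 * g y) →
        ∫ y, g y ∂(ν : Measure X) = ∫ y, g y ∂(μ : Measure X)) ∧
      ∫ y, f y ∂(μ : Measure X) + δ / 2 * (μ : Measure X).real F
        ≤ ∫ y, f y ∂(ν : Measure X) := by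
  classical
  let := TopologicalSpace.metrizableSpaceMetric X
  have hne : Nonempty X := (μ : Measure X).nonempty_of_neZero
  obtain ⟨y₀⟩ := hne
  -- As the maps `σ₁` and `σ₂` need not be measurable, they are composed with simple functions `s k`
  -- which converge to the identity and preserve `F`.
  obtain ⟨s, hs, hsF⟩ : ∃ s : ℕ → SimpleFunc X X,
      (∀ y, Tendsto (fun k => s k y) atTop (𝓝 y)) ∧ ∀ k, ∀ y ∈ F, s k y ∈ F := by
    let a : ℕ → SimpleFunc X X :=
      SimpleFunc.approxOn id measurable_id Set.univ y₀ (Set.mem_univ y₀)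
    have ha : ∀ y, Tendsto (fun k => a k y) atTop (𝓝 y) := fun y =>
      SimpleFunc.tendsto_approxOn measurable_id (Set.mem_univ y₀) (by simp)
    obtain rfl | ⟨y₁, hy₁⟩ := F.eq_empty_or_nonempty
    · exact ⟨a, ha, by simp⟩
    · let b : ℕ → SimpleFunc X X := SimpleFunc.approxOn id measurable_id F y₁ hy₁
      refine ⟨fun k => SimpleFunc.piecewise F hF.measurableSet (b k) (a k), fun y => ?_,
        fun k y hy => ?_⟩
      · simp only [SimpleFunc.coe_piecewise]
        by_cases hy : y ∈ F
        · simp only [Set.piecewise_eq_of_mem _ _ _ hy]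
          exact SimpleFunc.tendsto_approxOn measurable_id hy₁ (subset_closure hy)
        · simp only [Set.piecewise_eq_of_notMem _ _ _ hy]
          exact ha y
      · simp only [SimpleFunc.coe_piecewise, Set.piecewise_eq_of_mem _ _ _ hy]
        exact SimpleFunc.approxOn_mem measurable_id hy₁ k y
  have hm₁ : ∀ k, Measurable fun y => σ₁ (s k y) := fun k => ((s k).map σ₁).measurable
  have hm₂ : ∀ k, Measurable fun y => σ₂ (s k y) := fun k => ((s k).map σ₂).measurable
  have hint : ∀ (ρ : Measure X) [IsFiniteMeasure ρ] (g : C(X, ℝ)) {h : X → X}, Measurable h →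
      Integrable (fun y => g (h y)) ρ := fun ρ _ g h hh => by
    refine Integrable.of_bound (g.continuous.measurable.comp hh).aestronglyMeasurable ‖g‖
      (Eventually.of_forall fun y => g.norm_coe_le_norm _)
  -- The measure `ν` is a limit point of the averages of the images of `μ` under `σ₁ ∘ s k` and
  -- `σ₂ ∘ s k`.
  let νm : ℕ → Measure X := fun k =>
    (2⁻¹ : ENNReal) • ((μ : Measure X).map fun y => σ₁ (s k y)) +
      (2⁻¹ : ENNReal) • ((μ : Measure X).map fun y => σ₂ (s k y))
  have hνp : ∀ k, IsProbabilityMeasure (νm k) := fun k => ⟨by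
    simp only [νm, Measure.add_apply, Measure.smul_apply, smul_eq_mul,
      Measure.map_apply (hm₁ k) MeasurableSet.univ, Measure.map_apply (hm₂ k) MeasurableSet.univ,
      Set.preimage_univ, measure_univ, mul_one]
    exact ENNReal.inv_two_add_inv_two⟩
  have hνint : ∀ (g : C(X, ℝ)) k, ∫ y, g y ∂(νm k)
      = ∫ y, (g (σ₁ (s k y)) + g (σ₂ (s k y))) / 2 ∂(μ : Measure X) := fun g k => by
    have e1 := hint (μ : Measure X) g (hm₁ k)
    have e2 := hint (μ : Measure X) g (hm₂ k)
    have i1 : Integrable g ((μ : Measure X).map fun y => σ₁ (s k y)) :=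
      (integrable_map_measure g.continuous.measurable.aestronglyMeasurable (hm₁ k).aemeasurable).2 e1
    have i2 : Integrable g ((μ : Measure X).map fun y => σ₂ (s k y)) :=
      (integrable_map_measure g.continuous.measurable.aestronglyMeasurable (hm₂ k).aemeasurable).2 e2
    rw [integral_add_measure (i1.smul_measure (by simp)) (i2.smul_measure (by simp)),
      integral_smul_measure, integral_smul_measure,
      integral_map (hm₁ k).aemeasurable g.continuous.measurable.aestronglyMeasurable,
      integral_map (hm₂ k).aemeasurable g.continuous.measurable.aestronglyMeasurable,
      smul_eq_mul, smul_eq_mul, ← integral_const_mul, ← integral_const_mul,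
      ← integral_add (e1.const_mul _) (e2.const_mul _)]
    congr 1
    ext y
    simp
    ring
  have hslim : ∀ g : C(X, ℝ), Tendsto (fun k => ∫ y, g (s k y) ∂(μ : Measure X)) atTop
      (𝓝 (∫ y, g y ∂(μ : Measure X))) := fun g => by
    refine tendsto_integral_of_dominated_convergence (fun _ => ‖g‖)
      (fun k => (g.continuous.measurable.comp (s k).measurable).aestronglyMeasurable)
      (integrable_const _) (fun k => Eventually.of_forall fun y => g.norm_coe_le_norm _)
      (Eventually.of_forall fun y => (g.continuous.tendsto y).comp (hs y))
  let ν' : ℕ → ProbabilityMeasure X := fun k => ⟨νm k, hνp k⟩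
  obtain ⟨ν, -, hν⟩ := (isCompact_univ (X := ProbabilityMeasure X)).ultrafilter_le_nhds
    ((hyperfilter ℕ).map ν') (by simp)
  have hνlim : ∀ g : C(X, ℝ), Tendsto (fun k => ∫ y, g y ∂(νm k)) (hyperfilter ℕ)
      (𝓝 (∫ y, g y ∂(ν : Measure X))) := fun g =>
    ((ProbabilityMeasure.continuous_integral_boundedContinuousFunction
      (BoundedContinuousFunction.mkOfCompact g)).tendsto ν).comp (show Tendsto ν' _ _ from hν)
  refine ⟨ν, fun g hg => ?_, ?_⟩
  · refine tendsto_nhds_unique (hνlim g) (((hslim g).mono_left Nat.hyperfilter_le_atTop).congr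
      fun k => ?_)
    rw [hνint]
    congr 1
    ext y
    rw [hg]; ring
  · refine le_of_tendsto_of_tendsto (((hslim f).mono_left Nat.hyperfilter_le_atTop).add_const _)
      (hνlim f) (Eventually.of_forall fun k => ?_)
    have e0 := hint (μ : Measure X) f (s k).measurable
    have e1 := hint (μ : Measure X) f (hm₁ k)
    have e2 := hint (μ : Measure X) f (hm₂ k)
    have e3 : Integrable (F.indicator fun _ => δ / 2) (μ : Measure X) :=
      (integrable_const _).indicator hF.measurableSet
    have e4 : ∫ y, F.indicator (fun _ => δ / 2) y ∂(μ : Measure X)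
        = δ / 2 * (μ : Measure X).real F := by
      rw [integral_indicator hF.measurableSet, setIntegral_const, smul_eq_mul, mul_comm]
    beta_reduce
    rw [hνint, ← e4, ← integral_add e0 e3]
    refine integral_mono (e0.add e3) ((e1.add e2).div_const 2) fun y => ?_
    by_cases hy : y ∈ F
    · simp only [Set.indicator_of_mem hy]
      linarith [hσF _ (hsF k y hy)]
    · simp only [Set.indicator_of_notMem hy]
      linarith [hσ (s k y)]

/-- Choquet's theorem for a compact convex metrizable set, given a strictly convex continuous
function `f`; the strict convexity at the midpoint of `y` and `z` is measured by `D (y, z)`. A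
measure maximising `∫ f` among those with barycenter `x` is supported on the extreme points, as
otherwise splitting non-extreme points into pairs with a given midpoint would increase `∫ f`. -/
theorem exists_boundary_measure {E : Type*} [AddCommGroup E] [Module ℝ E] [TopologicalSpace E]
    [ContinuousAdd E] [T2Space E] {K : Set E} [CompactSpace K] [TopologicalSpace.MetrizableSpace K]
    [MeasurableSpace K] [BorelSpace K] (hK : Convex ℝ K) (f : C(K, ℝ)) {D : K × K → ℝ}
    (hD : Continuous D) (hD0 : ∀ p, 0 ≤ D p) (hDpos : ∀ p, p.1 ≠ p.2 → 0 < D p)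
    (hmid : ∀ y z m : K, (m : E) + m = y + z → f y + f z = 2 * f m + D (y, z)) (x : K) :
    ∃ μ : Measure K, μ Set.univ = 1 ∧ μ {y : K | (y : E) ∉ Set.extremePoints ℝ K} = 0 ∧
      ∀ g : E →L[ℝ] ℝ, ∫ y : K, g y ∂μ = g x := by
  classical
  let gK : (E →L[ℝ] ℝ) → C(K, ℝ) := fun g => ⟨fun y => g y, by fun_prop⟩
  have hcont : ∀ h : C(K, ℝ), Continuous fun μ : ProbabilityMeasure K => ∫ y, h y ∂(μ : Measure K) :=
    fun h => ProbabilityMeasure.continuous_integral_boundedContinuousFunction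
      (BoundedContinuousFunction.mkOfCompact h)
  let P : Set (ProbabilityMeasure K) := {μ | ∀ g, ∫ y, gK g y ∂(μ : Measure K) = g x}
  have hPc : IsClosed P := by
    have : P = ⋂ g, {μ : ProbabilityMeasure K | ∫ y, gK g y ∂(μ : Measure K) = g x} := by ext; simp [P]
    rw [this]
    exact isClosed_iInter fun g => isClosed_eq (hcont _) continuous_const
  have hPne : P.Nonempty := ⟨⟨Measure.dirac x, inferInstance⟩, fun g => by
    simp [gK]⟩
  obtain ⟨μ, hμP, hμmax⟩ := hPc.isCompact.exists_isMaxOn hPne (hcont f).continuousOn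
  refine ⟨μ, measure_univ, ?_, fun g => hμP g⟩
  -- The closed sets of midpoints of pairs at which the convexity gap `D` is at least `1 / (N + 1)`
  -- exhaust the complement of the extreme points.
  let F : ℕ → Set K := fun N =>
    {m | ∃ y z : K, (m : E) + m = y + z ∧ 1 / ((N : ℝ) + 1) ≤ D (y, z)}
  have hFclosed : ∀ N, IsClosed (F N) := fun N => by
    have h1 : IsClosed {p : K × K × K | (p.1 : E) + p.1 = p.2.1 + p.2.2 ∧
        1 / ((N : ℝ) + 1) ≤ D p.2} :=
      (isClosed_eq (by fun_prop) (by fun_prop)).inter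
        (isClosed_le continuous_const (hD.comp continuous_snd))
    have h2 := h1.isCompact.image continuous_fst
    convert h2.isClosed using 1
    ext m
    simp [F]
  have hF0 : ∀ N, (μ : Measure K) (F N) = 0 := by
    intro N
    by_contra hne
    have hpos : 0 < (μ : Measure K).real (F N) := ENNReal.toReal_pos hne (measure_ne_top _ _)
    have hex : ∀ m : K, ∃ p : K × K, (m : E) + m = p.1 + p.2 ∧
        (m ∈ F N → 1 / ((N : ℝ) + 1) ≤ D p) := fun m => by
      by_cases hm : m ∈ F N
      · obtain ⟨y, z, h1, h2⟩ := hm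
        exact ⟨(y, z), h1, fun _ => h2⟩
      · exact ⟨(m, m), rfl, fun h => absurd h hm⟩
    choose σ hσ hσF using hex
    obtain ⟨ν, hν1, hν2⟩ := exists_split_measure μ (hFclosed N) (fun m => (σ m).1)
      (fun m => (σ m).2) (f := f) (δ := 1 / ((N : ℝ) + 1))
      (fun m => by rw [hmid _ _ m (hσ m)]; linarith [hD0 (σ m)])
      (fun m hm => by rw [hmid _ _ m (hσ m)]; linarith [hσF m hm])
    have hνP : ν ∈ P := fun g => by
      rw [← hμP g]
      refine hν1 (gK g) fun m => ?_
      change g (σ m).1 + g (σ m).2 = 2 * g m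
      rw [← map_add, ← hσ, map_add, two_mul]
    have h3 : ∫ y, f y ∂(ν : Measure K) ≤ ∫ y, f y ∂(μ : Measure K) := hμmax hνP
    have h4 : 0 < 1 / ((N : ℝ) + 1) / 2 * (μ : Measure K).real (F N) := by positivity
    linarith
  refine measure_mono_null (fun m hm => ?_) (measure_iUnion_null hF0)
  obtain ⟨y, hy, z, hz, hyz, h⟩ := exists_midpoint_of_notMem_extremePoints hK m.2 hm
  have hDp := hDpos (⟨y, hy⟩, ⟨z, hz⟩) fun h => hyz (congrArg Subtype.val h)
  obtain ⟨N, hN⟩ := exists_nat_one_div_lt hDp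
  exact Set.mem_iUnion.2 ⟨N, ⟨y, hy⟩, ⟨z, hz⟩, h, hN.le⟩

end Choquet

/-! ### Faces of the trace space are Choquet simplices -/

section TraceChoquet

variable {A : Type*} [CStarAlgebra A] [TopologicalSpace.SeparableSpace A]

/-- A compact convex set of traces that is a face of the trace space is a metrizable Choquet
simplex, as its extreme points are extreme traces. -/
theorem isMetrizableChoquetSimplex_of_isExtreme {K : Set (WeakDual ℂ A)} (hKc : IsCompact K)
    (hconv : Convex ℝ K) (hKe : IsExtreme ℝ (traceSpace A) K) : IsMetrizableChoquetSimplex K := by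
  have hK : K ⊆ traceSpace A := hKe.subset
  have hmet : TopologicalSpace.MetrizableSpace K := WeakDual.metrizable_of_isCompact ℂ A K hKc
  have hcpt : CompactSpace K := isCompact_iff_compactSpace.1 hKc
  refine ⟨hKc, hconv, hmet, fun φ hφ => ?_⟩
  let : MeasurableSpace K := borel K
  have : BorelSpace K := ⟨rfl⟩
  -- A weighted sum of the `|φ(a)|²`, over a dense sequence of `a`, is strictly convex. With
  -- `o` the first projection `S (φ, φ) o` is this sum, and with `o` the subtraction `S (φ, ψ) o` is
  -- twice the convexity gap, by the parallelogram identity.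
  let a := TopologicalSpace.denseSeq A
  let w : ℕ → ℝ := fun n => (1 / 2) ^ n * (‖a n‖ ^ 2 + 1)⁻¹
  have hw : ∀ n, 0 < w n := fun n => by positivity
  let S : (K × K) → (ℂ → ℂ → ℂ) → ℝ := fun p o => ∑' n, w n * ‖o (p.1.1 (a n)) (p.2.1 (a n))‖ ^ 2
  have hbd : ∀ (p : K × K) (o : ℂ → ℂ → ℂ), (∀ x y, ‖o x y‖ ≤ ‖x‖ + ‖y‖) → ∀ n,
      ‖w n * ‖o (p.1.1 (a n)) (p.2.1 (a n))‖ ^ 2‖ ≤ 4 * (1 / 2) ^ n := by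
    intro p o ho n
    rw [Real.norm_eq_abs, abs_of_nonneg (mul_nonneg (hw n).le (by positivity))]
    have h1 : ‖o (p.1.1 (a n)) (p.2.1 (a n))‖ ≤ 2 * ‖a n‖ := by
      linarith [ho (p.1.1 (a n)) (p.2.1 (a n)), norm_trace_le (hK p.1.2) (a n),
        norm_trace_le (hK p.2.2) (a n)]
    calc _ ≤ (1 / 2) ^ n * (‖a n‖ ^ 2 + 1)⁻¹ * (2 * ‖a n‖) ^ 2 := by gcongr
      _ = (1 / 2) ^ n * (4 * ((‖a n‖ ^ 2) / (‖a n‖ ^ 2 + 1))) := by ring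
      _ ≤ (1 / 2) ^ n * (4 * 1) := by
        gcongr
        rw [div_le_one (by positivity)]
        linarith
      _ = 4 * (1 / 2) ^ n := by ring
  have hsum : ∀ (p : K × K) (o : ℂ → ℂ → ℂ), (∀ x y, ‖o x y‖ ≤ ‖x‖ + ‖y‖) →
      Summable fun n => w n * ‖o (p.1.1 (a n)) (p.2.1 (a n))‖ ^ 2 := fun p o ho =>
    Summable.of_norm_bounded (summable_geometric_two.mul_left 4) (hbd p o ho)
  have hScont : ∀ o : ℂ → ℂ → ℂ, (Continuous fun q : ℂ × ℂ => o q.1 q.2) →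
      (∀ x y, ‖o x y‖ ≤ ‖x‖ + ‖y‖) → Continuous fun p => S p o := fun o hoc ho => by
    refine continuous_tsum (fun n => ?_) (summable_geometric_two.mul_left 4)
      (fun n p => hbd p o ho n)
    have e1 : Continuous fun p : K × K => (p.1.1 (a n), p.2.1 (a n)) :=
      ((continuous_eval (a n)).comp (continuous_subtype_val.comp continuous_fst)).prodMk
        ((continuous_eval (a n)).comp (continuous_subtype_val.comp continuous_snd))
    exact continuous_const.mul ((hoc.comp e1).norm.pow 2)
  have ho1 : ∀ x y : ℂ, ‖(fun x _ => x : ℂ → ℂ → ℂ) x y‖ ≤ ‖x‖ + ‖y‖ := fun x y =>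
    le_add_of_nonneg_right (norm_nonneg y)
  have ho2 : ∀ x y : ℂ, ‖(fun x y => x - y : ℂ → ℂ → ℂ) x y‖ ≤ ‖x‖ + ‖y‖ := fun x y =>
    norm_sub_le x y
  let f : C(K, ℝ) := ⟨fun y => S (y, y) fun x _ => x,
    (hScont _ continuous_fst ho1).comp (continuous_id.prodMk continuous_id)⟩
  obtain ⟨μ, h1, h2, h3⟩ := exists_boundary_measure hconv f
    (D := fun p => S p (fun x y => x - y) / 2)
    ((hScont _ (continuous_fst.sub continuous_snd) ho2).div_const 2)
    (fun p => div_nonneg (tsum_nonneg fun n => mul_nonneg (hw n).le (by positivity)) (by norm_num))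
    (fun p hp => by
      by_contra hcon
      have h0 : S p (fun x y => x - y) = 0 := le_antisymm (by linarith)
        (tsum_nonneg fun n => mul_nonneg (hw n).le (by positivity))
      have hs := (hsum p _ ho2).hasSum
      rw [show ∑' n, w n * ‖(fun x y => x - y : ℂ → ℂ → ℂ) (p.1.1 (a n)) (p.2.1 (a n))‖ ^ 2 = 0
        from h0] at hs
      have h1 := (hasSum_zero_iff_of_nonneg (fun n => mul_nonneg (hw n).le (sq_nonneg _))).1 hs
      refine hp (Subtype.ext (weakDual_ext fun x => ?_))
      have hcl : IsClosed {x : A | p.1.1 x = p.2.1 x} :=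
        isClosed_eq (map_continuous _) (map_continuous _)
      refine (hcl.closure_subset_iff.2 ?_) (TopologicalSpace.denseRange_denseSeq A x)
      rintro _ ⟨n, rfl⟩
      have h2 := congrFun h1 n
      simp only [Pi.zero_apply, mul_eq_zero, (hw n).ne', false_or] at h2
      exact sub_eq_zero.1 (norm_eq_zero.1 (pow_eq_zero_iff (two_ne_zero) |>.1 h2)))
    (fun y z m hm => by
      change S (y, y) (fun x _ => x) + S (z, z) (fun x _ => x)
        = 2 * S (m, m) (fun x _ => x) + S (y, z) (fun x y => x - y) / 2
      simp only [S]
      rw [← (hsum (y, y) _ ho1).tsum_add (hsum (z, z) _ ho1), ← tsum_mul_left, ← tsum_div_const,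
        ← ((hsum (m, m) _ ho1).mul_left 2).tsum_add ((hsum (y, z) _ ho2).div_const 2)]
      congr 1
      ext n
      have hmn : m.1 (a n) + m.1 (a n) = y.1 (a n) + z.1 (a n) := DFunLike.congr_fun hm (a n)
      have hmn' : m.1 (a n) = (y.1 (a n) + z.1 (a n)) / 2 := by rw [← hmn]; ring
      rw [hmn', norm_div, div_pow]
      have hpar := parallelogram_law_with_norm ℝ (y.1 (a n)) (z.1 (a n))
      norm_num
      linear_combination (-(w n) / 2) * hpar)
    ⟨φ, hφ⟩
  refine ⟨μ, ⟨h1, h2, h3⟩, fun ν hν => ?_⟩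
  have hextr : ∀ ρ : Measure K, ρ {y : K | (y : WeakDual ℂ A) ∉ Set.extremePoints ℝ K} = 0 →
      ∀ᵐ ψ : K ∂ρ, (ψ : WeakDual ℂ A) ∈ Set.extremePoints ℝ (traceSpace A) := fun ρ hρ => by
    have h4 : ∀ᵐ ψ : K ∂ρ, (ψ : WeakDual ℂ A) ∈ Set.extremePoints ℝ K := hρ
    filter_upwards [h4] with ψ hψ using hKe.extremePoints_subset_extremePoints hψ
  have : IsFiniteMeasure μ := ⟨by rw [h1]; exact ENNReal.one_lt_top⟩
  have : IsFiniteMeasure ν := ⟨by rw [hν.prob]; exact ENNReal.one_lt_top⟩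
  exact eq_of_barycenter_eq hK (hK hφ) (fun a => hν.barycenter (evalRe a)) (fun a => h3 (evalRe a))
    (hextr ν hν.support) (hextr μ h2)

end TraceChoquet

/-! ### Dominated traces as densities -/

section Density

variable {A : Type*} [CStarAlgebra A]

/-- The first order condition at an approximate minimiser of a quadratic function on a convex set.
The infimum need not be attained, but if it is positive, an error of half of the lower bound `m`
is harmless. -/
theorem exists_first_order {Q : Set A} (hQ : Convex ℝ Q) (hne : Q.Nonempty) {q q₀ : A → ℝ}
    {L : A → A → ℝ} (hexp : ∀ b h (s : ℝ), q (b + s • h) = q b + 2 * s * L b h + s ^ 2 * q₀ h)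
    {W : ℝ} (hW : ∀ b ∈ Q, ∀ b' ∈ Q, q₀ (b' - b) ≤ W) {m : ℝ} (hm : 0 < m)
    (hq : ∀ b ∈ Q, m ≤ q b) : ∃ b ∈ Q, ∀ b' ∈ Q, -(m / 2) ≤ L b (b' - b) := by
  have hbdd : BddBelow (q '' Q) := ⟨m, by rintro _ ⟨b, hb, rfl⟩; exact hq b hb⟩
  obtain ⟨s, hs0, hs1, hsW⟩ : ∃ s : ℝ, 0 < s ∧ s ≤ 1 ∧ s * W ≤ m / 2 := by
    refine ⟨min 1 (m / (2 * (|W| + 1))), by positivity, min_le_left _ _, ?_⟩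
    calc _ ≤ (m / (2 * (|W| + 1))) * (|W| + 1) := by
          refine mul_le_mul_of_nonneg (min_le_right _ _) ?_ (by positivity) (by positivity)
          linarith [le_abs_self W]
      _ = m / 2 := by field_simp
  obtain ⟨_, ⟨b, hb, rfl⟩, hlt⟩ := exists_lt_of_csInf_lt (s := q '' Q) (hne.image q)
    (show sInf (q '' Q) < sInf (q '' Q) + s * m / 2 from lt_add_of_pos_right _ (by positivity))
  refine ⟨b, hb, fun b' hb' => ?_⟩
  have h1 : sInf (q '' Q) ≤ q (b + s • (b' - b)) :=
    csInf_le hbdd ⟨_, hQ.add_smul_sub_mem hb hb' ⟨hs0.le, hs1⟩, rfl⟩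
  rw [hexp] at h1
  have h2 := mul_le_mul_of_nonneg_left (hW b hb b' hb') (sq_nonneg s)
  have h3 : 0 ≤ s * (2 * L b (b' - b) + s * W + m / 2) := by nlinarith
  have h4 := nonneg_of_mul_nonneg_right h3 hs0
  linarith

variable {φ φ₁ : WeakDual ℂ A}

/-- For self-adjoint `b`, `Re φ(b x)` depends only on the real part of `x`. -/
theorem re_trace_mul_eq (hφ : φ ∈ traceSpace A) {b : A} (hb : IsSelfAdjoint b) (x : A) :
    (φ (b * x)).re = (φ (b * (realPart x : A))).re := by
  conv_lhs => rw [← realPart_add_I_smul_imaginaryPart x]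
  have h : (φ (b * (imaginaryPart x : A))).im = 0 := by
    have h2 := trace_star hφ (b * (imaginaryPart x : A))
    rw [star_mul, hb.star_eq, (imaginaryPart x).2.star_eq, trace_comm hφ] at h2
    exact Complex.conj_eq_iff_im.1 h2.symm
  rw [mul_add, mul_smul_comm, map_add, map_smul, Complex.add_re, smul_eq_mul, Complex.mul_re]
  simp [h]

/-- If `t φ₁ ≤ φ`, then `t Re φ₁(x)` is almost bounded below by `Re φ(b x)` for some `0 ≤ b ≤ 1`
(an approximate spectral projection of the real part of `x`). -/
theorem exists_re_trace_mul_lt [PartialOrder A] [StarOrderedRing A] (hφ : φ ∈ traceSpace A)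
    (hφ₁ : φ₁ ∈ traceSpace A) {t : ℝ}
    (hdom : ∀ x : A, t * (φ₁ (star x * x)).re ≤ (φ (star x * x)).re) (ht : 0 ≤ t) (x : A) {ε : ℝ}
    (hε : 0 < ε) :
    ∃ b : A, 0 ≤ b ∧ b ≤ 1 ∧ (φ (b * x)).re < t * (φ₁ x).re + ε := by
  obtain ⟨k, hk⟩ := exists_nat_one_div_lt hε
  set y : A := (realPart x : A) with hy
  have hysa : IsSelfAdjoint y := (realPart x).2
  -- `f` is a continuous approximation of the indicator function of the negative half-line, so that
  -- `f(y) y` is almost minus the negative part of `y`.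
  let f : ℝ → ℝ := fun r => min 1 (max 0 (-((k : ℝ) + 1) * r))
  have hf : Continuous f := by fun_prop
  have hf0 : ∀ r, 0 ≤ f r := fun r => le_min zero_le_one (le_max_left _ _)
  have hf1 : ∀ r, f r ≤ 1 := fun r => min_le_left _ _
  have hkey : ∀ r : ℝ, f r * r ≤ -(max (-r) 0) + 1 / ((k : ℝ) + 1) := by
    intro r
    have hk0 : (0 : ℝ) < (k : ℝ) + 1 := by positivity
    rcases le_or_gt 0 r with h | h
    · have h1 : f r = 0 := by
        simp only [f]
        rw [max_eq_left (by nlinarith), min_eq_right zero_le_one]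
      rw [h1, max_eq_right (by linarith)]
      simp; positivity
    · rw [max_eq_left (by linarith)]
      rcases le_or_gt r (-(1 / ((k : ℝ) + 1))) with h2 | h2
      · have h1 : f r = 1 := by
          simp only [f]
          refine min_eq_left (le_max_of_le_right ?_)
          have := mul_le_mul_of_nonneg_left h2 hk0.le
          rw [mul_neg, mul_one_div_cancel hk0.ne'] at this
          linarith
        rw [h1]
        have : (0 : ℝ) ≤ 1 / ((k : ℝ) + 1) := by positivity
        linarith
      · nlinarith [hf0 r]
  have hb0 : 0 ≤ cfc f y := cfc_nonneg fun r _ => hf0 r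
  refine ⟨cfc f y, hb0, cfc_le_one f y fun r _ => hf1 r, ?_⟩
  rw [re_trace_mul_eq hφ (IsSelfAdjoint.of_nonneg hb0), ← hy]
  have h1 : cfc f y * y = cfc (fun r => f r * r) y := by
    conv_lhs => rw [← cfc_id' ℝ y, cfc_id' ℝ y]
    nth_rewrite 2 [← cfc_id' ℝ y]
    rw [← cfc_mul f (fun r => r) y]
  set n : A := cfc (fun r : ℝ => max (-r) 0) y with hn
  have hn0 : 0 ≤ n := cfc_nonneg fun r _ => le_max_right _ _
  have h2 : cfc f y * y ≤ -n + algebraMap ℝ A (1 / ((k : ℝ) + 1)) := by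
    rw [h1, hn, ← cfc_neg, ← cfc_const (1 / ((k : ℝ) + 1)) y, ← cfc_add ..]
    exact cfc_mono fun r _ => hkey r
  have h3 : -n ≤ y := by
    conv_rhs => rw [← cfc_id' ℝ y]
    rw [hn, ← cfc_neg]
    refine cfc_mono fun r _ => ?_
    have := le_max_left (-r) 0
    linarith
  have h4 := (Complex.le_def.1 (trace_mono hφ h2)).1
  have h5 := (Complex.le_def.1 (trace_mono hφ₁ h3)).1
  have h6 : (φ₁ x).re = (φ₁ y).re := by
    have := re_trace_mul_eq hφ₁ (.one A) x
    rwa [one_mul, one_mul] at this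
  have h7 : t * (φ₁ n).re ≤ (φ n).re := by
    obtain ⟨z, hz⟩ := CStarAlgebra.nonneg_iff_eq_star_mul_self.1 hn0
    rw [hz]; exact hdom z
  rw [map_add, map_neg, Algebra.algebraMap_eq_smul_one, ← Complex.coe_smul, map_smul, hφ.1] at h4
  rw [map_neg] at h5
  simp only [Complex.add_re, Complex.neg_re, smul_eq_mul, mul_one, Complex.ofReal_re] at h4 h5
  rw [h6]
  have h8 := mul_le_mul_of_nonneg_left h5 ht
  linarith

/-- If `t φ₁ ≤ φ` for traces `φ`, `φ₁`, then `t φ₁` is approximated by densities `φ(b ·)`, with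
`0 ≤ b ≤ 1` asymptotically central. An approximate minimiser `b` of the sum of squares `q` of the
errors has almost the required properties: its first order condition says that the gradient of `q`
at `b`, an element `x` of the algebra, satisfies `Re φ(b' x) ≥ t Re φ₁(x) + q(b) - η² / 2` for all
`0 ≤ b' ≤ 1`, which contradicts `exists_re_trace_mul_lt` if `q(b) ≥ η²`. -/
theorem exists_almost_central_density [PartialOrder A] [StarOrderedRing A] (hφ : φ ∈ traceSpace A)
    (hφ₁ : φ₁ ∈ traceSpace A) {t : ℝ} (ht : 0 ≤ t)
    (hdom : ∀ x : A, t * (φ₁ (star x * x)).re ≤ (φ (star x * x)).re) (F : Finset A) {η : ℝ}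
    (hη : 0 < η) :
    ∃ b : A, 0 ≤ b ∧ b ≤ 1 ∧ (∀ a ∈ F, ‖φ (b * a) - t * φ₁ a‖ < η) ∧
      ∀ g ∈ F, traceNorm φ (b * g - g * b) < η := by
  by_contra! hcon
  let Q : Set A := {b | 0 ≤ b ∧ b ≤ 1}
  have hQ : Convex ℝ Q := (convex_Ici (0 : A)).inter (convex_Iic (1 : A))
  let v : A → A → ℂ := fun b a => φ (b * a) - t * φ₁ a
  let K : A → A → A := fun b g => b * g - g * b
  let q : A → ℝ := fun b => ∑ a ∈ F, (‖v b a‖ ^ 2 + traceNorm φ (K b a) ^ 2)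
  let q₀ : A → ℝ := fun b => ∑ a ∈ F, (‖φ (b * a)‖ ^ 2 + traceNorm φ (K b a) ^ 2)
  let L : A → A → ℝ := fun b h => ∑ a ∈ F, ((star (v b a) * φ (h * a)).re +
    (φ (star (K b a) * K h a)).re)
  have hexp : ∀ b h (s : ℝ), q (b + s • h) = q b + 2 * s * L b h + s ^ 2 * q₀ h := by
    intro b h s
    simp only [q, q₀, L, Finset.mul_sum, ← Finset.sum_add_distrib]
    refine Finset.sum_congr rfl fun a _ => ?_
    have e1 : v (b + s • h) a = v b a + s * φ (h * a) := by
      simp only [v, add_mul, smul_mul_assoc, map_add]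
      rw [← Complex.coe_smul, map_smul, smul_eq_mul]; ring
    have e2 : K (b + s • h) a = K b a + (s : ℂ) • K h a := by
      simp only [K, add_mul, mul_add, smul_mul_assoc, mul_smul_comm, smul_sub, Complex.coe_smul]
      abel
    have e3 : (φ (star (K h a) * K b a)).re = (φ (star (K b a) * K h a)).re := by
      have := trace_star hφ (star (K b a) * K h a)
      rw [star_mul, star_star] at this
      rw [this]; rfl
    rw [e1, e2, traceNorm_sq hφ, traceNorm_sq hφ, traceNorm_sq hφ]
    simp only [star_add, add_mul, mul_add, star_smul, smul_mul_assoc, mul_smul_comm, map_add,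
      map_smul, smul_eq_mul, Complex.add_re, Complex.star_def, Complex.conj_ofReal,
      Complex.re_ofReal_mul, e3]
    rw [← Complex.normSq_eq_norm_sq, ← Complex.normSq_eq_norm_sq, ← Complex.normSq_eq_norm_sq,
      Complex.normSq_apply, Complex.normSq_apply, Complex.normSq_apply]
    simp only [Complex.add_re, Complex.add_im, Complex.im_ofReal_mul,
      Complex.mul_re, Complex.conj_re, Complex.conj_im, Complex.ofReal_re, Complex.ofReal_im]
    ring
  have hQn : ∀ b ∈ Q, ‖b‖ ≤ 1 := fun b hb =>
    (CStarAlgebra.norm_le_one_iff_of_nonneg b hb.1).2 hb.2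
  have hW : ∀ b ∈ Q, ∀ b' ∈ Q, q₀ (b' - b) ≤ ∑ a ∈ F, ((2 * ‖a‖) ^ 2 + (4 * ‖a‖) ^ 2) := by
    intro b hb b' hb'
    have h1 : ‖b' - b‖ ≤ 2 := (norm_sub_le _ _).trans (by linarith [hQn b hb, hQn b' hb'])
    refine Finset.sum_le_sum fun a _ => ?_
    have e1 : ‖(b' - b) * a‖ ≤ 2 * ‖a‖ := (norm_mul_le _ _).trans (by gcongr)
    have e2 : ‖a * (b' - b)‖ ≤ 2 * ‖a‖ := (norm_mul_le _ _).trans (by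
      rw [mul_comm]; gcongr)
    have e3 : ‖K (b' - b) a‖ ≤ 4 * ‖a‖ := (norm_sub_le _ _).trans (by linarith)
    have e4 := (norm_trace_le hφ _).trans e1
    have e5 := (traceNorm_le_norm hφ _).trans e3
    have e6 := traceNorm_nonneg φ (K (b' - b) a)
    gcongr
  have hq : ∀ b ∈ Q, η ^ 2 ≤ q b := by
    intro b hb
    have hnn : ∀ a ∈ F, 0 ≤ ‖v b a‖ ^ 2 + traceNorm φ (K b a) ^ 2 := fun a _ => by positivity
    by_cases h : ∀ a ∈ F, ‖φ (b * a) - t * φ₁ a‖ < η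
    · obtain ⟨g, hg, hgη⟩ := hcon b hb.1 hb.2 h
      refine le_trans ?_ (Finset.single_le_sum hnn hg)
      have : η ^ 2 ≤ traceNorm φ (K b g) ^ 2 := by gcongr
      nlinarith [sq_nonneg ‖v b g‖]
    · push Not at h
      obtain ⟨a, ha, haη⟩ := h
      refine le_trans ?_ (Finset.single_le_sum hnn ha)
      have : η ^ 2 ≤ ‖v b a‖ ^ 2 := by gcongr
      nlinarith [sq_nonneg (traceNorm φ (K b a))]
  obtain ⟨b, hb, hfo⟩ := exists_first_order hQ ⟨0, le_rfl, zero_le_one⟩ hexp hW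
    (by positivity : 0 < η ^ 2) hq
  -- The gradient at `b` is represented by an element `x` of the algebra; the trace property moves
  -- the commutators of `b'` with `a` onto `K b a`, and makes `φ₁` vanish on the commutator terms.
  let x : A := ∑ a ∈ F, (star (v b a) • a + (a * star (K b a) - star (K b a) * a))
  have hx : ∀ b' : A, L b (b' - b) + q b = (φ (b' * x)).re - t * (φ₁ x).re := by
    intro b'
    have e1 : (φ (b' * x)).re - t * (φ₁ x).re = (φ (b' * x) - t * φ₁ x).re := by
      rw [Complex.sub_re, Complex.re_ofReal_mul]
    rw [e1]
    simp only [L, q, x, Finset.mul_sum, map_sum, ← Finset.sum_add_distrib, ← Finset.sum_sub_distrib,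
      Complex.re_sum]
    refine Finset.sum_congr rfl fun a _ => ?_
    have e2 : φ₁ (star (v b a) • a + (a * star (K b a) - star (K b a) * a))
        = star (v b a) * φ₁ a := by
      rw [map_add, map_sub, trace_comm hφ₁ a, sub_self, add_zero, map_smul, smul_eq_mul]
    have e3 : φ (b' * (star (v b a) • a + (a * star (K b a) - star (K b a) * a)))
        = star (v b a) * φ (b' * a) + φ (star (K b a) * K b' a) := by
      rw [mul_add, map_add, mul_smul_comm, map_smul, smul_eq_mul]
      congr 1
      simp only [K, mul_sub, map_sub]
      rw [← mul_assoc, trace_comm hφ (b' * a), ← mul_assoc b', trace_comm hφ (b' * _) a,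
        ← mul_assoc a, trace_comm hφ (a * b')]
    have e4 : K (b' - b) a = K b' a - K b a := by simp only [K, sub_mul, mul_sub]; abel
    have e5 : φ ((b' - b) * a) = (φ (b' * a) - t * φ₁ a) - v b a := by
      simp only [v, sub_mul, map_sub]; ring
    rw [e2, e3, e4, e5, traceNorm_sq hφ, mul_sub (star (K b a)), map_sub]
    simp only [Complex.add_re, Complex.sub_re, mul_sub]
    have e6 : (star (v b a) * v b a).re = ‖v b a‖ ^ 2 := by
      rw [Complex.star_def, ← Complex.normSq_eq_conj_mul_self, Complex.ofReal_re,
        Complex.normSq_eq_norm_sq]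
    rw [e6, show star (v b a) * (t * φ₁ a) = t * (star (v b a) * φ₁ a) by ring]
    ring
  obtain ⟨b', hb'0, hb'1, hlt⟩ := exists_re_trace_mul_lt hφ hφ₁ hdom ht x
    (show 0 < η ^ 2 / 2 by positivity)
  have h1 := hfo b' ⟨hb'0, hb'1⟩
  have h2 := hx b'
  have h3 := hq b hb
  linarith

end Density

/-! ### Matrices in the Frobenius norm -/

section Frobenius

open Matrix
open scoped Matrix.Norms.Frobenius

variable {ι κ m : Type*} [Fintype ι] [Fintype κ] [Fintype m]

theorem frobenius_sq (X : Matrix ι κ ℂ) : ‖X‖ ^ 2 = ∑ i, ∑ j, ‖X i j‖ ^ 2 := by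
  rw [frobenius_norm_def, ← Real.sqrt_eq_rpow]
  norm_cast
  exact Real.sq_sqrt (by positivity)

theorem frobenius_sq' (X : Matrix ι κ ℂ) : ‖X‖ ^ 2 = ∑ j, ∑ i, ‖X i j‖ ^ 2 := by
  rw [frobenius_sq, Finset.sum_comm]

theorem conjTranspose_mul_self_apply_self {κ : Type*} (X : Matrix ι κ ℂ) (j : κ) :
    (Xᴴ * X) j j = ((∑ i, ‖X i j‖ ^ 2 : ℝ) : ℂ) := by
  rw [mul_apply]
  push_cast
  refine Finset.sum_congr rfl fun i _ => ?_
  rw [conjTranspose_apply, ← Complex.ofReal_pow, ← Complex.normSq_eq_norm_sq,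
    Complex.normSq_eq_conj_mul_self]
  rfl

theorem frobenius_sq_eq_trace (X : Matrix ι κ ℂ) :
    ((‖X‖ ^ 2 : ℝ) : ℂ) = (Xᴴ * X).trace := by
  rw [frobenius_sq', trace]
  push_cast
  refine Finset.sum_congr rfl fun j _ => ?_
  rw [diag_apply, conjTranspose_mul_self_apply_self]
  push_cast
  rfl

theorem norm_trace_conjTranspose_mul_le (X Y : Matrix ι κ ℂ) :
    ‖(Xᴴ * Y).trace‖ ≤ ‖X‖ * ‖Y‖ := by
  have h1 : (Xᴴ * Y).trace = ∑ p : κ × ι, star (X p.2 p.1) * Y p.2 p.1 := by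
    rw [Fintype.sum_prod_type]
    rfl
  have h2 : ∀ Z : Matrix ι κ ℂ, ‖Z‖ = √(∑ p : κ × ι, ‖Z p.2 p.1‖ ^ 2) := fun Z => by
    rw [Fintype.sum_prod_type]
    change _ = √(∑ j, ∑ i, ‖Z i j‖ ^ 2)
    rw [← frobenius_sq', Real.sqrt_sq (norm_nonneg _)]
  rw [h1, h2 X, h2 Y]
  refine (norm_sum_le _ _).trans (le_trans (le_of_eq ?_) (Real.sum_mul_le_sqrt_mul_sqrt _ _ _))
  simp

theorem norm_trace_mul_le_frobenius (X : Matrix κ ι ℂ) (Y : Matrix ι κ ℂ) :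
    ‖(X * Y).trace‖ ≤ ‖X‖ * ‖Y‖ := by
  have := norm_trace_conjTranspose_mul_le Xᴴ Y
  rwa [conjTranspose_conjTranspose, frobenius_norm_conjTranspose] at this

theorem frobenius_isometry_mul [DecidableEq ι] {U : Matrix m ι ℂ} (hU : Uᴴ * U = 1)
    (X : Matrix ι κ ℂ) : ‖U * X‖ = ‖X‖ := by
  rw [← sq_eq_sq₀ (norm_nonneg _) (norm_nonneg _)]
  have : (((‖U * X‖ ^ 2 : ℝ)) : ℂ) = ((‖X‖ ^ 2 : ℝ) : ℂ) := by
    rw [frobenius_sq_eq_trace, frobenius_sq_eq_trace, conjTranspose_mul, Matrix.mul_assoc,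
      ← Matrix.mul_assoc Uᴴ, hU, Matrix.one_mul]
  exact_mod_cast this

theorem frobenius_mul_coisometry [DecidableEq ι] {U : Matrix ι m ℂ} (hU : U * Uᴴ = 1)
    (X : Matrix κ ι ℂ) : ‖X * U‖ = ‖X‖ := by
  rw [← frobenius_norm_conjTranspose, conjTranspose_mul,
    frobenius_isometry_mul (by rwa [conjTranspose_conjTranspose]), frobenius_norm_conjTranspose]

theorem frobenius_one_sq [DecidableEq ι] : ‖(1 : Matrix ι ι ℂ)‖ ^ 2 = Fintype.card ι := by
  have h := frobenius_sq_eq_trace (1 : Matrix ι ι ℂ)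
  rw [conjTranspose_one, Matrix.one_mul, Matrix.trace_one] at h
  exact_mod_cast h

theorem unitary_conjTranspose_mul [DecidableEq ι] (U : unitaryGroup ι ℂ) :
    (U : Matrix ι ι ℂ)ᴴ * (U : Matrix ι ι ℂ) = 1 := Unitary.coe_star_mul_self U

theorem unitary_mul_conjTranspose [DecidableEq ι] (U : unitaryGroup ι ℂ) :
    (U : Matrix ι ι ℂ) * (U : Matrix ι ι ℂ)ᴴ = 1 := Unitary.coe_mul_star_self U

theorem frobenius_unitary_mul [DecidableEq ι] (U : unitaryGroup ι ℂ) (X : Matrix ι κ ℂ) :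
    ‖(U : Matrix ι ι ℂ) * X‖ = ‖X‖ := frobenius_isometry_mul (unitary_conjTranspose_mul U) X

theorem frobenius_mul_unitary [DecidableEq ι] (U : unitaryGroup ι ℂ) (X : Matrix κ ι ℂ) :
    ‖X * (U : Matrix ι ι ℂ)‖ = ‖X‖ := frobenius_mul_coisometry (unitary_mul_conjTranspose U) X

theorem frobenius_unitary_sq [DecidableEq ι] (U : unitaryGroup ι ℂ) :
    ‖(U : Matrix ι ι ℂ)‖ ^ 2 = Fintype.card ι := by
  rw [← mul_one (U : Matrix ι ι ℂ), frobenius_unitary_mul, frobenius_one_sq]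

/-- A contraction `X` with `X* X + Y* Y = 1` is close to a unitary if `Y` is small: the unitary
part of a polar decomposition of `X`, obtained from singular vectors. -/
theorem exists_unitary_near [DecidableEq ι] (X : Matrix ι ι ℂ) (Y : Matrix m ι ℂ)
    (h : Xᴴ * X + Yᴴ * Y = 1) : ∃ U : unitaryGroup ι ℂ, ‖X - (U : Matrix ι ι ℂ)‖ ≤ ‖Y‖ := by
  have hH : (Xᴴ * X).IsHermitian := isHermitian_conjTranspose_mul_self X
  set W := hH.eigenvectorUnitary
  set e := hH.eigenvalues
  -- The columns of `Z` are orthogonal; the nonzero ones, normalised, extend to an orthonormal basis,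
  -- which forms the columns of the unitary `G`.
  set Z := X * (W : Matrix ι ι ℂ) with hZ
  have hZZ : Zᴴ * Z = diagonal fun j => (e j : ℂ) := by
    have h1 := hH.spectral_theorem
    rw [Unitary.conjStarAlgAut_apply] at h1
    change Xᴴ * X = (W : Matrix ι ι ℂ) * _ * (W : Matrix ι ι ℂ)ᴴ at h1
    rw [hZ, conjTranspose_mul, Matrix.mul_assoc, ← Matrix.mul_assoc Xᴴ, h1]
    simp only [Matrix.mul_assoc]
    rw [unitary_conjTranspose_mul, Matrix.mul_one, ← Matrix.mul_assoc, unitary_conjTranspose_mul,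
      Matrix.one_mul]
    rfl
  have hYY : (Y * (W : Matrix ι ι ℂ))ᴴ * (Y * (W : Matrix ι ι ℂ))
      = diagonal fun j => ((1 - e j : ℝ) : ℂ) := by
    have h1 : Yᴴ * Y = 1 - Xᴴ * X := by rw [← h]; abel
    rw [conjTranspose_mul, Matrix.mul_assoc, ← Matrix.mul_assoc Yᴴ, h1, Matrix.sub_mul,
      Matrix.mul_sub, Matrix.one_mul, unitary_conjTranspose_mul, Matrix.mul_assoc Xᴴ,
      ← Matrix.mul_assoc _ Xᴴ, ← conjTranspose_mul, ← hZ, hZZ, ← diagonal_one, diagonal_sub]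
    simp
  have he1 : ∀ j, 1 - e j = ∑ i, ‖(Y * (W : Matrix ι ι ℂ)) i j‖ ^ 2 := fun j => by
    have h1 := conjTranspose_mul_self_apply_self (Y * (W : Matrix ι ι ℂ)) j
    rw [hYY, diagonal_apply_eq] at h1
    exact_mod_cast h1
  have he0 : ∀ j, e j = ∑ i, ‖Z i j‖ ^ 2 := fun j => by
    have h1 := conjTranspose_mul_self_apply_self Z j
    rw [hZZ, diagonal_apply_eq] at h1
    exact_mod_cast h1
  have he0' : ∀ j, 0 ≤ e j := fun j => by rw [he0]; positivity
  have he1' : ∀ j, e j ≤ 1 := fun j => by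
    rw [← sub_nonneg, he1]; positivity
  let r : ι → ℝ := fun j => √(e j)
  let z : ι → EuclideanSpace ℂ ι := fun j => WithLp.toLp 2 fun i => Z i j
  have hin : ∀ j k, inner ℂ (z j) (z k) = if j = k then (e j : ℂ) else 0 := fun j k => by
    have h1 := congrFun (congrFun hZZ j) k
    rw [mul_apply, diagonal_apply] at h1
    rw [← h1, PiLp.inner_apply]
    refine Finset.sum_congr rfl fun i _ => ?_
    rw [RCLike.inner_apply, mul_comm]
    rfl
  have hON : Orthonormal ℂ (({j | e j ≠ 0} : Set ι).domRestrict fun j => ((r j)⁻¹ : ℂ) • z j) := by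
    rw [orthonormal_iff_ite]
    rintro ⟨j, hj⟩ ⟨k, hk⟩
    simp only [Set.domRestrict_apply, inner_smul_left, inner_smul_right, hin, Subtype.mk.injEq]
    split_ifs with hjk
    · subst hjk
      have hr : (r j : ℂ) ^ 2 = e j := by
        rw [← Complex.ofReal_pow, Real.sq_sqrt (he0' j)]
      have hr0 : (r j : ℂ) ≠ 0 := by
        intro h0
        rw [h0] at hr
        rw [zero_pow two_ne_zero] at hr
        exact hj (by exact_mod_cast hr.symm)
      rw [← hr, map_inv₀, Complex.conj_ofReal]
      field_simp
    · simp
  obtain ⟨b, hb⟩ := hON.exists_orthonormalBasis_extension_of_card_eq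
    (by rw [finrank_euclideanSpace])
  have hzb : ∀ j, z j = (r j : ℂ) • b j := fun j => by
    by_cases hj : e j = 0
    · have h1 : inner ℂ (z j) (z j) = 0 := by rw [hin, if_pos rfl, hj]; simp
      rw [inner_self_eq_zero.1 h1]
      simp [r, hj]
    · rw [hb j hj, smul_smul, mul_inv_cancel₀, one_smul]
      exact_mod_cast (Real.sqrt_pos.2 (lt_of_le_of_ne (he0' j) (Ne.symm hj))).ne'
  let G : Matrix ι ι ℂ := Matrix.of fun i j => b j i
  have hG : Gᴴ * G = 1 := by
    ext j k
    rw [mul_apply, one_apply, ← orthonormal_iff_ite.1 b.orthonormal j k, PiLp.inner_apply]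
    refine Finset.sum_congr rfl fun i _ => ?_
    rw [RCLike.inner_apply, mul_comm]
    rfl
  have hGu : G ∈ unitaryGroup ι ℂ := mem_unitaryGroup_iff'.2 hG
  refine ⟨⟨G, hGu⟩ * star W, ?_⟩
  have hX : X = Z * ((star W : unitaryGroup ι ℂ) : Matrix ι ι ℂ) := by
    rw [hZ, Matrix.mul_assoc]
    change _ = X * ((W : Matrix ι ι ℂ) * (W : Matrix ι ι ℂ)ᴴ)
    rw [unitary_mul_conjTranspose, Matrix.mul_one]
  have hsq : ‖Z - G‖ ^ 2 ≤ ‖Y * (W : Matrix ι ι ℂ)‖ ^ 2 := by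
    rw [frobenius_sq', frobenius_sq']
    refine Finset.sum_le_sum fun j _ => ?_
    rw [← he1]
    have h1 : ∀ i, (Z - G) i j = ((r j - 1 : ℝ) : ℂ) * b j i := fun i => by
      have := congrArg (fun v : EuclideanSpace ℂ ι => v i) (hzb j)
      change Z i j = (r j : ℂ) * b j i at this
      rw [Matrix.sub_apply, this]
      push_cast
      simp only [G, of_apply]
      ring
    have h2 : ∑ i, ‖b j i‖ ^ 2 = 1 := by
      rw [← EuclideanSpace.norm_sq_eq, b.orthonormal.1, one_pow]
    simp_rw [h1, norm_mul, mul_pow, ← Finset.mul_sum, h2, Complex.norm_real, Real.norm_eq_abs,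
      sq_abs]
    -- `(1 - r)² ≤ 1 - r²` for `0 ≤ r ≤ 1`.
    have hr0 : 0 ≤ r j := Real.sqrt_nonneg _
    have hr : r j ^ 2 = e j := Real.sq_sqrt (he0' j)
    have hr1 : r j ≤ 1 := Real.sqrt_le_one.2 (he1' j)
    nlinarith
  rw [← frobenius_mul_unitary W Y]
  refine le_trans (le_of_eq ?_) ((sq_le_sq₀ (norm_nonneg _) (norm_nonneg _)).1 hsq)
  conv_lhs => rw [hX]
  rw [Submonoid.coe_mul, ← Matrix.sub_mul, frobenius_mul_unitary]

/-- The matrix of the inclusion of coordinates `e : κ → ι`. -/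
def inclMatrix [DecidableEq ι] (e : κ → ι) : Matrix ι κ ℂ := (1 : Matrix ι ι ℂ).submatrix id e

/-- The compression of a unitary to a set of coordinates is close to a unitary if the unitary has
small entries off the diagonal blocks. -/
theorem exists_unitary_compression [DecidableEq ι] [DecidableEq κ] {e : κ → ι}
    (he : Function.Injective e) (U : unitaryGroup ι ℂ) {δ : ℝ}
    (hδ : ∑ i, ∑ k, (if i ∈ Set.range e then 0 else ‖(U : Matrix ι ι ℂ) i (e k)‖ ^ 2) ≤ δ) :
    ∃ V : unitaryGroup κ ℂ,
      ‖(U : Matrix ι ι ℂ) * inclMatrix e - inclMatrix e * (V : Matrix κ κ ℂ)‖ ^ 2 ≤ 2 * δ := by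
  classical
  have hUJ : (U : Matrix ι ι ℂ) * inclMatrix e = (U : Matrix ι ι ℂ).submatrix id e := by
    ext i k
    simp [inclMatrix, mul_apply, one_apply]
  have hJV : ∀ (V : Matrix κ κ ℂ) k l, (inclMatrix e * V) (e k) l = V k l := fun V k l => by
    rw [mul_apply, Finset.sum_eq_single k]
    · simp [inclMatrix, one_apply]
    · intro j _ hj
      simp [inclMatrix, he.ne hj.symm]
    · simp
  have hJV0 : ∀ (V : Matrix κ κ ℂ) i l, i ∉ Set.range e → (inclMatrix e * V) i l = 0 :=
    fun V i l hi => by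
      rw [mul_apply]
      refine Finset.sum_eq_zero fun j _ => ?_
      have : i ≠ e j := fun h => hi ⟨j, h.symm⟩
      simp [inclMatrix, this]
  -- `X` is the compression of `U`, and `Y` the remaining part of the columns in the range of `e`.
  let Y : Matrix ι κ ℂ := of fun i k => if i ∈ Set.range e then 0 else (U : Matrix ι ι ℂ) i (e k)
  have hY : ‖Y‖ ^ 2 ≤ δ := by
    rw [frobenius_sq]
    refine le_trans (le_of_eq ?_) hδ
    refine Finset.sum_congr rfl fun i _ => Finset.sum_congr rfl fun k _ => ?_
    simp only [Y, of_apply]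
    split_ifs <;> simp
  -- splitting a sum over `ι` into the range of `e` and its complement
  have hsplit : ∀ {R : Type} [AddCommMonoid R] (f : ι → R),
      ∑ i, f i = ∑ k, f (e k) + ∑ i, (if i ∈ Set.range e then 0 else f i) := fun f => by
    rw [← Finset.sum_filter_add_sum_filter_not Finset.univ (fun i => i ∈ Set.range e) f]
    congr 1
    · rw [← Finset.sum_image (s := Finset.univ) (g := e) (f := f) fun a _ b _ h => he h]
      refine Finset.sum_congr ?_ fun _ _ => rfl
      ext i; simp
    · rw [Finset.sum_filter]
      refine Finset.sum_congr rfl fun i _ => ?_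
      by_cases hi : i ∈ Set.range e <;> simp [hi]
  let X : Matrix κ κ ℂ := (U : Matrix ι ι ℂ).submatrix e e
  have hXY : Xᴴ * X + Yᴴ * Y = 1 := by
    ext k l
    have h1 := congrFun (congrFun (unitary_conjTranspose_mul U) (e k)) (e l)
    rw [mul_apply, hsplit] at h1
    rw [Matrix.add_apply, mul_apply, mul_apply]
    refine Eq.trans ?_ (h1.trans ?_)
    · congr 1
      refine Finset.sum_congr rfl fun i _ => ?_
      simp only [Y, conjTranspose_apply, of_apply]
      split_ifs <;> simp
    · simp [one_apply, he.eq_iff]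
  obtain ⟨V, hV⟩ := exists_unitary_near X Y hXY
  refine ⟨V, ?_⟩
  have h2 : ‖X - (V : Matrix κ κ ℂ)‖ ^ 2 ≤ ‖Y‖ ^ 2 := by gcongr
  have h3 : ‖(U : Matrix ι ι ℂ) * inclMatrix e - inclMatrix e * (V : Matrix κ κ ℂ)‖ ^ 2
      = ‖X - (V : Matrix κ κ ℂ)‖ ^ 2 + ‖Y‖ ^ 2 := by
    rw [frobenius_sq, frobenius_sq, frobenius_sq, hsplit]
    congr 1
    · refine Finset.sum_congr rfl fun k _ => Finset.sum_congr rfl fun l _ => ?_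
      rw [Matrix.sub_apply, hJV, hUJ]
      rfl
    · refine Finset.sum_congr rfl fun i _ => ?_
      by_cases hi : i ∈ Set.range e
      · simp only [Y, hi, if_true, of_apply, norm_zero]
        simp
      · simp only [hi, if_false, Y, of_apply]
        refine Finset.sum_congr rfl fun l _ => ?_
        rw [Matrix.sub_apply, hJV0 _ _ _ hi, hUJ, sub_zero]
        rfl
  rw [h3]
  linarith

end Frobenius

/-! ### Matrix representations and their traces -/

section MatrixTraces

open Matrix
open scoped Matrix.Norms.Frobenius

variable {A : Type*} [CStarAlgebra A] {ι κ : Type*} [Fintype ι] [DecidableEq ι] [Fintype κ]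

theorem norm_rep_apply_le (π : A →⋆ₐ[ℂ] Matrix ι ι ℂ) (a : A) (i j : ι) : ‖π a i j‖ ≤ ‖a‖ := by
  let f : A →⋆ₐ[ℂ] CStarMatrix ι ι ℂ :=
    (CStarMatrix.ofMatrixStarAlgEquiv (n := ι) (A := ℂ) : Matrix ι ι ℂ →⋆ₐ[ℂ] CStarMatrix ι ι ℂ).comp π
  have h1 : ‖f a i j‖ ≤ ‖f a‖ := CStarMatrix.norm_entry_le_norm
  exact h1.trans (NonUnitalStarAlgHom.norm_apply_le f a)

/-- A representation of a C⋆-algebra is contractive, as its matrices act on the columns of `Y`. -/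
theorem frobenius_rep_mul_le (π : A →⋆ₐ[ℂ] Matrix ι ι ℂ) (a : A) (Y : Matrix ι κ ℂ) :
    ‖π a * Y‖ ≤ ‖a‖ * ‖Y‖ := by
  let := CStarAlgebra.spectralOrder A
  have := CStarAlgebra.spectralOrderedRing A
  have h0 : (0 : A) ≤ algebraMap ℝ A (‖a‖ ^ 2) - star a * a := by
    rw [sub_nonneg, sq, ← CStarRing.norm_star_mul_self]
    exact IsSelfAdjoint.le_algebraMap_norm_self (IsSelfAdjoint.star_mul_self a)
  obtain ⟨c, hc⟩ := CStarAlgebra.nonneg_iff_eq_star_mul_self.1 h0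
  have key : ∀ x : A, ((‖π x * Y‖ ^ 2 : ℝ) : ℂ) = (Yᴴ * (π (star x * x) * Y)).trace := fun x => by
    rw [frobenius_sq_eq_trace, conjTranspose_mul, map_mul, map_star, Matrix.mul_assoc,
      Matrix.mul_assoc]
    rfl
  have h1 := key c
  rw [← hc, map_sub, Matrix.sub_mul, Matrix.mul_sub, trace_sub, ← key a,
    Algebra.algebraMap_eq_smul_one, ← Complex.coe_smul, map_smul, map_one, Matrix.smul_mul,
    Matrix.one_mul, Matrix.mul_smul, trace_smul, ← frobenius_sq_eq_trace, smul_eq_mul] at h1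
  have h2 : ‖π c * Y‖ ^ 2 = ‖a‖ ^ 2 * ‖Y‖ ^ 2 - ‖π a * Y‖ ^ 2 := by exact_mod_cast h1
  refine (sq_le_sq₀ (norm_nonneg _) (by positivity)).1 ?_
  nlinarith [sq_nonneg ‖π c * Y‖]

theorem frobenius_mul_rep_le (π : A →⋆ₐ[ℂ] Matrix ι ι ℂ) (a : A) (Y : Matrix κ ι ℂ) :
    ‖Y * π a‖ ≤ ‖a‖ * ‖Y‖ := by
  have h := frobenius_rep_mul_le π (star a) Yᴴ
  rwa [map_star, star_eq_conjTranspose, ← conjTranspose_mul, frobenius_norm_conjTranspose,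
    frobenius_norm_conjTranspose, norm_star] at h

/-- The normalised trace of a square matrix. -/
noncomputable def normTrace (X : Matrix ι ι ℂ) : ℂ := (Fintype.card ι : ℂ)⁻¹ * X.trace

/-- The functional `a ↦ tr(π(a))` for the normalised trace `tr` and a matrix representation `π`. -/
noncomputable def matrixTrace (π : A →⋆ₐ[ℂ] Matrix ι ι ℂ) : WeakDual ℂ A :=
  StrongDual.toWeakDual (LinearMap.mkContinuous
    { toFun := fun a => normTrace (π a)
      map_add' := fun a b => by simp only [normTrace, map_add, trace_add, mul_add]
      map_smul' := fun c a => by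
        simp only [normTrace, map_smul, trace_smul, smul_eq_mul, RingHom.id_apply]; ring } 1
    (fun a => by
      simp only [normTrace, LinearMap.coe_mk, AddHom.coe_mk, norm_mul, norm_inv, one_mul]
      have h1 : ‖(π a).trace‖ ≤ Fintype.card ι * ‖a‖ := by
        refine (norm_sum_le _ _).trans ((Finset.sum_le_sum fun i _ =>
          norm_rep_apply_le π a i i).trans ?_)
        simp
      rw [Complex.norm_natCast]
      calc _ ≤ (Fintype.card ι : ℝ)⁻¹ * (Fintype.card ι * ‖a‖) := by gcongr
        _ = ((Fintype.card ι : ℝ)⁻¹ * Fintype.card ι) * ‖a‖ := by ring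
        _ ≤ 1 * ‖a‖ := by gcongr; exact inv_mul_le_one
        _ = ‖a‖ := one_mul _))

theorem matrixTrace_apply (π : A →⋆ₐ[ℂ] Matrix ι ι ℂ) (a : A) :
    matrixTrace π a = (Fintype.card ι : ℂ)⁻¹ * (π a).trace := rfl

theorem matrixTrace_star_mul_self (π : A →⋆ₐ[ℂ] Matrix ι ι ℂ) (a : A) :
    matrixTrace π (star a * a) = ((((Fintype.card ι : ℝ)⁻¹ * ‖π a‖ ^ 2 : ℝ)) : ℂ) := by
  rw [matrixTrace_apply, map_mul, map_star, star_eq_conjTranspose, ← frobenius_sq_eq_trace]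
  push_cast
  rfl

theorem matrixTrace_mem [Nonempty ι] (π : A →⋆ₐ[ℂ] Matrix ι ι ℂ) :
    matrixTrace π ∈ traceSpace A := by
  refine ⟨?_, fun a => ?_, fun a b => ?_⟩
  · rw [matrixTrace_apply, map_one, Matrix.trace_one, inv_mul_cancel₀]
    exact_mod_cast Fintype.card_ne_zero
  · rw [matrixTrace_star_mul_self]
    exact_mod_cast (by positivity : (0 : ℝ) ≤ (Fintype.card ι : ℝ)⁻¹ * ‖π a‖ ^ 2)
  · rw [matrixTrace_apply, matrixTrace_apply, map_mul, map_mul, trace_mul_comm]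

theorem traceNorm_matrixTrace [Nonempty ι] (π : A →⋆ₐ[ℂ] Matrix ι ι ℂ) (a : A) :
    ‖π a‖ = traceNorm (matrixTrace π) a * ‖(1 : Matrix ι ι ℂ)‖ := by
  have h1 := traceNorm_sq (matrixTrace_mem π) a
  rw [matrixTrace_star_mul_self, Complex.ofReal_re] at h1
  rw [← sq_eq_sq₀ (norm_nonneg _) (mul_nonneg (traceNorm_nonneg _ _) (norm_nonneg _)), mul_pow, h1,
    frobenius_one_sq]
  field_simp

variable (A) in
/-- The normalised traces of matrix representations of `A`. -/
def matrixTraces : Set (WeakDual ℂ A) :=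
  {φ | ∃ (ι : Type) (_ : Fintype ι) (_ : DecidableEq ι) (_ : Nonempty ι)
    (π : A →⋆ₐ[ℂ] Matrix ι ι ℂ), φ = matrixTrace π}

theorem matrixTraces_subset : matrixTraces A ⊆ traceSpace A := by
  rintro _ ⟨ι, _, _, _, π, rfl⟩
  exact matrixTrace_mem π

end MatrixTraces

/-! ### Algebras whose matrix representations are parametrised by unitaries -/

section Model

open Matrix
open scoped Matrix.Norms.Frobenius Kronecker

/-- The matrix `1 ⊗ J`. -/
def ampl (n : ℕ) {κ κ' : Type*} (J : Matrix κ κ' ℂ) : Matrix (Fin n × κ) (Fin n × κ') ℂ :=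
  (1 : Matrix (Fin n) (Fin n) ℂ) ⊗ₖ J

/-- A parametrisation of the matrix representations of `A` by `d`-tuples of unitaries on
`ℂⁿ ⊗ ℂᵏ`. It is compatible with approximate intertwiners of the form `1 ⊗ J` (`defect`), and
matrices which almost commute with a representation can be straightened to `1 ⊗ Λ`, with `Λ`
diagonal, at the expense of another choice of the unitaries (`straighten`). -/
structure MatrixModel (A : Type*) [CStarAlgebra A] (d n : ℕ) where
  /-- The representation given by a tuple of unitaries. -/
  rep : ∀ (κ : Type) [Fintype κ] [DecidableEq κ], (Fin d → unitaryGroup (Fin n × κ) ℂ) →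
    (A →⋆ₐ[ℂ] Matrix (Fin n × κ) (Fin n × κ) ℂ)
  /-- The index set of the generators of `A`. -/
  σ : Type
  /-- The algebra is finitely generated. -/
  finite : Finite σ
  /-- The generators of `A`. -/
  gen : σ → A
  /-- The generators generate a dense star subalgebra. -/
  dense : Dense (StarAlgebra.adjoin ℂ (Set.range gen) : Set A)
  /-- The fixed tensor factor is not zero. -/
  pos : 0 < n
  /-- An approximate intertwiner `1 ⊗ J` of two tuples of unitaries, in the Frobenius norm, is an
  approximate intertwiner of the two representations, uniformly in the dimensions. -/
  defect : ∀ s, ∃ C : ℝ, 0 ≤ C ∧ ∀ (κ κ' : Type) [Fintype κ] [DecidableEq κ] [Fintype κ']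
    [DecidableEq κ'] (J : Matrix κ κ' ℂ) (u : Fin d → unitaryGroup (Fin n × κ) ℂ)
    (v : Fin d → unitaryGroup (Fin n × κ') ℂ),
    ‖rep κ u (gen s) * ampl n J - ampl n J * rep κ' v (gen s)‖ ≤
      C * ∑ i, ‖(u i).1 * ampl n J - ampl n J * (v i).1‖
  /-- Every matrix representation is, up to relabelling of the coordinates, given by a tuple of
  unitaries; only its trace matters. -/
  complete : ∀ (ι : Type) [Fintype ι] [DecidableEq ι] [Nonempty ι] (π : A →⋆ₐ[ℂ] Matrix ι ι ℂ),
    ∃ (κ : Type) (_ : Fintype κ) (_ : DecidableEq κ) (_ : Nonempty κ)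
      (u : Fin d → unitaryGroup (Fin n × κ) ℂ), matrixTrace π = matrixTrace (rep κ u)
  /-- A matrix `0 ≤ B ≤ 1` that almost commutes with the representation given by `u` is, after
  conjugation with a unitary `w`, close to a diagonal matrix `1 ⊗ Λ`; the conjugated representation
  is given by a tuple `v` that almost commutes with `1 ⊗ Λ`. The errors are relative to the
  Frobenius norm of the identity. -/
  straighten : ∀ ε > 0, ∃ δ > 0, ∀ (κ : Type) [Fintype κ] [DecidableEq κ]
    (u : Fin d → unitaryGroup (Fin n × κ) ℂ) (B : Matrix (Fin n × κ) (Fin n × κ) ℂ),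
    B.PosSemidef → (1 - B).PosSemidef →
    (∀ s, ‖B * rep κ u (gen s) - rep κ u (gen s) * B‖ ≤
      δ * ‖(1 : Matrix (Fin n × κ) (Fin n × κ) ℂ)‖) →
    ∃ (v : Fin d → unitaryGroup (Fin n × κ) ℂ) (w : unitaryGroup (Fin n × κ) ℂ) (l : κ → ℝ),
      (∀ k, 0 ≤ l k ∧ l k ≤ 1) ∧
      (∀ a, rep κ v a = w.1 * rep κ u a * w.1ᴴ) ∧
      ‖w.1 * B * w.1ᴴ - ampl n (diagonal fun k => (l k : ℂ))‖ ≤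
        ε * ‖(1 : Matrix (Fin n × κ) (Fin n × κ) ℂ)‖ ∧
      ∀ i, ‖(v i).1 * ampl n (diagonal fun k => (l k : ℂ)) -
        ampl n (diagonal fun k => (l k : ℂ)) * (v i).1‖ ≤
        ε * ‖(1 : Matrix (Fin n × κ) (Fin n × κ) ℂ)‖
  /-- In every dimension `n k` some tuple of unitaries gives an irreducible representation. -/
  irreducible : ∀ (κ : Type) [Fintype κ] [DecidableEq κ] [Nonempty κ],
    ∃ u : Fin d → unitaryGroup (Fin n × κ) ℂ, ∀ X : Matrix (Fin n × κ) (Fin n × κ) ℂ,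
      (∀ a, X * rep κ u a = rep κ u a * X) → ∃ c : ℂ, X = c • 1
  /-- The representation depends analytically on the unitaries. -/
  analytic : ∀ (κ : Type) [Fintype κ] [DecidableEq κ]
    (u : ℝ → Fin d → unitaryGroup (Fin n × κ) ℂ),
    (∀ i p q, AnalyticOnNhd ℝ
      (fun t => (u t i).1 p q) Set.univ) →
    ∀ s p q, AnalyticOnNhd ℝ (fun t => rep κ (u t) (gen s) p q) Set.univ

variable {A : Type*} [CStarAlgebra A] {d n : ℕ}

theorem conjTranspose_ampl {κ κ' : Type*} (J : Matrix κ κ' ℂ) : (ampl n J)ᴴ = ampl n Jᴴ := by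
  rw [ampl, conjTranspose_kronecker, conjTranspose_one, ampl]

theorem ampl_mul {κ κ' κ'' : Type*} [Fintype κ'] (J : Matrix κ κ' ℂ) (J' : Matrix κ' κ'' ℂ) :
    ampl n (J * J') = ampl n J * ampl n J' := by
  rw [ampl, ampl, ampl, ← mul_kronecker_mul, Matrix.one_mul]

theorem ampl_one {κ : Type*} [DecidableEq κ] :
    ampl n (1 : Matrix κ κ ℂ) = 1 := by
  rw [ampl, one_kronecker_one]

theorem ampl_apply {κ κ' : Type*} (J : Matrix κ κ' ℂ) (x : Fin n × κ) (y : Fin n × κ') :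
    ampl n J x y = if x.1 = y.1 then J x.2 y.2 else 0 := by
  simp [ampl, kroneckerMap_apply, one_apply]

theorem ampl_diagonal {κ : Type*} [DecidableEq κ] (l : κ → ℂ) :
    ampl n (diagonal l) = diagonal fun x : Fin n × κ => l x.2 := by
  ext ⟨a, k⟩ ⟨b, k'⟩
  rw [ampl_apply]
  simp only [diagonal_apply, Prod.mk.injEq]
  by_cases h : a = b <;> simp [h]

theorem ampl_inclMatrix {κ κ' : Type*} [DecidableEq κ] (e : κ' → κ) :
    ampl n (inclMatrix e) = inclMatrix (Prod.map (id : Fin n → Fin n) e) := by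
  ext ⟨a, k⟩ ⟨b, k'⟩
  rw [ampl_apply]
  simp only [inclMatrix, submatrix_apply, one_apply, id, Prod.map_apply, Prod.mk.injEq]
  by_cases h : a = b <;> simp [h]

namespace MatrixModel

variable (𝓜 : MatrixModel A d n)

/-- The intertwining defect of an element of the star algebra generated by the generators is
bounded by the intertwining defects of the unitaries. -/
theorem defect_adjoin {a : A} (ha : a ∈ StarAlgebra.adjoin ℂ (Set.range 𝓜.gen)) :
    ∃ C : ℝ, 0 ≤ C ∧ ∀ (κ κ' : Type) [Fintype κ] [DecidableEq κ] [Fintype κ']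
    [DecidableEq κ'] (J : Matrix κ κ' ℂ) (u : Fin d → unitaryGroup (Fin n × κ) ℂ)
    (v : Fin d → unitaryGroup (Fin n × κ') ℂ),
    ‖𝓜.rep κ u a * ampl n J - ampl n J * 𝓜.rep κ' v a‖ ≤
      C * ∑ i, ‖(u i).1 * ampl n J - ampl n J * (v i).1‖ := by
  induction ha using StarAlgebra.adjoin_induction with
  | mem x hx => obtain ⟨s, rfl⟩ := hx; exact 𝓜.defect s
  | algebraMap r =>
    refine ⟨0, le_rfl, fun κ κ' _ _ _ _ J u v => ?_⟩
    rw [Algebra.algebraMap_eq_smul_one, map_smul, map_smul, map_one, map_one, Matrix.smul_mul,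
      Matrix.mul_smul, Matrix.one_mul, Matrix.mul_one, sub_self, norm_zero, zero_mul]
  | add x y _ _ hx hy =>
    obtain ⟨C, hC, hx⟩ := hx
    obtain ⟨C', hC', hy⟩ := hy
    refine ⟨C + C', by positivity, fun κ κ' _ _ _ _ J u v => ?_⟩
    have e : 𝓜.rep κ u (x + y) * ampl n J - ampl n J * 𝓜.rep κ' v (x + y)
        = (𝓜.rep κ u x * ampl n J - ampl n J * 𝓜.rep κ' v x)
          + (𝓜.rep κ u y * ampl n J - ampl n J * 𝓜.rep κ' v y) := by
      rw [map_add, map_add, Matrix.add_mul, Matrix.mul_add]; abel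
    rw [e, add_mul]
    exact (norm_add_le _ _).trans (add_le_add (hx κ κ' J u v) (hy κ κ' J u v))
  | mul x y _ _ hx hy =>
    obtain ⟨C, hC, hx⟩ := hx
    obtain ⟨C', hC', hy⟩ := hy
    refine ⟨‖x‖ * C' + ‖y‖ * C, by positivity, fun κ κ' _ _ _ _ J u v => ?_⟩
    have e : 𝓜.rep κ u (x * y) * ampl n J - ampl n J * 𝓜.rep κ' v (x * y)
        = 𝓜.rep κ u x * (𝓜.rep κ u y * ampl n J - ampl n J * 𝓜.rep κ' v y)
          + (𝓜.rep κ u x * ampl n J - ampl n J * 𝓜.rep κ' v x) * 𝓜.rep κ' v y := by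
      rw [map_mul, map_mul, Matrix.mul_sub, Matrix.sub_mul]
      simp only [Matrix.mul_assoc]
      abel
    rw [e, add_mul]
    refine (norm_add_le _ _).trans (add_le_add ?_ ?_)
    · refine (frobenius_rep_mul_le _ _ _).trans ?_
      rw [mul_assoc]
      exact mul_le_mul_of_nonneg_left (hy κ κ' J u v) (norm_nonneg _)
    · refine (frobenius_mul_rep_le _ _ _).trans ?_
      rw [mul_assoc]
      exact mul_le_mul_of_nonneg_left (hx κ κ' J u v) (norm_nonneg _)
  | star x _ hx =>
    obtain ⟨C, hC, hx⟩ := hx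
    refine ⟨C, hC, fun κ κ' _ _ _ _ J u v => ?_⟩
    have h := hx κ' κ Jᴴ v u
    rw [← conjTranspose_ampl] at h
    have e1 : 𝓜.rep κ u (star x) * ampl n J - ampl n J * 𝓜.rep κ' v (star x)
        = -(𝓜.rep κ' v x * (ampl n J)ᴴ - (ampl n J)ᴴ * 𝓜.rep κ u x)ᴴ := by
      rw [conjTranspose_sub, conjTranspose_mul, conjTranspose_mul, conjTranspose_conjTranspose,
        map_star, map_star, neg_sub]
      rfl
    rw [e1, norm_neg, frobenius_norm_conjTranspose]
    refine h.trans (le_of_eq ?_)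
    congr 1
    refine Finset.sum_congr rfl fun i _ => ?_
    -- The defect of `J*` for `(v, u)` is that of `J` for `(u, v)`, as the unitaries can be moved across.
    have e2 : (u i).1 * (((v i).1 * (ampl n J)ᴴ
        - (ampl n J)ᴴ * (u i).1)ᴴ * (v i).1)
        = (u i).1 * ampl n J - ampl n J * (v i).1 := by
      rw [conjTranspose_sub, conjTranspose_mul, conjTranspose_mul, conjTranspose_conjTranspose,
        Matrix.sub_mul, Matrix.mul_sub, Matrix.mul_assoc, unitary_conjTranspose_mul, Matrix.mul_one,
        Matrix.mul_assoc, ← Matrix.mul_assoc (u i).1, unitary_mul_conjTranspose,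
        Matrix.one_mul]
    rw [← e2, frobenius_unitary_mul, frobenius_mul_unitary, frobenius_norm_conjTranspose]

end MatrixModel

/-- The unitary `u ⊗ 1` on `ℂⁿ ⊗ (ℂᵏ ⊗ ℂᴹ)`. -/
def amplUnitary {n : ℕ} {κ : Type*} [Fintype κ] [DecidableEq κ] (M : ℕ)
    (u : unitaryGroup (Fin n × κ) ℂ) : unitaryGroup (Fin n × (κ × Fin M)) ℂ :=
  ⟨(u.1 ⊗ₖ (1 : Matrix (Fin M) (Fin M) ℂ)).submatrix
    (Equiv.prodAssoc _ _ _).symm (Equiv.prodAssoc _ _ _).symm, by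
    rw [mem_unitaryGroup_iff, star_eq_conjTranspose, conjTranspose_submatrix,
      submatrix_mul_equiv, conjTranspose_kronecker, ← mul_kronecker_mul, conjTranspose_one,
      Matrix.one_mul, unitary_mul_conjTranspose, one_kronecker_one, submatrix_one_equiv]⟩

theorem amplUnitary_apply {κ : Type*} [Fintype κ] [DecidableEq κ] (M : ℕ)
    (u : unitaryGroup (Fin n × κ) ℂ) (x y : Fin n × (κ × Fin M)) :
    (amplUnitary M u).1 x y
      = if x.2.2 = y.2.2 then u.1 (x.1, x.2.1) (y.1, y.2.1) else 0 := by
  simp [amplUnitary, kroneckerMap_apply, one_apply]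

theorem mul_inclMatrix {ι κ κ' : Type*} [Fintype κ] [DecidableEq κ] (X : Matrix ι κ ℂ)
    (e : κ' → κ) : X * inclMatrix e = X.submatrix id e := by
  ext i k
  simp [inclMatrix, mul_apply, one_apply]

/-- The unitaries `u ⊗ 1` give the representation `R_u ⊗ 1`, of which only the diagonal is needed:
the inclusion `J` of `ℂᵏ` as `ℂᵏ ⊗ e_s` intertwines `u ⊗ 1` with `u` exactly, hence also the
representations. -/
theorem MatrixModel.rep_amplUnitary_diag (𝓜 : MatrixModel A d n) {a : A}
    (ha : a ∈ StarAlgebra.adjoin ℂ (Set.range 𝓜.gen)) {κ : Type} [Fintype κ] [DecidableEq κ]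
    (M : ℕ) (u : Fin d → unitaryGroup (Fin n × κ) ℂ) (x : Fin n × (κ × Fin M)) :
    𝓜.rep (κ × Fin M) (fun i => amplUnitary M (u i)) a x x
      = 𝓜.rep κ u a (x.1, x.2.1) (x.1, x.2.1) := by
  obtain ⟨b, k, s⟩ := x
  obtain ⟨C, -, hC⟩ := 𝓜.defect_adjoin ha
  let J : Matrix (κ × Fin M) κ ℂ := inclMatrix fun k => (k, s)
  have hJ : ∀ {ι : Type} (Y : Matrix (Fin n × κ) ι ℂ) (x : Fin n × (κ × Fin M)) (y : ι),
      (ampl n J * Y) x y = if x.2.2 = s then Y (x.1, x.2.1) y else 0 := by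
    intro ι Y x y
    rw [ampl_inclMatrix, mul_apply, Finset.sum_eq_single (x.1, x.2.1)]
    · obtain ⟨b, k, t⟩ := x
      simp [inclMatrix, one_apply]
    · rintro ⟨b', k'⟩ _ hne
      obtain ⟨b, k, t⟩ := x
      simp only [ne_eq, Prod.mk.injEq, not_and] at hne
      simp only [inclMatrix, submatrix_apply, one_apply, id, Prod.map_apply, Prod.mk.injEq]
      rw [if_neg, zero_mul]
      rintro ⟨rfl, rfl, -⟩
      exact hne rfl rfl
    · simp
  have h := hC (κ × Fin M) κ J (fun i => amplUnitary M (u i)) u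
  have h0 : ∀ i, ((amplUnitary M (u i)).1) * ampl n J
      - ampl n J * (u i).1 = 0 := by
    intro i
    rw [sub_eq_zero]
    ext x ⟨b', k'⟩
    rw [hJ, ampl_inclMatrix, mul_inclMatrix, submatrix_apply, amplUnitary_apply]
    rfl
  simp only [h0, norm_zero, Finset.sum_const_zero, mul_zero, norm_le_zero_iff, sub_eq_zero] at h
  have h2 := congrFun (congrFun h (b, k, s)) (b, k)
  rw [hJ, ampl_inclMatrix, mul_inclMatrix, submatrix_apply] at h2
  simpa using h2

end Model

/-! ### Compression of matrix representations -/

section Compression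

open Matrix
open scoped Matrix.Norms.Frobenius Kronecker

/-- An interval `[α, β)` contains at most `|β - α| + 1` natural numbers. -/
theorem card_fin_filter_le (M : ℕ) (α β : ℝ) :
    (((Finset.univ : Finset (Fin M)).filter fun s : Fin M => α ≤ ((s : ℕ) : ℝ) ∧ ((s : ℕ) : ℝ) < β).card : ℝ)
      ≤ |β - α| + 1 := by
  rcases le_or_gt β α with h | h
  · rw [Finset.filter_false_of_mem, Finset.card_empty]
    · simp only [Nat.cast_zero]; positivity
    · rintro s - ⟨h1, h2⟩
      linarith
  · rw [abs_of_pos (sub_pos.2 h)]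
    have h1 : ((Finset.univ : Finset (Fin M)).filter fun s : Fin M => α ≤ ((s : ℕ) : ℝ) ∧ ((s : ℕ) : ℝ) < β).card
        ≤ (Finset.Ico ⌈α⌉ ⌈β⌉).card := by
      refine Finset.card_le_card_of_injOn (fun s : Fin M => ((s : ℕ) : ℤ)) ?_ ?_
      · intro s hs
        simp only [Finset.coe_filter, Finset.mem_univ, true_and, Set.mem_ofPred_eq] at hs
        rw [Finset.coe_Ico, Set.mem_Ico, Int.ceil_le, Int.lt_ceil]
        exact_mod_cast hs
      · intro s _ s' _ h
        exact Fin.ext (Int.ofNat_inj.1 h)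
    rw [Int.card_Ico] at h1
    have h2 : ⌈α⌉ ≤ ⌈β⌉ := Int.ceil_mono h.le
    have h3 : (((⌈β⌉ - ⌈α⌉).toNat : ℕ) : ℝ) = (⌈β⌉ : ℝ) - ⌈α⌉ := by
      have : (((⌈β⌉ - ⌈α⌉).toNat : ℕ) : ℤ) = ⌈β⌉ - ⌈α⌉ := Int.toNat_of_nonneg (by omega)
      exact_mod_cast this
    have h4 : (((Finset.univ : Finset (Fin M)).filter fun s : Fin M =>
        α ≤ ((s : ℕ) : ℝ) ∧ ((s : ℕ) : ℝ) < β).card : ℝ) ≤ (⌈β⌉ : ℝ) - ⌈α⌉ := by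
      rw [← h3]; exact_mod_cast h1
    linarith [Int.le_ceil α, Int.ceil_lt_add_one β]

/-- The number of natural numbers below `β ≥ 0` is `β` up to an error of `1`. -/
theorem card_fin_filter_lt {M : ℕ} {β : ℝ} (h0 : 0 ≤ β) (h1 : β ≤ M) :
    β ≤ (((Finset.univ : Finset (Fin M)).filter fun s : Fin M => ((s : ℕ) : ℝ) < β).card : ℝ) ∧
      (((Finset.univ : Finset (Fin M)).filter fun s : Fin M => ((s : ℕ) : ℝ) < β).card : ℝ) ≤ β + 1 := by
  have h : ((Finset.univ : Finset (Fin M)).filter fun s : Fin M => ((s : ℕ) : ℝ) < β).card = ⌈β⌉₊ := by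
    have h2 : ⌈β⌉₊ ≤ M := Nat.ceil_le.2 h1
    rw [← Fintype.card_fin ⌈β⌉₊, ← Finset.card_univ,
      ← Finset.card_map (Fin.castLEEmb h2)]
    congr 1
    ext s
    simp only [Finset.mem_filter, Finset.mem_univ, true_and, Finset.mem_map, Fin.castLEEmb_apply]
    rw [← Nat.lt_ceil]
    constructor
    · intro hs
      exact ⟨⟨s, hs⟩, rfl⟩
    · rintro ⟨x, rfl⟩
      exact x.2
  rw [h]
  exact ⟨Nat.le_ceil β, (Nat.ceil_lt_add_one h0).le⟩

/-- The coordinates of `ℂᵏ ⊗ ℂᴹ` lying below the graph of `M l`. -/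
abbrev Below {κ : Type} (M : ℕ) (l : κ → ℝ) : Type :=
  {q : κ × Fin M // ((q.2 : ℕ) : ℝ) < M * l q.1}

open scoped Classical in
/-- A sum over the coordinates below the graph, column by column. -/
theorem sum_below {κ : Type} [Fintype κ] (M : ℕ) (l : κ → ℝ) {R : Type*} [AddCommMonoid R]
    (f : κ × Fin M → R) :
    ∑ q : Below M l, f q.1 = ∑ k, ∑ s : Fin M, if ((s : ℕ) : ℝ) < M * l k then f (k, s) else 0 := by
  rw [← Fintype.sum_prod_type' (f := fun k (s : Fin M) =>
    if ((s : ℕ) : ℝ) < M * l k then f (k, s) else 0), ← Finset.sum_filter,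
    ← Finset.sum_subtype_eq_sum_filter]
  simp

variable {A : Type*} [CStarAlgebra A] {d n : ℕ}

/-- If `v` almost commutes with `1 ⊗ Λ`, then the compression of `v ⊗ 1` to the coordinates below
the graph of `M Λ` is almost unitary, so that the inclusion of these coordinates almost
intertwines `v ⊗ 1` with a unitary. -/
theorem exists_unitary_below {κ : Type} [Fintype κ] [DecidableEq κ]
    (v : unitaryGroup (Fin n × κ) ℂ) (l : κ → ℝ) {η : ℝ}
    (hv : ‖v.1 * ampl n (diagonal fun k => (l k : ℂ)) -
        ampl n (diagonal fun k => (l k : ℂ)) * v.1‖ ≤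
        η * ‖(1 : Matrix (Fin n × κ) (Fin n × κ) ℂ)‖) (M : ℕ) :
    ∃ V : unitaryGroup (Fin n × Below M l) ℂ,
      ‖(amplUnitary M v).1 * ampl n (inclMatrix (Subtype.val : Below M l → _))
        - ampl n (inclMatrix (Subtype.val : Below M l → _)) * V.1‖ ^ 2
        ≤ 2 * ((M * η + 1) * ‖(1 : Matrix (Fin n × κ) (Fin n × κ) ℂ)‖ ^ 2) := by
  classical
  rw [ampl_inclMatrix]
  refine exists_unitary_compression (Function.injective_id.prodMap Subtype.val_injective) _ ?_
  -- The coordinates `(k, s)` and `(k', s)` are separated by the graph for at most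
  -- `M |l k' - l k| + 1` values of `s`.
  set S : ℝ := ∑ x, ∑ y, ‖v.1 x y‖ ^ 2 * (M * |l y.2 - l x.2| + 1) with hS
  have h1 : ∑ i, ∑ k : Fin n × Below M l, (if i ∈ Set.range (Prod.map (id : Fin n → Fin n)
      (Subtype.val : Below M l → κ × Fin M)) then 0 else
      ‖(amplUnitary M v).1 i (Prod.map (id : Fin n → Fin n) Subtype.val k)‖ ^ 2) ≤ S := by
    have e1 : ∀ x : Fin n × (κ × Fin M), x ∈ Set.range (Prod.map (id : Fin n → Fin n)
      (Subtype.val : Below M l → κ × Fin M)) ↔ ((x.2.2 : ℕ) : ℝ) < M * l x.2.1 := by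
      rintro ⟨a, q⟩
      constructor
      · rintro ⟨⟨b, p⟩, h⟩
        simp only [Prod.map_apply, id, Prod.mk.injEq] at h
        have := p.2
        rw [h.2] at this
        exact this
      · intro h
        exact ⟨(a, ⟨q, h⟩), rfl⟩
    simp only [e1]
    have e2 : ∀ x : Fin n × (κ × Fin M), ∑ k : Fin n × Below M l,
        (if ((x.2.2 : ℕ) : ℝ) < M * l x.2.1 then 0 else
          ‖(amplUnitary M v).1 x (Prod.map (id : Fin n → Fin n) Subtype.val k)‖ ^ 2)
        = ∑ y : Fin n × κ, ‖v.1 (x.1, x.2.1) y‖ ^ 2 *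
          if M * l x.2.1 ≤ ((x.2.2 : ℕ) : ℝ) ∧ ((x.2.2 : ℕ) : ℝ) < M * l y.2 then 1 else 0 := by
      rintro ⟨a, k, s⟩
      rw [Fintype.sum_prod_type, Fintype.sum_prod_type]
      refine Finset.sum_congr rfl fun b _ => ?_
      refine (sum_below (R := ℝ) M l (fun q => if ((s : ℕ) : ℝ) < M * l k then 0 else
          ‖(amplUnitary M v).1 (a, k, s) (b, q)‖ ^ 2)).trans ?_
      refine Finset.sum_congr rfl fun k' _ => ?_
      rw [Finset.sum_eq_single s]
      · simp only [amplUnitary_apply, if_true]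
        by_cases h1 : ((s : ℕ) : ℝ) < M * l k <;> by_cases h2 : ((s : ℕ) : ℝ) < M * l k' <;>
          simp [h1, h2, not_le.2, not_lt.1]
      · intro s' _ hs
        simp [amplUnitary_apply, hs.symm]
      · simp
    simp only [e2]
    rw [Fintype.sum_prod_type, hS, Fintype.sum_prod_type]
    refine Finset.sum_le_sum fun a _ => ?_
    rw [Fintype.sum_prod_type]
    refine Finset.sum_le_sum fun k _ => ?_
    rw [Finset.sum_comm]
    refine Finset.sum_le_sum fun y _ => ?_
    have e3 : ∑ s : Fin M, ‖v.1 (a, k) y‖ ^ 2 *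
        (if M * l k ≤ ((s : ℕ) : ℝ) ∧ ((s : ℕ) : ℝ) < M * l y.2 then (1 : ℝ) else 0)
        = ‖v.1 (a, k) y‖ ^ 2 * ((Finset.univ : Finset (Fin M)).filter fun s : Fin M =>
          M * l k ≤ ((s : ℕ) : ℝ) ∧ ((s : ℕ) : ℝ) < M * l y.2).card := by
      rw [← Finset.mul_sum, Finset.sum_boole]
    refine e3.le.trans ?_
    refine mul_le_mul_of_nonneg_left ((card_fin_filter_le M _ _).trans (le_of_eq ?_)) (by positivity)
    rw [← mul_sub, abs_mul, Nat.abs_cast]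
  refine h1.trans ?_
  have h2 : S = M * (∑ x : (Fin n × κ) × (Fin n × κ), ‖v.1 x.1 x.2‖ *
      (‖v.1 x.1 x.2‖ * |l x.2.2 - l x.1.2|)) + ‖(1 : Matrix (Fin n × κ) (Fin n × κ) ℂ)‖ ^ 2 := by
    rw [frobenius_one_sq, ← frobenius_unitary_sq v, frobenius_sq, hS,
      Fintype.sum_prod_type (γ := ℝ) (α₁ := Fin n × κ) (α₂ := Fin n × κ),
      Finset.mul_sum, ← Finset.sum_add_distrib]
    refine Finset.sum_congr rfl fun x _ => ?_
    rw [Finset.mul_sum, ← Finset.sum_add_distrib]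
    exact Finset.sum_congr rfl fun y _ => by ring
  have h3 : ∑ x : (Fin n × κ) × (Fin n × κ), (‖v.1 x.1 x.2‖ * |l x.2.2 - l x.1.2|) ^ 2
      ≤ (η * ‖(1 : Matrix (Fin n × κ) (Fin n × κ) ℂ)‖) ^ 2 := by
    refine le_trans (le_of_eq ?_) (pow_le_pow_left₀ (norm_nonneg _) hv 2)
    rw [frobenius_sq, Fintype.sum_prod_type]
    refine Finset.sum_congr rfl fun x _ => Finset.sum_congr rfl fun y _ => ?_
    rw [ampl_diagonal, Matrix.sub_apply, mul_diagonal, diagonal_mul]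
    rw [mul_comm ((l x.2 : ℂ)), ← mul_sub, norm_mul, ← Complex.ofReal_sub, Complex.norm_real,
      Real.norm_eq_abs]
  -- The Cauchy–Schwarz inequality bounds `∑ |v_{xy}|² |l y - l x|` by the commutator norm `h3`.
  have h4 := Finset.sum_mul_sq_le_sq_mul_sq Finset.univ
    (fun x : (Fin n × κ) × (Fin n × κ) => ‖v.1 x.1 x.2‖)
    (fun x => ‖v.1 x.1 x.2‖ * |l x.2.2 - l x.1.2|)
  have h5 : ∑ x : (Fin n × κ) × (Fin n × κ), ‖v.1 x.1 x.2‖ ^ 2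
      = ‖(1 : Matrix (Fin n × κ) (Fin n × κ) ℂ)‖ ^ 2 := by
    rw [frobenius_one_sq, ← frobenius_unitary_sq v, frobenius_sq, Fintype.sum_prod_type]
  have hη : 0 ≤ η * ‖(1 : Matrix (Fin n × κ) (Fin n × κ) ℂ)‖ := (norm_nonneg _).trans hv
  have h6 : ∑ x : (Fin n × κ) × (Fin n × κ), ‖v.1 x.1 x.2‖ *
      (‖v.1 x.1 x.2‖ * |l x.2.2 - l x.1.2|)
      ≤ ‖(1 : Matrix (Fin n × κ) (Fin n × κ) ℂ)‖ *
        (η * ‖(1 : Matrix (Fin n × κ) (Fin n × κ) ℂ)‖) := by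
    refine abs_le_of_sq_le_sq' ?_ (mul_nonneg (norm_nonneg _) hη) |>.2
    rw [mul_pow]
    refine h4.trans ?_
    rw [h5]
    exact mul_le_mul_of_nonneg_left h3 (by positivity)
  rw [h2]
  nlinarith [mul_le_mul_of_nonneg_left h6 (Nat.cast_nonneg (α := ℝ) M)]

namespace MatrixModel

variable (𝓜 : MatrixModel A d n)

/-- The compression of `R_v ⊗ 1` to the coordinates below the graph of `M Λ` is close to a
representation `R_V`, and its trace is `M Tr(Λ R_v)` up to rounding: the diagonal entry at `k` is
counted about `M l k` times. -/
theorem exists_trace_below {κ : Type} [Fintype κ] [DecidableEq κ]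
    (v : Fin d → unitaryGroup (Fin n × κ) ℂ) (l : κ → ℝ) (hl : ∀ k, 0 ≤ l k ∧ l k ≤ 1) {η : ℝ}
    (hv : ∀ i, ‖(v i).1 * ampl n (diagonal fun k => (l k : ℂ)) -
        ampl n (diagonal fun k => (l k : ℂ)) * (v i).1‖ ≤
        η * ‖(1 : Matrix (Fin n × κ) (Fin n × κ) ℂ)‖) (M : ℕ) :
    ∃ V : Fin d → unitaryGroup (Fin n × Below M l) ℂ,
      ∀ a ∈ StarAlgebra.adjoin ℂ (Set.range 𝓜.gen), ∀ C : ℝ, 0 ≤ C →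
      (∀ (κ κ' : Type) [Fintype κ] [DecidableEq κ] [Fintype κ']
        [DecidableEq κ'] (J : Matrix κ κ' ℂ) (u : Fin d → unitaryGroup (Fin n × κ) ℂ)
        (v : Fin d → unitaryGroup (Fin n × κ') ℂ),
        ‖𝓜.rep κ u a * ampl n J - ampl n J * 𝓜.rep κ' v a‖ ≤
          C * ∑ i, ‖(u i).1 * ampl n J - ampl n J * (v i).1‖) →
      ‖(𝓜.rep (Below M l) V a).trace -
          M * (ampl n (diagonal fun k => (l k : ℂ)) * 𝓜.rep κ v a).trace‖
        ≤ √(n * Fintype.card (Below M l)) *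
          (C * (d * √(2 * ((M * η + 1) * ‖(1 : Matrix (Fin n × κ) (Fin n × κ) ℂ)‖ ^ 2))))
          + ‖a‖ * (n * Fintype.card κ) := by
  classical
  choose V hV using fun i => exists_unitary_below (v i) l (hv i) M
  refine ⟨V, fun a ha C hC hCa => ?_⟩
  set J : Matrix (Fin n × (κ × Fin M)) (Fin n × Below M l) ℂ :=
    ampl n (inclMatrix (Subtype.val : Below M l → _)) with hJ
  have hJJ : Jᴴ * J = 1 := by
    rw [hJ, conjTranspose_ampl, ← ampl_mul, mul_inclMatrix, ← ampl_one]
    congr 1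
    ext q q'
    simp [inclMatrix, one_apply, Subtype.ext_iff]
  have hJnorm : ‖J‖ = √(n * Fintype.card (Below M l)) := by
    rw [eq_comm, Real.sqrt_eq_iff_mul_self_eq (by positivity) (norm_nonneg _), ← sq]
    have := frobenius_sq_eq_trace J
    rw [hJJ, Matrix.trace_one, Fintype.card_prod, Fintype.card_fin] at this
    exact_mod_cast this.symm
  set R := 𝓜.rep (κ × Fin M) (fun i => amplUnitary M (v i)) a with hR
  have h1 : ‖R * J - J * 𝓜.rep (Below M l) V a‖
      ≤ C * (d * √(2 * ((M * η + 1) * ‖(1 : Matrix (Fin n × κ) (Fin n × κ) ℂ)‖ ^ 2))) := by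
    refine (hCa _ _ (inclMatrix (Subtype.val : Below M l → _)) _ V).trans ?_
    refine mul_le_mul_of_nonneg_left ?_ hC
    refine (Finset.sum_le_sum fun i _ => Real.le_sqrt_of_sq_le (hV i)).trans ?_
    simp
  have h2 : ‖(Jᴴ * (R * J)).trace - (𝓜.rep (Below M l) V a).trace‖
      ≤ √(n * Fintype.card (Below M l)) *
        (C * (d * √(2 * ((M * η + 1) * ‖(1 : Matrix (Fin n × κ) (Fin n × κ) ℂ)‖ ^ 2)))) := by
    have e : (Jᴴ * (R * J)).trace - (𝓜.rep (Below M l) V a).trace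
        = (Jᴴ * (R * J - J * 𝓜.rep (Below M l) V a)).trace := by
      rw [Matrix.mul_sub, trace_sub, ← Matrix.mul_assoc Jᴴ J, hJJ, Matrix.one_mul]
    rw [e, ← hJnorm]
    exact (norm_trace_conjTranspose_mul_le _ _).trans
      (mul_le_mul_of_nonneg_left h1 (norm_nonneg _))
  set r : κ → ℝ := fun k =>
    (((Finset.univ : Finset (Fin M)).filter fun s : Fin M => ((s : ℕ) : ℝ) < M * l k).card : ℝ) with hr
  have hrk : ∀ k, |r k - M * l k| ≤ 1 := fun k => by
    have h := card_fin_filter_lt (M := M) (β := M * l k) (mul_nonneg (Nat.cast_nonneg _) (hl k).1)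
      (mul_le_of_le_one_right (Nat.cast_nonneg _) (hl k).2)
    rw [abs_le]
    constructor <;> linarith [h.1, h.2]
  have h3 : (Jᴴ * (R * J)).trace = ∑ b, ∑ k, (r k : ℂ) * 𝓜.rep κ v a (b, k) (b, k) := by
    rw [trace, Fintype.sum_prod_type]
    refine Finset.sum_congr rfl fun b _ => ?_
    have e : ∀ q : Below M l, diag (Jᴴ * (R * J)) (b, q) = 𝓜.rep κ v a (b, q.1.1) (b, q.1.1) := by
      intro q
      rw [← 𝓜.rep_amplUnitary_diag ha M v (b, q.1), diag_apply, ← conjTranspose_conjTranspose (R * J),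
        ← conjTranspose_mul, hJ, ampl_inclMatrix, mul_inclMatrix, mul_inclMatrix]
      simp [hR]
    simp only [e]
    rw [sum_below M l (fun q => 𝓜.rep κ v a (b, q.1) (b, q.1))]
    refine Finset.sum_congr rfl fun k _ => ?_
    rw [← Finset.sum_filter]
    refine (Finset.sum_const (𝓜.rep κ v a (b, k) (b, k))).trans ?_
    rw [nsmul_eq_mul, hr]
    push_cast
    rfl
  have h4 : ‖(Jᴴ * (R * J)).trace
      - M * (ampl n (diagonal fun k => (l k : ℂ)) * 𝓜.rep κ v a).trace‖
      ≤ ‖a‖ * (n * Fintype.card κ) := by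
    rw [h3, ampl_diagonal, trace, Fintype.sum_prod_type, Finset.mul_sum, ← Finset.sum_sub_distrib]
    have e : ‖a‖ * ((n : ℝ) * Fintype.card κ) = ∑ b : Fin n, ∑ k : κ, ‖a‖ := by
      simp; ring
    rw [e]
    refine norm_sum_le_of_le _ fun b _ => ?_
    rw [Finset.mul_sum, ← Finset.sum_sub_distrib]
    refine norm_sum_le_of_le _ fun k _ => ?_
    rw [diag_apply, diagonal_mul, ← mul_assoc, ← sub_mul, norm_mul]
    have : ‖(r k : ℂ) - M * (l k : ℂ)‖ ≤ 1 := by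
      have := hrk k
      rw [← Real.norm_eq_abs, ← Complex.norm_real] at this
      push_cast at this
      exact this
    calc _ ≤ 1 * ‖a‖ := mul_le_mul this (norm_rep_apply_le _ _ _ _) (norm_nonneg _) zero_le_one
      _ = ‖a‖ := one_mul _
  calc _ = ‖((Jᴴ * (R * J)).trace
      - M * (ampl n (diagonal fun k => (l k : ℂ)) * 𝓜.rep κ v a).trace)
      - ((Jᴴ * (R * J)).trace - (𝓜.rep (Below M l) V a).trace)‖ := by congr 1; ring
    _ ≤ _ := (norm_sub_le _ _).trans (by linarith)

end MatrixModel

end Compression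

/-! ### Dominated traces and matrix traces -/

section Domination

open Matrix
open scoped Matrix.Norms.Frobenius Kronecker

variable {A : Type*} [CStarAlgebra A] {d n : ℕ}

/-- A point of the closure of a set of functionals is approximated on finite sets. -/
theorem exists_near_of_mem_closure {D : Set (WeakDual ℂ A)} {φ : WeakDual ℂ A} (h : φ ∈ closure D)
    (F : Finset A) {ε : ℝ} (hε : 0 < ε) : ∃ ψ ∈ D, ∀ a ∈ F, ‖ψ a - φ a‖ < ε := by
  have hU : {ψ : WeakDual ℂ A | ∀ a ∈ F, ‖ψ a - φ a‖ < ε} ∈ nhds φ := by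
    have : {ψ : WeakDual ℂ A | ∀ a ∈ F, ‖ψ a - φ a‖ < ε} = ⋂ a ∈ F, {ψ | ‖ψ a - φ a‖ < ε} := by
      ext; simp
    rw [this, Filter.biInter_finset_mem]
    intro a _
    refine (isOpen_lt ?_ continuous_const).mem_nhds (by simpa using hε)
    exact ((WeakDual.eval_continuous a).sub continuous_const).norm
  obtain ⟨ψ, h1, h2⟩ := mem_closure_iff_nhds.1 h _ hU
  exact ⟨ψ, h2, h1⟩

/-- Passage to normalised traces. If the dimension `N'` is close to `M L`, and `T'` to `M T`, with
errors relative to `N ≤ L / t`, then the quotients `T' / N'` and `T / L` are close, with an error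
that tends to `0` with `η ≥ 1 / M`. -/
theorem norm_quotient_sub_le {T T' : ℂ} {N N' L M c α η t : ℝ} (ht : 0 < t) (hc : 0 ≤ c)
    (hα : 0 ≤ α) (hN : 0 < N) (hL : t * N ≤ L) (hη : 0 < η) (hM : 1 ≤ M * η) (hηt : 2 * η ≤ t)
    (hN' : |N' - M * L| ≤ N) (hT : ‖T‖ ≤ α * L)
    (hTT : ‖T' - M * T‖ ≤ √N' * (c * √(2 * ((M * η + 1) * N))) + α * N) :
    ‖(N' : ℂ)⁻¹ * T' - (L : ℂ)⁻¹ * T‖ ≤ c * √(8 * η / t) + 4 * α * η / t := by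
  have hL0 : 0 < L := lt_of_lt_of_le (by positivity) hL
  have hM0 : 0 < M := by
    by_contra h
    nlinarith
  -- `N' ≥ M L / 2`, hence `N / N' ≤ 2 / (M t) ≤ 2 η / t`.
  have h1 : N ≤ M * L / 2 := by
    have h2 : 2 ≤ M * t := by nlinarith
    nlinarith
  have h3 : M * L / 2 ≤ N' := by linarith [(abs_le.1 hN').1]
  have hN0 : 0 < N' := lt_of_lt_of_le (by positivity) h3
  have h4 : N / N' ≤ 2 / (M * t) := by
    rw [div_le_div_iff₀ hN0 (by positivity)]
    nlinarith
  have h5 : N / N' ≤ 2 * η / t := by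
    refine h4.trans ?_
    rw [div_le_div_iff₀ (by positivity) ht]
    nlinarith
  have e : (N' : ℂ)⁻¹ * T' - (L : ℂ)⁻¹ * T
      = (N' : ℂ)⁻¹ * (T' - M * T) + (((M * L - N') / (N' * L) : ℝ) : ℂ) * T := by
    have : (N' : ℂ) ≠ 0 := by exact_mod_cast hN0.ne'
    have : (L : ℂ) ≠ 0 := by exact_mod_cast hL0.ne'
    push_cast
    field_simp
    ring
  rw [e]
  refine (norm_add_le _ _).trans ?_
  rw [norm_mul, norm_mul, norm_inv, Complex.norm_real, Complex.norm_real, Real.norm_eq_abs,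
    Real.norm_eq_abs, abs_of_pos hN0, abs_div, abs_of_pos (mul_pos hN0 hL0), abs_sub_comm]
  have h6 : |N' - M * L| / (N' * L) * ‖T‖ ≤ α * (2 * η / t) := by
    calc _ ≤ N / (N' * L) * (α * L) := by gcongr
      _ = α * (N / N') := by field_simp
      _ ≤ _ := by gcongr
  have h7 : N'⁻¹ * ‖T' - M * T‖ ≤ c * √(8 * η / t) + α * (2 * η / t) := by
    calc _ ≤ N'⁻¹ * (√N' * (c * √(2 * ((M * η + 1) * N))) + α * N) := by gcongr
      _ = c * (√(2 * ((M * η + 1) * N)) / √N') + α * (N / N') := by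
        rw [mul_add]
        congr 1
        · nth_rw 1 [← Real.mul_self_sqrt hN0.le]
          have : √N' ≠ 0 := (Real.sqrt_pos.2 hN0).ne'
          field_simp
        · field_simp
      _ = c * √(2 * ((M * η + 1) * N) / N') + α * (N / N') := by
        rw [Real.sqrt_div (by positivity)]
      _ ≤ _ := by
        have h8 : 2 * ((M * η + 1) * N) / N' ≤ 8 * η / t := by
          calc 2 * ((M * η + 1) * N) / N' = 2 * (M * η + 1) * (N / N') := by ring
            _ ≤ 2 * (M * η + M * η) * (2 / (M * t)) := by gcongr
            _ = 8 * η / t := by field_simp; ring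
        exact add_le_add (mul_le_mul_of_nonneg_left (Real.sqrt_le_sqrt h8) hc)
          (mul_le_mul_of_nonneg_left h5 hα)
  calc _ ≤ _ := add_le_add h7 h6
    _ = _ := by ring

namespace MatrixModel

variable (𝓜 : MatrixModel A d n)

/-- If a diagonal matrix `1 ⊗ Λ` almost commutes with the unitaries `v`, then the functional
`a ↦ tr(Λ R_v(a)) / tr(Λ)` is close to the trace of another matrix representation. -/
theorem exists_matrixTrace_near (F : Finset A)
    (hF : ∀ a ∈ F, a ∈ StarAlgebra.adjoin ℂ (Set.range 𝓜.gen)) {t : ℝ} (ht : 0 < t) {ε : ℝ}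
    (hε : 0 < ε) : ∃ η > 0, ∀ (κ : Type) [Fintype κ] [DecidableEq κ] [Nonempty κ]
    (v : Fin d → unitaryGroup (Fin n × κ) ℂ) (l : κ → ℝ), (∀ k, 0 ≤ l k ∧ l k ≤ 1) →
    (∀ i, ‖(v i).1 * ampl n (diagonal fun k => (l k : ℂ)) -
        ampl n (diagonal fun k => (l k : ℂ)) * (v i).1‖ ≤
        η * ‖(1 : Matrix (Fin n × κ) (Fin n × κ) ℂ)‖) →
    t * (n * Fintype.card κ) ≤ n * ∑ k, l k →
    ∃ ψ ∈ matrixTraces A, ∀ a ∈ F, ‖ψ a - ((n * ∑ k, l k : ℝ) : ℂ)⁻¹ *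
      (ampl n (diagonal fun k => (l k : ℂ)) * 𝓜.rep κ v a).trace‖ < ε := by
  choose C hC0 hC using fun a : {a // a ∈ F} => 𝓜.defect_adjoin (hF a.1 a.2)
  have hlim : ∀ a : {a // a ∈ F}, ∀ᶠ η in nhdsWithin (0 : ℝ) (Set.Ioi 0),
      C a * d * √(8 * η / t) + 4 * ‖a.1‖ * η / t < ε := fun a => by
    have h1 : Continuous fun η : ℝ => C a * d * √(8 * η / t) + 4 * ‖a.1‖ * η / t := by fun_prop
    have h2 := h1.tendsto 0
    simp only [mul_zero, zero_div, Real.sqrt_zero, add_zero] at h2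
    exact (h2.mono_left nhdsWithin_le_nhds).eventually (gt_mem_nhds hε)
  have hlim2 : ∀ᶠ η in nhdsWithin (0 : ℝ) (Set.Ioi 0), η < t / 2 :=
    nhdsWithin_le_nhds (gt_mem_nhds (half_pos ht))
  obtain ⟨η, ⟨hη1, hη2⟩, hη⟩ :=
    (((Filter.eventually_all.2 hlim).and hlim2).and self_mem_nhdsWithin).exists
  have hη : 0 < η := hη
  refine ⟨η, hη, fun κ _ _ _ v l hl hv htl => ?_⟩
  -- The rounding errors are relatively small if `M ≥ 1 / η`.
  obtain ⟨M, hM⟩ : ∃ M : ℕ, η⁻¹ ≤ M := ⟨_, Nat.le_ceil _⟩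
  obtain ⟨V, hV⟩ := 𝓜.exists_trace_below v l hl hv M
  have hn : 0 < n := 𝓜.pos
  have hN : (0 : ℝ) < n * Fintype.card κ := by
    have : 0 < Fintype.card κ := Fintype.card_pos
    positivity
  have hNN : ‖(1 : Matrix (Fin n × κ) (Fin n × κ) ℂ)‖ ^ 2 = n * Fintype.card κ := by
    rw [frobenius_one_sq, Fintype.card_prod, Fintype.card_fin]; push_cast; rfl
  have htrace : (ampl n (diagonal fun k => (l k : ℂ))).trace = ((n * ∑ k, l k : ℝ) : ℂ) := by
    rw [ampl_diagonal, trace_diagonal, Fintype.sum_prod_type]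
    simp
  have hMη : 1 ≤ (M : ℝ) * η := by
    rw [← inv_mul_cancel₀ hη.ne']
    gcongr
  -- The dimension of the compression is estimated by the case `a = 1` of the trace estimate.
  have hN' : |(n * Fintype.card (Below M l) : ℝ) - M * (n * ∑ k, l k)| ≤ n * Fintype.card κ := by
    have h := hV 1 (one_mem _) 0 le_rfl (fun κ κ' _ _ _ _ J u v => by
      rw [map_one, map_one, Matrix.one_mul, Matrix.mul_one, sub_self, norm_zero, zero_mul])
    have hnt : Nontrivial A ∨ Subsingleton A := (subsingleton_or_nontrivial A).symm
    rw [map_one, map_one, Matrix.mul_one, htrace, Matrix.trace_one, zero_mul, mul_zero,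
      zero_add] at h
    have h1 : ‖(1 : A)‖ ≤ 1 := by
      rcases hnt with h | h
      · exact CStarRing.norm_one.le
      · rw [Subsingleton.elim (1 : A) 0, norm_zero]; exact zero_le_one
    rw [← Real.norm_eq_abs, ← Complex.norm_real]
    push_cast
    rw [Fintype.card_prod, Fintype.card_fin] at h
    push_cast at h
    exact h.trans (mul_le_of_le_one_left hN.le h1)
  have hT : ∀ a : A, ‖(ampl n (diagonal fun k => (l k : ℂ)) * 𝓜.rep κ v a).trace‖
      ≤ ‖a‖ * (n * ∑ k, l k) := fun a => by
    have e : ‖a‖ * (n * ∑ k, l k) = ∑ x : Fin n × κ, l x.2 * ‖a‖ := by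
      rw [← Finset.sum_mul, Fintype.sum_prod_type]
      simp [mul_comm]
    rw [e, ampl_diagonal, trace]
    refine norm_sum_le_of_le _ fun x _ => ?_
    rw [diag_apply, diagonal_mul, norm_mul, Complex.norm_real, Real.norm_eq_abs,
      abs_of_nonneg (hl _).1]
    exact mul_le_mul_of_nonneg_left (norm_rep_apply_le _ _ _ _) (hl _).1
  have hbelow : 0 < Fintype.card (Below M l) := by
    by_contra h0
    have h0 : Fintype.card (Below M l) = 0 := by omega
    rw [h0] at hN'
    have h2 := (abs_le.1 hN').1
    simp only [Nat.cast_zero, mul_zero, zero_sub, neg_le_neg_iff] at h2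
    have h3 : (M : ℝ) * (t * (n * Fintype.card κ)) ≤ M * (n * ∑ k, l k) := by gcongr
    have h4 : 2 < (M : ℝ) * t := by nlinarith
    nlinarith
  have : Nonempty (Below M l) := Fintype.card_pos_iff.1 hbelow
  have : Nonempty (Fin n) := ⟨⟨0, hn⟩⟩
  refine ⟨_, ⟨Fin n × Below M l, inferInstance, inferInstance, inferInstance,
    𝓜.rep (Below M l) V, rfl⟩, fun a ha => lt_of_le_of_lt ?_ (hη1 ⟨a, ha⟩)⟩
  have h := norm_quotient_sub_le (T' := (𝓜.rep (Below M l) V a).trace)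
    (T := (ampl n (diagonal fun k => (l k : ℂ)) * 𝓜.rep κ v a).trace)
    (N' := n * Fintype.card (Below M l)) (M := M) ht
    (mul_nonneg (hC0 ⟨a, ha⟩) (Nat.cast_nonneg d)) (norm_nonneg a) hN htl hη hMη (by linarith)
    hN' (hT a) (by
      have h := hV a (hF a ha) (C ⟨a, ha⟩) (hC0 _) (hC ⟨a, ha⟩)
      rw [hNN] at h
      refine h.trans (le_of_eq ?_)
      ring)
  rw [matrixTrace_apply, Fintype.card_prod, Fintype.card_fin]
  refine le_trans (le_of_eq ?_) h
  push_cast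
  rfl

/-- The closure of the set of matrix traces contains every trace dominated by a multiple of one of
its elements. If `t φ₁ ≤ φ` and `b` is an almost central density, `φ(b ·) ≈ t φ₁`, then `φ` is
replaced by the trace of a representation `R_u` which is close to `φ` on the relevant elements, and
`R_u(b)` by `1 ⊗ Λ`, so that `φ₁` is close to `Tr(Λ R_v ·) / Tr(Λ)`. -/
theorem mem_closure_matrixTraces_of_dominated (𝓜 : MatrixModel A d n) {φ φ₁ : WeakDual ℂ A}
    (hφ : φ ∈ closure (matrixTraces A)) (hφ₁ : φ₁ ∈ traceSpace A) {t : ℝ} (ht : 0 < t)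
    (hdom : ∀ x, t * (φ₁ (star x * x)).re ≤ (φ (star x * x)).re) :
    φ₁ ∈ closure (matrixTraces A) := by
  classical
  let := CStarAlgebra.spectralOrder A
  have := CStarAlgebra.spectralOrderedRing A
  have hφT : φ ∈ traceSpace A := closure_minimal matrixTraces_subset isClosed_traceSpace hφ
  refine mem_closure_of_approx matrixTraces_subset hφ₁ 𝓜.dense fun F hF ε hε => ?_
  obtain ⟨η, hη, hnear⟩ := 𝓜.exists_matrixTrace_near F hF (half_pos ht) (half_pos hε)
  obtain ⟨K, hK1, hK⟩ : ∃ K : ℝ, 1 ≤ K ∧ ∀ a ∈ insert 1 F, ‖a‖ ≤ K := by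
    refine ⟨1 + ∑ a ∈ insert 1 F, ‖a‖,
      le_add_of_nonneg_right (Finset.sum_nonneg fun _ _ => norm_nonneg _), fun a ha => ?_⟩
    have := Finset.single_le_sum (f := fun a : A => ‖a‖) (fun _ _ => norm_nonneg _) ha
    linarith
  -- `ζ` bounds the error of the non-normalised traces relative to the dimension.
  set ζ : ℝ := min (t / 2) (t * ε / (8 * (1 + K))) with hζ
  have hζ0 : 0 < ζ := lt_min (half_pos ht) (by positivity)
  obtain ⟨δ, hδ, hstr⟩ := 𝓜.straighten (min η (ζ / (4 * K))) (lt_min hη (by positivity))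
  have := 𝓜.finite
  have : Fintype 𝓜.σ := Fintype.ofFinite _
  set G : Finset A := insert 1 F ∪ Finset.univ.image 𝓜.gen with hG
  obtain ⟨b, hb0, hb1, hba, hbg⟩ := exists_almost_central_density hφT hφ₁ ht.le hdom G
    (η := min (ζ / 4) (δ / 2)) (lt_min (by positivity) (by positivity))
  -- The matrix trace has to be close to `φ` also at `|c s|²`, so that `R_u(b)` almost commutes with
  -- the generators in the Frobenius norm.
  let c : 𝓜.σ → A := fun s => b * 𝓜.gen s - 𝓜.gen s * b
  obtain ⟨ψ, ⟨ι, _, _, _, π, rfl⟩, hψ⟩ := exists_near_of_mem_closure hφ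
    ((insert 1 F).image (fun a => b * a) ∪ Finset.univ.image fun s => star (c s) * c s)
    (ε := min (ζ / 4) (δ ^ 2 / 4)) (lt_min (by positivity) (by positivity))
  obtain ⟨κ, _, _, _, u, hu⟩ := 𝓜.complete ι π
  rw [hu] at hψ
  have : Nonempty (Fin n) := ⟨⟨0, 𝓜.pos⟩⟩
  set N : ℝ := n * Fintype.card κ with hN
  have hN0 : 0 < N := by
    have h1 : 0 < Fintype.card κ := Fintype.card_pos
    have h2 := 𝓜.pos
    positivity
  have hone : ‖(1 : Matrix (Fin n × κ) (Fin n × κ) ℂ)‖ ^ 2 = N := by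
    rw [frobenius_one_sq, Fintype.card_prod, Fintype.card_fin]; push_cast; rfl
  have hpos : ∀ a : A, 0 ≤ a → (𝓜.rep κ u a).PosSemidef := fun a ha => by
    obtain ⟨x, rfl⟩ := CStarAlgebra.nonneg_iff_eq_star_mul_self.1 ha
    rw [map_mul, map_star]
    exact posSemidef_conjTranspose_mul_self _
  obtain ⟨v, w, l, hl, hvw, hw, hvl⟩ := hstr κ u (𝓜.rep κ u b) (hpos b hb0) (by
      have := hpos (1 - b) (sub_nonneg.2 hb1)
      rwa [map_sub, map_one] at this) (fun s => by
      rw [← map_mul, ← map_mul, ← map_sub, traceNorm_matrixTrace]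
      refine mul_le_mul_of_nonneg_right ?_ (norm_nonneg _)
      have h1 := hbg (𝓜.gen s) (by rw [hG]; simp)
      have h2 := hψ (star (c s) * c s) (by simp)
      have h3 := traceNorm_sq hφT (c s)
      have h4 := traceNorm_sq (matrixTrace_mem (𝓜.rep κ u)) (c s)
      have h5 := (Complex.abs_re_le_norm _).trans_lt h2
      rw [Complex.sub_re, ← h3, ← h4] at h5
      have h6 : traceNorm φ (c s) < δ / 2 := h1.trans_le (min_le_right _ _)
      have h7 := (abs_lt.1 h5).2.trans_le (min_le_right _ _)
      refine abs_le_of_sq_le_sq' ?_ hδ.le |>.2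
      nlinarith [traceNorm_nonneg φ (c s)])
  set Λ := ampl n (diagonal fun k => (l k : ℂ)) with hΛ
  set L : ℝ := n * ∑ k, l k with hL
  have hΛL : Λ.trace = (L : ℂ) := by
    rw [hΛ, ampl_diagonal, trace_diagonal, Fintype.sum_prod_type, hL]
    simp
  -- `Tr(Λ R_v(a))` is close to `Tr(R_u(b a))`, hence to `N φ(b a)` and to `N t φ₁(a)`.
  have hX : ∀ a ∈ insert 1 F, ‖(Λ * 𝓜.rep κ v a).trace - N * (t * φ₁ a)‖ ≤ ζ * N := by
    intro a ha
    have h1 : ((w.1 * 𝓜.rep κ u b * w.1ᴴ) * 𝓜.rep κ v a).trace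
        = N * matrixTrace (𝓜.rep κ u) (b * a) := by
      rw [hvw, matrixTrace_apply, map_mul, Fintype.card_prod, Fintype.card_fin]
      have e : w.1 * 𝓜.rep κ u b * w.1ᴴ * (w.1 * 𝓜.rep κ u a * w.1ᴴ)
          = w.1 * (𝓜.rep κ u b * 𝓜.rep κ u a) * w.1ᴴ := by
        simp only [Matrix.mul_assoc]
        rw [← Matrix.mul_assoc w.1ᴴ w.1, unitary_conjTranspose_mul, Matrix.one_mul]
      rw [e, trace_mul_comm, ← Matrix.mul_assoc, unitary_conjTranspose_mul, Matrix.one_mul]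
      have hNC : (N : ℂ) = (n * Fintype.card κ : ℕ) := by rw [hN]; push_cast; rfl
      rw [← hNC, mul_inv_cancel_left₀ (by exact_mod_cast hN0.ne')]
    have h2 : ‖((Λ - w.1 * 𝓜.rep κ u b * w.1ᴴ) * 𝓜.rep κ v a).trace‖ ≤ ζ / 4 * N := by
      refine (norm_trace_mul_le_frobenius _ _).trans ?_
      have h3 := frobenius_rep_mul_le (𝓜.rep κ v) a (1 : Matrix (Fin n × κ) (Fin n × κ) ℂ)
      rw [Matrix.mul_one] at h3
      rw [norm_sub_rev]
      have h4 : min η (ζ / (4 * K)) ≤ ζ / (4 * K) := min_le_right _ _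
      calc _ ≤ (ζ / (4 * K) * ‖(1 : Matrix (Fin n × κ) (Fin n × κ) ℂ)‖) *
            (K * ‖(1 : Matrix (Fin n × κ) (Fin n × κ) ℂ)‖) := by
            refine mul_le_mul (hw.trans ?_) (h3.trans ?_) (norm_nonneg _) (by positivity)
            · exact mul_le_mul_of_nonneg_right h4 (norm_nonneg _)
            · exact mul_le_mul_of_nonneg_right (hK a ha) (norm_nonneg _)
        _ = ζ / 4 * ‖(1 : Matrix (Fin n × κ) (Fin n × κ) ℂ)‖ ^ 2 := by field_simp
        _ = _ := by rw [hone]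
    have h5 := hψ (b * a) (Finset.mem_union_left _ (Finset.mem_image_of_mem _ ha))
    have h6 := hba a (Finset.mem_union_left _ ha)
    have h7 : ‖matrixTrace (𝓜.rep κ u) (b * a) - t * φ₁ a‖ ≤ ζ / 2 := by
      calc _ = ‖(matrixTrace (𝓜.rep κ u) (b * a) - φ (b * a)) + (φ (b * a) - t * φ₁ a)‖ := by
            congr 1; ring
        _ ≤ ζ / 4 + ζ / 4 := (norm_add_le _ _).trans
            (add_le_add (h5.le.trans (min_le_left _ _)) (h6.le.trans (min_le_left _ _)))
        _ = _ := by ring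
    have e : (Λ * 𝓜.rep κ v a).trace - N * (t * φ₁ a)
        = ((Λ - w.1 * 𝓜.rep κ u b * w.1ᴴ) * 𝓜.rep κ v a).trace
          + N * (matrixTrace (𝓜.rep κ u) (b * a) - t * φ₁ a) := by
      rw [Matrix.sub_mul, trace_sub, h1]; ring
    rw [e]
    refine (norm_add_le _ _).trans ?_
    rw [norm_mul, Complex.norm_real, Real.norm_eq_abs, abs_of_pos hN0]
    nlinarith
  have hX1 : |L - t * N| ≤ ζ * N := by
    have h := hX 1 (Finset.mem_insert_self _ _)
    rw [map_one, Matrix.mul_one, hΛL, hφ₁.1, mul_one] at h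
    rw [← Real.norm_eq_abs, ← Complex.norm_real]
    push_cast
    rwa [mul_comm (t : ℂ)]
  have hL2 : t / 2 * N ≤ L := by
    have h1 : ζ ≤ t / 2 := min_le_left _ _
    nlinarith [(abs_le.1 hX1).1]
  have hL0 : 0 < L := lt_of_lt_of_le (by positivity) hL2
  obtain ⟨ψ', hψ', hψ'F⟩ := hnear κ v l hl (fun i => (hvl i).trans
    (mul_le_mul_of_nonneg_right (min_le_left _ _) (norm_nonneg _))) hL2
  refine ⟨ψ', hψ', fun a ha => ?_⟩
  have h1 := hψ'F a ha
  have h2 : ‖((L : ℝ) : ℂ)⁻¹ * (Λ * 𝓜.rep κ v a).trace - φ₁ a‖ ≤ ε / 4 := by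
    have e : ((L : ℝ) : ℂ)⁻¹ * (Λ * 𝓜.rep κ v a).trace - φ₁ a
        = (L : ℂ)⁻¹ * (((Λ * 𝓜.rep κ v a).trace - N * (t * φ₁ a))
          - ((L - t * N : ℝ) : ℂ) * φ₁ a) := by
      have : (L : ℂ) ≠ 0 := by exact_mod_cast hL0.ne'
      push_cast
      field_simp
      ring
    have ha' := Finset.mem_insert_of_mem (b := 1) ha
    have h3 : ‖φ₁ a‖ ≤ K := (norm_trace_le hφ₁ a).trans (hK a ha')
    have h4 : ‖((Λ * 𝓜.rep κ v a).trace - N * (t * φ₁ a)) - ((L - t * N : ℝ) : ℂ) * φ₁ a‖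
        ≤ ζ * N * (1 + K) := by
      refine (norm_sub_le _ _).trans ?_
      rw [norm_mul, Complex.norm_real, Real.norm_eq_abs, mul_add, mul_one]
      exact add_le_add (hX a ha') (mul_le_mul hX1 h3 (norm_nonneg _) (by positivity))
    have h5 : ζ * (1 + K) ≤ t * ε / 8 := by
      have : ζ ≤ t * ε / (8 * (1 + K)) := min_le_right _ _
      calc _ ≤ t * ε / (8 * (1 + K)) * (1 + K) := by gcongr
        _ = _ := by field_simp
    rw [e, norm_mul, norm_inv, Complex.norm_real, Real.norm_eq_abs, abs_of_pos hL0,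
      inv_mul_le_iff₀ hL0]
    refine h4.trans ?_
    nlinarith
  calc _ = ‖(ψ' a - ((L : ℝ) : ℂ)⁻¹ * (Λ * 𝓜.rep κ v a).trace)
        + (((L : ℝ) : ℂ)⁻¹ * (Λ * 𝓜.rep κ v a).trace - φ₁ a)‖ := by congr 1; ring
    _ < ε := (norm_add_le _ _).trans_lt (by linarith)

end MatrixModel

end Domination

/-! ### The closure of the set of matrix traces -/

section DirectSum

open Matrix
open scoped Matrix.Norms.Frobenius

variable {A : Type*} [CStarAlgebra A] {d n : ℕ}

/-- The direct sum of two matrix representations. -/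
def sumRep {ι κ : Type*} [Fintype ι] [DecidableEq ι] [Fintype κ] [DecidableEq κ]
    (π : A →⋆ₐ[ℂ] Matrix ι ι ℂ) (ρ : A →⋆ₐ[ℂ] Matrix κ κ ℂ) : A →⋆ₐ[ℂ] Matrix (ι ⊕ κ) (ι ⊕ κ) ℂ where
  toFun a := fromBlocks (π a) 0 0 (ρ a)
  map_one' := by rw [map_one, map_one, fromBlocks_one]
  map_mul' a b := by
    rw [fromBlocks_multiply, map_mul, map_mul]
    simp
  map_zero' := by rw [map_zero, map_zero, fromBlocks_zero]
  map_add' a b := by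
    rw [fromBlocks_add, map_add, map_add]
    simp
  commutes' c := by
    rw [Algebra.algebraMap_eq_smul_one, map_smul, map_smul, map_one, map_one,
      Algebra.algebraMap_eq_smul_one, ← fromBlocks_one, fromBlocks_smul]
    simp
  map_star' a := by
    rw [map_star, map_star, star_eq_conjTranspose, star_eq_conjTranspose, star_eq_conjTranspose,
      fromBlocks_conjTranspose]
    simp

theorem matrixTrace_sumRep {ι κ : Type*} [Fintype ι] [DecidableEq ι] [Fintype κ] [DecidableEq κ]
    [Nonempty ι] [Nonempty κ] (π : A →⋆ₐ[ℂ] Matrix ι ι ℂ) (ρ : A →⋆ₐ[ℂ] Matrix κ κ ℂ) (a : A) :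
    matrixTrace (sumRep π ρ) a = ((Fintype.card ι : ℂ) + Fintype.card κ)⁻¹ *
      (Fintype.card ι * matrixTrace π a + Fintype.card κ * matrixTrace ρ a) := by
  have h1 : (Fintype.card ι : ℂ) ≠ 0 := by exact_mod_cast Fintype.card_ne_zero
  have h2 : (Fintype.card κ : ℂ) ≠ 0 := by exact_mod_cast Fintype.card_ne_zero
  rw [matrixTrace_apply, matrixTrace_apply, matrixTrace_apply, mul_inv_cancel_left₀ h1,
    mul_inv_cancel_left₀ h2, Fintype.card_sum]
  have h3 : (sumRep π ρ a).trace = (π a).trace + (ρ a).trace := by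
    simp [trace, sumRep]
  rw [h3]
  push_cast
  rfl

/-- A convex combination of the traces of two representations need not be a matrix trace, but it is
dominated by a multiple of the trace of the direct sum. -/
theorem convex_closure_matrixTraces (𝓜 : MatrixModel A d n) :
    Convex ℝ (closure (matrixTraces A)) := by
  intro φ hφ ψ hψ s r hs hr hsr
  rw [← closure_closure]
  refine map_mem_closure₂ (f := fun φ ψ : WeakDual ℂ A => s • φ + r • ψ) ?_ hφ hψ ?_
  · refine WeakDual.continuous_of_continuous_eval fun a => ?_
    change Continuous fun p : WeakDual ℂ A × WeakDual ℂ A => (s • p.1 + r • p.2) a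
    simp only [weakDual_add_apply, weakDual_real_smul_apply]
    exact (((WeakDual.eval_continuous a).comp continuous_fst).const_mul _).add
      (((WeakDual.eval_continuous a).comp continuous_snd).const_mul _)
  rintro _ ⟨ι, _, _, _, π, rfl⟩ _ ⟨κ, _, _, _, ρ, rfl⟩
  have h1 : 1 ≤ (Fintype.card ι : ℝ) := by exact_mod_cast Fintype.card_pos
  have h2 : 1 ≤ (Fintype.card κ : ℝ) := by exact_mod_cast Fintype.card_pos
  have hpos : (0 : ℝ) < ((Fintype.card ι : ℝ) + Fintype.card κ)⁻¹ := by positivity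
  refine 𝓜.mem_closure_matrixTraces_of_dominated
    (subset_closure ⟨ι ⊕ κ, inferInstance, inferInstance, inferInstance, sumRep π ρ, rfl⟩)
    (convex_traceSpace (matrixTrace_mem π) (matrixTrace_mem ρ) hs hr hsr) hpos fun x => ?_
  rw [matrixTrace_sumRep, weakDual_add_apply, weakDual_real_smul_apply, weakDual_real_smul_apply,
    matrixTrace_star_mul_self, matrixTrace_star_mul_self]
  set p := (Fintype.card ι : ℝ)⁻¹ * ‖π x‖ ^ 2 with hp
  set q := (Fintype.card κ : ℝ)⁻¹ * ‖ρ x‖ ^ 2 with hq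
  have hp0 : 0 ≤ p := by positivity
  have hq0 : 0 ≤ q := by positivity
  have e : (((Fintype.card ι : ℂ) + Fintype.card κ)⁻¹ *
      (Fintype.card ι * (p : ℂ) + Fintype.card κ * (q : ℂ))).re
      = ((Fintype.card ι : ℝ) + Fintype.card κ)⁻¹ * (Fintype.card ι * p + Fintype.card κ * q) := by
    rw [← Complex.ofReal_re (((Fintype.card ι : ℝ) + Fintype.card κ)⁻¹ *
      (Fintype.card ι * p + Fintype.card κ * q))]
    push_cast
    rfl
  have e2 : ((s : ℂ) * (p : ℂ) + (r : ℂ) * (q : ℂ)).re = s * p + r * q := by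
    rw [← Complex.ofReal_re (s * p + r * q)]
    push_cast
    rfl
  rw [e, e2]
  refine mul_le_mul_of_nonneg_left ?_ hpos.le
  exact add_le_add (mul_le_mul_of_nonneg_right (by linarith) hp0)
    (mul_le_mul_of_nonneg_right (by linarith) hq0)

/-- The closure of the matrix traces has the face property, as the components of a convex
combination are dominated by multiples of it. -/
theorem isExtreme_closure_matrixTraces (𝓜 : MatrixModel A d n) :
    IsExtreme ℝ (traceSpace A) (closure (matrixTraces A)) := by
  refine ⟨closure_minimal matrixTraces_subset isClosed_traceSpace, ?_⟩
  rintro φ hφ ψ hψ _ hχ ⟨s, r, hs, hr, -, rfl⟩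
  refine 𝓜.mem_closure_matrixTraces_of_dominated hχ hφ hs fun x => ?_
  rw [weakDual_add_apply, weakDual_real_smul_apply, weakDual_real_smul_apply, Complex.add_re,
    Complex.re_ofReal_mul, Complex.re_ofReal_mul]
  have h := mul_nonneg hr.le (Complex.le_def.1 (hψ.2.1 x)).1
  linarith

end DirectSum

/-! ### Finite-dimensional traces -/

section GNS

open Matrix
open scoped Matrix.Norms.Frobenius InnerProductSpace

variable {A : Type*} [CStarAlgebra A] [PartialOrder A] [StarOrderedRing A] (φ : traceSpace A)

/-- The vector of the GNS space given by an element of the algebra. -/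
noncomputable def gnsVec : A →ₗ[ℂ] (tracePositive φ).GNS where
  toFun a := (((tracePositive φ).toPreGNS a : (tracePositive φ).PreGNS) : (tracePositive φ).GNS)
  map_add' a b := by rw [map_add, UniformSpace.Completion.coe_add]
  map_smul' c a := by rw [map_smul, UniformSpace.Completion.coe_smul, RingHom.id_apply]

theorem gnsStarAlgHom_gnsVec (a b : A) :
    (tracePositive φ).gnsStarAlgHom a (gnsVec φ b) = gnsVec φ (a * b) :=
  (tracePositive φ).gnsNonUnitalStarAlgHom_apply_coe

theorem inner_gnsVec (a b : A) : ⟪gnsVec φ a, gnsVec φ b⟫_ℂ = φ.1 (star a * b) :=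
  UniformSpace.Completion.inner_coe _ _

theorem norm_gnsVec_sq (a : A) : ‖gnsVec φ a‖ ^ 2 = (φ.1 (star a * a)).re := by
  rw [← inner_gnsVec, ← inner_self_eq_norm_sq (𝕜 := ℂ)]
  rfl

theorem denseRange_gnsVec : DenseRange (gnsVec φ) :=
  UniformSpace.Completion.denseRange_coe (α := (tracePositive φ).PreGNS)

/-- If the image of the GNS representation is finite-dimensional, then every vector of the GNS
space comes from the algebra. -/
theorem gnsVec_surjective {V : Type*} [AddCommGroup V] [Module ℂ V] [FiniteDimensional ℂ V]
    (f : A →ₗ[ℂ] V) (hf : LinearMap.ker f ≤ LinearMap.ker (gnsVec φ)) :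
    Function.Surjective (gnsVec φ) := by
  have h1 : FiniteDimensional ℂ (A ⧸ LinearMap.ker f) :=
    Module.Finite.of_injective f.quotKerEquivRange.toLinearMap f.quotKerEquivRange.injective
  let g : (A ⧸ LinearMap.ker f) →ₗ[ℂ] (tracePositive φ).GNS := (LinearMap.ker f).liftQ (gnsVec φ) hf
  have h2 : LinearMap.range g = LinearMap.range (gnsVec φ) := Submodule.range_liftQ _ _ _
  have h3 : FiniteDimensional ℂ (LinearMap.range (gnsVec φ)) := by
    rw [← h2]; infer_instance
  have h4 := (LinearMap.range (gnsVec φ)).closed_of_finiteDimensional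
  have h5 : Dense ((LinearMap.range (gnsVec φ) : Submodule ℂ _) : Set (tracePositive φ).GNS) :=
    denseRange_gnsVec φ
  intro x
  have : x ∈ ((LinearMap.range (gnsVec φ) : Submodule ℂ _) : Set (tracePositive φ).GNS) := by
    rw [← h4.closure_eq]; exact h5 x
  exact this

/-- A finite-dimensional trace is dominated by a multiple of the trace of a matrix
representation, since its GNS space is finite-dimensional. -/
theorem exists_dominating_matrixTrace [FiniteDimensional ℂ (traceVonNeumannAlgebra φ)] :
    ∃ ψ ∈ matrixTraces A, ∃ t > 0, ∀ x, t * (φ.1 (star x * x)).re ≤ (ψ (star x * x)).re := by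
  set π := (tracePositive φ).gnsStarAlgHom with hπ
  -- The image of the algebra lies in its bicommutant.
  let f : A →ₗ[ℂ] traceVonNeumannAlgebra φ :=
    { toFun := fun a => ⟨π a, by
        rw [traceVonNeumannAlgebra, StarSubalgebra.mem_centralizer_iff]
        intro g hg
        have hg := (StarSubalgebra.mem_centralizer_iff ℂ).1 hg
        refine ⟨((hg _ ⟨a, rfl⟩).1).symm, ?_⟩
        have h := (hg _ ⟨star a, rfl⟩).1
        have h2 := congrArg star h
        rw [star_mul, star_mul, ← map_star, star_star] at h2
        exact h2⟩
      map_add' := fun a b => Subtype.ext (map_add π a b)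
      map_smul' := fun c a => Subtype.ext (map_smul π c a) }
  have hsurj := gnsVec_surjective φ f (fun a ha => by
    have h1 : π a = 0 := congrArg Subtype.val ha
    have h2 := gnsStarAlgHom_gnsVec φ a 1
    rw [mul_one, ← hπ, h1, _root_.zero_apply] at h2
    exact h2.symm)
  have hfd : FiniteDimensional ℂ (tracePositive φ).GNS := by
    have h1 : FiniteDimensional ℂ (A ⧸ LinearMap.ker f) :=
      Module.Finite.of_injective f.quotKerEquivRange.toLinearMap f.quotKerEquivRange.injective
    refine Module.Finite.of_surjective ((LinearMap.ker f).liftQ (gnsVec φ) fun a ha => ?_) ?_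
    · have h1 : π a = 0 := congrArg Subtype.val ha
      have h2 := gnsStarAlgHom_gnsVec φ a 1
      rw [mul_one, ← hπ, h1, _root_.zero_apply] at h2
      exact h2.symm
    · intro x
      obtain ⟨a, rfl⟩ := hsurj x
      exact ⟨Submodule.Quotient.mk a, Submodule.liftQ_apply _ _ _⟩
  have hξ : ‖gnsVec φ 1‖ = 1 := by
    rw [← sq_eq_sq₀ (norm_nonneg _) zero_le_one, norm_gnsVec_sq, star_one, mul_one, φ.2.1]
    simp
  have hnt : Nontrivial (tracePositive φ).GNS := ⟨gnsVec φ 1, 0, fun h => by simp [h] at hξ⟩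
  let b := stdOrthonormalBasis ℂ (tracePositive φ).GNS
  have hne : Nonempty (Fin (Module.finrank ℂ (tracePositive φ).GNS)) :=
    ⟨⟨0, Module.finrank_pos⟩⟩
  let ρ : A →⋆ₐ[ℂ] Matrix (Fin (Module.finrank ℂ (tracePositive φ).GNS))
      (Fin (Module.finrank ℂ (tracePositive φ).GNS)) ℂ :=
    { toFun := fun a => LinearMap.toMatrixOrthonormal b (π a).toLinearMap
      map_one' := by rw [map_one]; exact map_one _
      map_mul' := fun x y => by rw [map_mul]; exact map_mul (LinearMap.toMatrixOrthonormal b) _ _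
      map_zero' := by rw [map_zero]; exact map_zero _
      map_add' := fun x y => by rw [map_add]; exact map_add (LinearMap.toMatrixOrthonormal b) _ _
      commutes' := fun c => by
        rw [Algebra.algebraMap_eq_smul_one, map_smul, map_one, Algebra.algebraMap_eq_smul_one]
        refine (map_smul (LinearMap.toMatrixOrthonormal b) c _).trans ?_
        congr 1
        exact map_one (LinearMap.toMatrixOrthonormal b)
      map_star' := fun x => by
        rw [map_star, ← map_star (LinearMap.toMatrixOrthonormal b)]
        refine congrArg _ ((LinearMap.eq_adjoint_iff _ _).2 fun v w => ?_)
        exact ContinuousLinearMap.adjoint_inner_left (π x) w v }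
  refine ⟨_, ⟨_, inferInstance, inferInstance, hne, ρ, rfl⟩,
    (Module.finrank ℂ (tracePositive φ).GNS : ℝ)⁻¹, ?_, fun x => ?_⟩
  · have : 0 < Module.finrank ℂ (tracePositive φ).GNS := Module.finrank_pos
    positivity
  rw [matrixTrace_star_mul_self, Complex.ofReal_re, Fintype.card_fin]
  refine mul_le_mul_of_nonneg_left ?_ (by positivity)
  rw [← norm_gnsVec_sq, ← mul_one x, ← gnsStarAlgHom_gnsVec, ← hπ, mul_one]
  have h1 : ‖ρ x‖ ^ 2 = ∑ j, ‖π x (b j)‖ ^ 2 := by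
    rw [frobenius_sq']
    refine Finset.sum_congr rfl fun j _ => ?_
    rw [← b.sum_sq_norm_inner_right (π x (b j))]
    refine Finset.sum_congr rfl fun i _ => ?_
    exact congrArg (‖·‖ ^ 2) (LinearMap.toMatrixOrthonormal_apply_apply b _ i j)
  have h2 : π x (gnsVec φ 1) = ∑ j, ⟪b j, gnsVec φ 1⟫_ℂ • π x (b j) := by
    conv_lhs => rw [← b.sum_repr' (gnsVec φ 1)]
    rw [map_sum]
    simp only [map_smul]
  have h3 : ‖π x (gnsVec φ 1)‖ ≤ ∑ j, ‖⟪b j, gnsVec φ 1⟫_ℂ‖ * ‖π x (b j)‖ := by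
    rw [h2]
    exact norm_sum_le_of_le _ fun j _ => (norm_smul _ _).le
  -- The norm of `π x ξ` for the unit vector `ξ = gnsVec φ 1` is at most the Hilbert–Schmidt norm.
  have h4 := Finset.sum_mul_sq_le_sq_mul_sq Finset.univ
    (fun j => ‖⟪b j, gnsVec φ 1⟫_ℂ‖) (fun j => ‖π x (b j)‖)
  rw [b.sum_sq_norm_inner_right, hξ, one_pow, one_mul, ← h1] at h4
  exact (pow_le_pow_left₀ (norm_nonneg _) h3 2).trans h4

end GNS

/-- A finite-dimensional trace need not be a matrix trace, as its weights on the matrix summands may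
be irrational, but it is a limit of matrix traces. -/
theorem finiteDimensionalTraces_subset_closure {A : Type*} [CStarAlgebra A] {d n : ℕ}
    (𝓜 : MatrixModel A d n) : finiteDimensionalTraces A ⊆ closure (matrixTraces A) := by
  rintro φ ⟨hφ, hfd⟩
  let := CStarAlgebra.spectralOrder A
  have := CStarAlgebra.spectralOrderedRing A
  have : FiniteDimensional ℂ (traceVonNeumannAlgebra ⟨φ, hφ⟩) := hfd
  obtain ⟨ψ, hψ, t, ht, h⟩ := exists_dominating_matrixTrace ⟨φ, hφ⟩
  exact 𝓜.mem_closure_matrixTraces_of_dominated (subset_closure hψ) hφ ht h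

/-! ### Irreducible matrix representations -/

section Irreducible

open Matrix
open scoped InnerProductSpace

variable {A : Type*} [CStarAlgebra A] {ι : Type*} [Fintype ι] [DecidableEq ι]

/-- The orthogonal projection, for the Hilbert–Schmidt inner product, onto the image of a
representation is a left module map. -/
theorem exists_projection_range (π : A →⋆ₐ[ℂ] Matrix ι ι ℂ) :
    ∃ E : Matrix ι ι ℂ →ₗ[ℂ] Matrix ι ι ℂ, (∀ X, ∃ a, E X = π a) ∧ E 1 = 1 ∧
      ∀ a X, E (π a * X) = π a * E X := by
  let e : Matrix ι ι ℂ ≃ₗ[ℂ] EuclideanSpace ℂ (ι × ι) :=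
    (LinearEquiv.curry ℂ ℂ ι ι).symm.trans (WithLp.linearEquiv 2 ℂ (ι × ι → ℂ)).symm
  have he : ∀ X Y : Matrix ι ι ℂ, ⟪e X, e Y⟫_ℂ = (Xᴴ * Y).trace := fun X Y => by
    rw [trace, PiLp.inner_apply, Fintype.sum_prod_type, Finset.sum_comm]
    refine Finset.sum_congr rfl fun j _ => ?_
    rw [diag_apply, mul_apply]
    refine Finset.sum_congr rfl fun i _ => ?_
    exact mul_comm _ _
  let V : Submodule ℂ (EuclideanSpace ℂ (ι × ι)) :=
    LinearMap.range (e.toLinearMap.comp (π : A →ₐ[ℂ] Matrix ι ι ℂ).toLinearMap)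
  have hV : ∀ a, e (π a) ∈ V := fun a => ⟨a, rfl⟩
  have hV' : ∀ X, ∃ a, e.symm (V.starProjection (e X)) = π a := fun X => by
    obtain ⟨a, ha⟩ := V.starProjection_apply_mem (e X)
    exact ⟨a, e.symm_apply_eq.2 ha.symm⟩
  refine ⟨e.symm.toLinearMap.comp (V.starProjection.toLinearMap.comp e.toLinearMap), hV', ?_,
    fun a X => ?_⟩
  · refine e.symm_apply_eq.2 (Submodule.starProjection_eq_self_iff.2 ?_)
    exact ⟨1, congrArg e (map_one π)⟩
  · refine e.symm_apply_eq.2 (Submodule.eq_starProjection_of_mem_of_inner_eq_zero ?_ ?_)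
    · obtain ⟨c, hc⟩ := hV' X
      have h : e.symm.toLinearMap.comp (V.starProjection.toLinearMap.comp e.toLinearMap) X = π c :=
        hc
      rw [h, ← map_mul]
      exact hV _
    · rintro _ ⟨c, rfl⟩
      have h := V.starProjection_inner_eq_zero (e X) (e (π (star a * c))) (hV _)
      change ⟪e (π a * X) - e (π a * e.symm (V.starProjection (e X))), e (π c)⟫_ℂ = 0
      rw [← map_sub, ← Matrix.mul_sub, he, conjTranspose_mul, Matrix.mul_assoc,
        ← star_eq_conjTranspose (π a), ← map_star, ← map_mul, ← he, map_sub,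
        LinearEquiv.apply_symm_apply]
      exact h

/-- Burnside's theorem: a matrix representation with trivial commutant is surjective. The left
module projection `E` onto the image consists of intertwiners, which are scalars, so that `E` is a
right multiplication; as `E 1 = 1`, it is the identity. -/
theorem surjective_of_irreducible (π : A →⋆ₐ[ℂ] Matrix ι ι ℂ)
    (h : ∀ X, (∀ a, X * π a = π a * X) → ∃ c : ℂ, X = c • 1) : Function.Surjective π := by
  obtain ⟨E, hE, hE1, hEm⟩ := exists_projection_range π
  -- For fixed `j`, `k` the matrix of the map `x ↦ E(x ⊗ e_j) e_k` commutes with the representation.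
  let Y : ι → ι → Matrix ι ι ℂ := fun j k => of fun p q => E (single q j 1) p k
  have hY : ∀ j k, ∃ c : ℂ, Y j k = c • 1 := fun j k => h _ fun a => by
    ext p q
    have h1 : π a * single q j 1 = ∑ r, π a r q • single r j (1 : ℂ) := by
      ext r s
      rw [Matrix.sum_apply, mul_apply]
      by_cases hs : j = s <;> simp [single_apply, hs]
    have h2 := congrFun (congrFun (hEm a (single q j 1)) p) k
    rw [h1, map_sum, Matrix.sum_apply, mul_apply] at h2
    rw [mul_apply, mul_apply]
    refine Eq.trans (Finset.sum_congr rfl fun r _ => ?_) h2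
    rw [map_smul, Matrix.smul_apply, smul_eq_mul, mul_comm]
    rfl
  choose c hc using hY
  have h1 : ∀ q j p k, E (single q j 1) p k = if p = q then c j k else 0 := fun q j p k => by
    have := congrFun (congrFun (hc j k) p) q
    rw [Matrix.smul_apply, one_apply, smul_eq_mul, mul_ite, mul_one, mul_zero] at this
    exact this
  have h2 : ∀ j k, c j k = if j = k then 1 else 0 := fun j k => by
    have h3 := congrFun (congrFun hE1 j) k
    rw [← sum_single_one, map_sum, Matrix.sum_apply] at h3
    simp only [h1] at h3
    rw [Finset.sum_ite_eq, if_pos (Finset.mem_univ _), sum_single_one, one_apply] at h3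
    exact h3
  have h3 : ∀ q j, E (single q j 1) = single q j 1 := fun q j => by
    ext p k
    rw [h1, h2, single_apply]
    rcases eq_or_ne p q with rfl | hp
    · by_cases hk : j = k <;> simp [hk]
    · simp [hp, hp.symm]
  intro X
  obtain ⟨a, ha⟩ := hE X
  refine ⟨a, ?_⟩
  rw [← ha, matrix_eq_sum_single X]
  simp only [map_sum]
  refine Finset.sum_congr rfl fun i _ => Finset.sum_congr rfl fun j _ => ?_
  rw [← mul_one (X i j), ← smul_eq_mul, ← smul_single, map_smul, h3]

/-- The normalised trace is the only normalised tracial functional on a matrix algebra. -/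
theorem eq_trace_of_tracial [Nonempty ι] (f : Matrix ι ι ℂ →ₗ[ℂ] ℂ) (h1 : f 1 = 1)
    (hf : ∀ X Y, f (X * Y) = f (Y * X)) (X : Matrix ι ι ℂ) :
    f X = (Fintype.card ι : ℂ)⁻¹ * X.trace := by
  have h0 : ∀ i j, i ≠ j → f (single i j 1) = 0 := fun i j hij => by
    have h2 := hf (single i j 1) (single j j 1)
    rwa [single_mul_single_same, single_mul_single_of_ne _ _ _ _ hij.symm, map_zero,
      mul_one] at h2
  have hd : ∀ i j, f (single i i 1) = f (single j j 1) := fun i j => by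
    have h2 := hf (single i j 1) (single j i 1)
    rwa [single_mul_single_same, single_mul_single_same, mul_one] at h2
  have hc : ∀ i, f (single i i 1) = (Fintype.card ι : ℂ)⁻¹ := fun i => by
    rw [← sum_single_one, map_sum, Finset.sum_congr rfl fun j _ => hd j i, Finset.sum_const,
      nsmul_eq_mul, Finset.card_univ] at h1
    exact eq_inv_of_mul_eq_one_right h1
  conv_lhs => rw [matrix_eq_sum_single X]
  rw [map_sum, trace, Finset.mul_sum]
  refine Finset.sum_congr rfl fun i _ => ?_
  rw [map_sum, Finset.sum_eq_single i]
  · rw [← mul_one (X i i), ← smul_eq_mul, ← smul_single, map_smul, hc, smul_eq_mul]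
    exact mul_comm _ _
  · intro j _ hj
    rw [← mul_one (X i j), ← smul_eq_mul, ← smul_single, map_smul, h0 i j hj.symm, smul_zero]
  · simp

/-- The trace of a surjective matrix representation is an extreme trace, as a dominated trace
vanishes on the kernel of the representation. -/
theorem matrixTrace_mem_extremePoints [Nonempty ι] (π : A →⋆ₐ[ℂ] Matrix ι ι ℂ)
    (hπ : Function.Surjective π) : matrixTrace π ∈ (traceSpace A).extremePoints ℝ := by
  refine ⟨matrixTrace_mem π, ?_⟩
  rintro φ hφ ψ hψ ⟨s, r, hs, hr, -, hsr⟩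
  have hker : ∀ x, π x = 0 → φ x = 0 := fun x hx => by
    have h1 : matrixTrace π (star x * x) = 0 := by
      rw [matrixTrace_apply, map_mul, hx, Matrix.mul_zero, trace_zero, mul_zero]
    have h2 : s * (φ (star x * x)).re + r * (ψ (star x * x)).re = 0 := by
      rw [← hsr, weakDual_add_apply, weakDual_real_smul_apply, weakDual_real_smul_apply] at h1
      have := congrArg Complex.re h1
      rwa [Complex.add_re, Complex.re_ofReal_mul, Complex.re_ofReal_mul] at this
    have h3 : 0 ≤ (φ (star x * x)).re := (Complex.le_def.1 (hφ.2.1 x)).1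
    have h4 : 0 ≤ (ψ (star x * x)).re := (Complex.le_def.1 (hψ.2.1 x)).1
    have h5 : (φ (star x * x)).re = 0 := by nlinarith [mul_nonneg hr.le h4, mul_nonneg hs.le h3]
    have h6 := norm_trace_le_traceNorm hφ x
    rw [traceNorm, h5, Real.sqrt_zero] at h6
    exact norm_le_zero_iff.1 h6
  choose σ hσ using hπ
  have hφσ : ∀ X a, π a = X → φ (σ X) = φ a := fun X a h => by
    rw [← sub_eq_zero, ← map_sub]
    exact hker _ (by rw [map_sub, hσ, h, sub_self])
  let f : Matrix ι ι ℂ →ₗ[ℂ] ℂ :=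
    { toFun := fun X => φ (σ X)
      map_add' := fun X Y => by rw [hφσ _ (σ X + σ Y) (by rw [map_add, hσ, hσ]), map_add]
      map_smul' := fun c X => by
        rw [hφσ _ (c • σ X) (by rw [map_smul, hσ]), map_smul, RingHom.id_apply] }
  refine weakDual_ext fun a => ?_
  rw [matrixTrace_apply, ← eq_trace_of_tracial f (by
      change φ (σ 1) = 1
      rw [hφσ 1 1 (map_one π), hφ.1]) (fun X Y => by
      change φ (σ (X * Y)) = φ (σ (Y * X))
      rw [hφσ _ (σ X * σ Y) (by rw [map_mul, hσ, hσ]), hφ.2.2,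
        hφσ (Y * X) (σ Y * σ X) (by rw [map_mul, hσ, hσ])])]
  exact (hφσ _ a rfl).symm

/-- Two surjections with the same kernel have isomorphic targets. -/
theorem nonempty_starAlgEquiv_of_ker_eq {B C : Type*} [Ring B] [StarRing B] [Algebra ℂ B]
    [Ring C] [StarRing C] [Algebra ℂ C] (f : A →⋆ₐ[ℂ] B) (g : A →⋆ₐ[ℂ] C)
    (hf : Function.Surjective f) (hg : Function.Surjective g) (h : ∀ a, f a = 0 ↔ g a = 0) :
    Nonempty (B ≃⋆ₐ[ℂ] C) := by
  have h' : ∀ a b, f a = f b ↔ g a = g b := fun a b => by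
    rw [← sub_eq_zero, ← map_sub, h, map_sub, sub_eq_zero]
  choose σ hσ using hf
  have hgσ : ∀ x a, f a = x → g (σ x) = g a := fun x a hx => (h' _ _).1 (by rw [hσ, hx])
  have hbij : Function.Bijective fun x => g (σ x) := by
    constructor
    · intro x y hxy
      rw [← hσ x, ← hσ y]
      exact (h' _ _).2 hxy
    · intro y
      obtain ⟨a, rfl⟩ := hg y
      exact ⟨f a, hgσ _ a rfl⟩
  refine ⟨{ Equiv.ofBijective _ hbij with
    map_mul' := fun x y => ?_
    map_add' := fun x y => ?_
    map_star' := fun x => ?_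
    map_smul' := fun c x => ?_ }⟩
  · exact (hgσ _ (σ x * σ y) (by rw [map_mul, hσ, hσ])).trans (map_mul _ _ _)
  · exact (hgσ _ (σ x + σ y) (by rw [map_add, hσ, hσ])).trans (map_add _ _ _)
  · exact (hgσ _ (star (σ x)) (by rw [map_star, hσ])).trans (map_star _ _)
  · exact (hgσ _ (c • σ x) (by rw [map_smul, hσ])).trans (map_smul _ _ _)

/-- The von Neumann algebra of the trace of a surjective matrix representation is a matrix
algebra: in the GNS space, operators commuting with right multiplications are left
multiplications. -/
theorem nonempty_traceVonNeumannAlgebra_equiv [PartialOrder A] [StarOrderedRing A] [Nonempty ι]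
    (π : A →⋆ₐ[ℂ] Matrix ι ι ℂ) (hπ : Function.Surjective π) {φ : traceSpace A}
    (hφ : φ.1 = matrixTrace π) :
    Nonempty (traceVonNeumannAlgebra φ ≃⋆ₐ[ℂ] Matrix (Fin (Fintype.card ι))
      (Fin (Fintype.card ι)) ℂ) := by
  have hker : ∀ a, gnsVec φ a = 0 ↔ π a = 0 := fun a => by
    rw [← norm_eq_zero, ← sq_eq_zero_iff, norm_gnsVec_sq, hφ, matrixTrace_star_mul_self,
      Complex.ofReal_re, mul_eq_zero, or_iff_right (by simp), frobenius_sq]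
    constructor
    · intro h
      ext i j
      have h1 := (Finset.sum_eq_zero_iff_of_nonneg (fun i _ => by positivity)).1 h i
        (Finset.mem_univ _)
      have h2 := (Finset.sum_eq_zero_iff_of_nonneg (fun i _ => by positivity)).1 h1 j
        (Finset.mem_univ _)
      simpa using h2
    · intro h
      simp [h]
  have hsurj : Function.Surjective (gnsVec φ) :=
    gnsVec_surjective φ (π : A →ₐ[ℂ] Matrix ι ι ℂ).toLinearMap fun a ha => (hker a).2 ha
  have hfd : FiniteDimensional ℂ (tracePositive φ).GNS := by
    choose σ hσ using hπ
    let f : Matrix ι ι ℂ →ₗ[ℂ] (tracePositive φ).GNS :=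
      { toFun := fun X => gnsVec φ (σ X)
        map_add' := fun X Y => by
          rw [← map_add, ← sub_eq_zero, ← map_sub, hker, map_sub, map_add, hσ, hσ, hσ, sub_self]
        map_smul' := fun c X => by
          rw [RingHom.id_apply, ← map_smul, ← sub_eq_zero, ← map_sub, hker, map_sub, map_smul, hσ,
            hσ, sub_self] }
    refine Module.Finite.of_surjective f fun x => ?_
    obtain ⟨a, rfl⟩ := hsurj x
    refine ⟨π a, ?_⟩
    change gnsVec φ (σ (π a)) = gnsVec φ a
    rw [← sub_eq_zero, ← map_sub, hker, map_sub, hσ, sub_self]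
  set P := (tracePositive φ).gnsStarAlgHom with hP
  -- Right multiplications are well defined on the GNS space, which is a quotient of the algebra.
  have hright : ∀ b, ∃ R : (tracePositive φ).GNS →L[ℂ] (tracePositive φ).GNS,
      ∀ a, R (gnsVec φ a) = gnsVec φ (a * b) := fun b => by
    choose τ hτ using hsurj
    have h1 : ∀ x a, gnsVec φ a = x → gnsVec φ (τ x * b) = gnsVec φ (a * b) := fun x a h => by
      rw [← sub_eq_zero, ← map_sub, hker, ← sub_mul, map_mul, (hker _).1, Matrix.zero_mul]
      rw [map_sub, hτ, h, sub_self]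
    let f : (tracePositive φ).GNS →ₗ[ℂ] (tracePositive φ).GNS :=
      { toFun := fun x => gnsVec φ (τ x * b)
        map_add' := fun x y => by
          rw [h1 (x + y) (τ x + τ y) (by rw [map_add, hτ, hτ]), add_mul, map_add]
        map_smul' := fun c x => by
          rw [h1 (c • x) (c • τ x) (by rw [map_smul, hτ]), smul_mul_assoc, map_smul,
            RingHom.id_apply] }
    exact ⟨LinearMap.toContinuousLinearMap f, fun a => h1 _ a rfl⟩
  choose R hR using hright
  have hcomm : ∀ b, R b ∈ StarSubalgebra.centralizer ℂ (Set.range P) := fun b => by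
    have h1 : ∀ c, P c * R b = R b * P c := fun c => by
      ext x
      obtain ⟨a, rfl⟩ := hsurj x
      change P c (R b (gnsVec φ a)) = R b (P c (gnsVec φ a))
      rw [hR, hP, gnsStarAlgHom_gnsVec, gnsStarAlgHom_gnsVec, hR, mul_assoc]
    rw [StarSubalgebra.mem_centralizer_iff]
    rintro _ ⟨c, rfl⟩
    rw [← map_star]
    exact ⟨h1 c, h1 _⟩
  have hmem : ∀ a, P a ∈ traceVonNeumannAlgebra φ := fun a => by
    rw [traceVonNeumannAlgebra, StarSubalgebra.mem_centralizer_iff]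
    intro g hg
    have hg := (StarSubalgebra.mem_centralizer_iff ℂ).1 hg
    refine ⟨((hg _ ⟨a, rfl⟩).1).symm, ?_⟩
    have h2 := congrArg star (hg _ ⟨star a, rfl⟩).1
    rw [star_mul, star_mul, ← map_star, star_star] at h2
    exact h2
  -- The GNS representation `f` and the matrix representation `g` have the same kernel.
  let f : A →⋆ₐ[ℂ] traceVonNeumannAlgebra φ := P.codRestrict _ hmem
  let e := Fintype.equivFin ι
  let g : A →⋆ₐ[ℂ] Matrix (Fin (Fintype.card ι)) (Fin (Fintype.card ι)) ℂ :=
    { ((Matrix.reindexAlgEquiv ℂ ℂ e).toAlgHom.comp (π : A →ₐ[ℂ] Matrix ι ι ℂ)) with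
      map_star' := fun a => by
        change (π (star a)).submatrix _ _ = ((π a).submatrix _ _)ᴴ
        rw [map_star, conjTranspose_submatrix]
        rfl }
  have hg : ∀ a, g a = (Matrix.reindexAlgEquiv ℂ ℂ e) (π a) := fun a => rfl
  refine nonempty_starAlgEquiv_of_ker_eq f g ?_ ?_ ?_
  · rintro ⟨T, hT⟩
    obtain ⟨a, ha⟩ := hsurj (T (gnsVec φ 1))
    refine ⟨a, Subtype.ext ?_⟩
    change P a = T
    ext x
    obtain ⟨b, rfl⟩ := hsurj x
    -- An operator `T` in the bicommutant is determined by its value at `gnsVec φ 1`.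
    have h1 := ((StarSubalgebra.mem_centralizer_iff ℂ).1 hT (R b) (hcomm b)).1
    have h2 := congrArg (fun S : (tracePositive φ).GNS →L[ℂ] (tracePositive φ).GNS =>
      S (gnsVec φ 1)) h1
    change R b (T (gnsVec φ 1)) = T (R b (gnsVec φ 1)) at h2
    rw [hR, one_mul, ← ha, hR] at h2
    rw [hP, gnsStarAlgHom_gnsVec, h2]
  · intro X
    obtain ⟨a, ha⟩ := hπ ((Matrix.reindexAlgEquiv ℂ ℂ e).symm X)
    exact ⟨a, by rw [hg, ha, AlgEquiv.apply_symm_apply]⟩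
  · intro a
    rw [hg, map_eq_zero_iff (Matrix.reindexAlgEquiv ℂ ℂ e) (AlgEquiv.injective _), ← hker]
    constructor
    · intro h
      have h1 : P a = 0 := congrArg Subtype.val h
      have h2 := gnsStarAlgHom_gnsVec φ a 1
      rw [mul_one, ← hP, h1, _root_.zero_apply] at h2
      exact h2.symm
    · intro h
      refine Subtype.ext ?_
      change P a = 0
      ext x
      obtain ⟨b, rfl⟩ := hsurj x
      rw [hP, gnsStarAlgHom_gnsVec, _root_.zero_apply, hker, map_mul, (hker a).1 h, Matrix.zero_mul]

end Irreducible

/-- The trace of a surjective representation on `ℂᵏ` is an extreme trace of dimension `k`. -/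
theorem matrixTrace_mem_extremeFiniteDimensionalTraces {A : Type*} [CStarAlgebra A] {ι : Type*}
    [Fintype ι] [DecidableEq ι] [Nonempty ι] (π : A →⋆ₐ[ℂ] Matrix ι ι ℂ)
    (hπ : Function.Surjective π) {m : ℕ} (hm : m ≤ Fintype.card ι) :
    matrixTrace π ∈ extremeFiniteDimensionalTraces A m := by
  let := CStarAlgebra.spectralOrder A
  have := CStarAlgebra.spectralOrderedRing A
  obtain ⟨e⟩ := nonempty_traceVonNeumannAlgebra_equiv π hπ
    (φ := ⟨matrixTrace π, matrixTrace_mem π⟩) rfl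
  refine ⟨matrixTrace_mem_extremePoints π hπ, ⟨matrixTrace_mem π, ?_⟩, matrixTrace_mem π, _, hm, ⟨e⟩⟩
  exact Module.Finite.of_injective (e : traceVonNeumannAlgebra _ ≃⋆ₐ[ℂ] _).toAlgEquiv.toLinearMap e.injective

/-! ### Irreducible representations are dense -/

section UnitaryPath

open Matrix
open scoped Matrix.Norms.L2Operator

/-- Every unitary matrix is joined to the identity by an analytic path of unitaries: the powers
`W ^ t`, defined by functional calculus on the finite spectrum of `W`. -/
theorem exists_analytic_unitary_path {ι : Type*} [Fintype ι] [DecidableEq ι]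
    (W : unitaryGroup ι ℂ) : ∃ γ : ℝ → unitaryGroup ι ℂ, γ 0 = 1 ∧ γ 1 = W ∧
      ∀ p q, AnalyticOnNhd ℝ (fun t => (γ t).1 p q) Set.univ := by
  have hW : IsStarNormal W.1 :=
    ⟨(Unitary.star_mul_self_of_mem W.2).trans (Unitary.mul_star_self_of_mem W.2).symm⟩
  have hfin : (spectrum ℂ W.1).Finite := Matrix.finite_spectrum W.1
  have hcont : ∀ f : ℂ → ℂ, ContinuousOn f (spectrum ℂ W.1) := fun f => hfin.continuousOn f
  have hcirc : ∀ z ∈ spectrum ℂ W.1, ‖z‖ = 1 := fun z hz => by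
    simpa using spectrum.subset_circle_of_unitary W.2 hz
  let f : ℝ → ℂ → ℂ := fun t z => Complex.exp (((t * z.arg : ℝ) : ℂ) * Complex.I)
  have hf : ∀ t z, star (f t z) * f t z = 1 := fun t z => by
    rw [Complex.star_def, ← Complex.normSq_eq_conj_mul_self, Complex.normSq_eq_norm_sq,
      Complex.norm_exp_ofReal_mul_I]
    norm_num
  have hmem : ∀ t, cfc (f t) W.1 ∈ unitaryGroup ι ℂ := fun t => by
    rw [mem_unitaryGroup_iff', ← cfc_star, ← cfc_mul _ _ W.1 (hcont _) (hcont _)]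
    simp only [hf]
    exact cfc_const_one ℂ W.1
  refine ⟨fun t => ⟨cfc (f t) W.1, hmem t⟩, Subtype.ext ?_, Subtype.ext ?_, fun p q => ?_⟩
  · have : f 0 = fun _ => 1 := by funext z; simp [f]
    change cfc (f 0) W.1 = 1
    rw [this]
    exact cfc_const_one ℂ W.1
  · change cfc (f 1) W.1 = W.1
    conv_rhs => rw [← cfc_id' ℂ W.1]
    refine cfc_congr fun z hz => ?_
    have h := Complex.norm_mul_exp_arg_mul_I z
    rw [hcirc z hz] at h
    simpa [f] using h
  · -- The path is the sum of `f t w • P w` over the spectrum, with the spectral projections `P w`.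
    let P : ℂ → Matrix ι ι ℂ := fun w => cfc (fun z => if z = w then (1 : ℂ) else 0) W.1
    have h1 : ∀ t, cfc (f t) W.1 = ∑ w ∈ hfin.toFinset, f t w • P w := fun t => by
      have h2 : ∀ w, f t w • P w = cfc (fun z => f t w * if z = w then (1 : ℂ) else 0) W.1 :=
        fun w => (cfc_const_mul _ _ _ (hcont _)).symm
      simp only [h2]
      rw [← cfc_sum _ _ _ fun _ _ => hcont _]
      refine cfc_congr fun z hz => ?_
      rw [Finset.sum_apply]
      simp [hz]
    have h2 : ∀ t, (cfc (f t) W.1) p q = ∑ w ∈ hfin.toFinset, f t w * P w p q := fun t => by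
      rw [h1, Matrix.sum_apply]
      rfl
    simp only [h2]
    refine Finset.analyticOnNhd_fun_sum _ fun w _ => AnalyticOnNhd.mul ?_ analyticOnNhd_const
    refine (analyticOnNhd_cexp.restrictScalars (𝕜 := ℝ)).comp (t := Set.univ) ?_
      fun _ _ => Set.mem_univ _
    refine AnalyticOnNhd.mul ?_ analyticOnNhd_const
    exact (Complex.ofRealCLM.analyticOnNhd _).comp (analyticOnNhd_id.mul analyticOnNhd_const)
      fun _ _ => Set.mem_univ _

end UnitaryPath

section Density

open Matrix
open scoped Matrix.Norms.Frobenius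

theorem analyticOnNhd_matrix {ι κ : Type*} [Fintype ι] [DecidableEq ι] [Fintype κ] [DecidableEq κ]
    {f : ℝ → Matrix ι κ ℂ}
    (hf : ∀ p q, AnalyticOnNhd ℝ (fun t => f t p q) Set.univ) : AnalyticOnNhd ℝ f Set.univ := by
  have h : f = fun t => ∑ p, ∑ q, f t p q • single p q (1 : ℂ) := by
    funext t
    conv_lhs => rw [matrix_eq_sum_single (f t)]
    simp
  rw [h]
  exact Finset.analyticOnNhd_fun_sum _ fun p _ => Finset.analyticOnNhd_fun_sum _ fun q _ =>
    (hf p q).smul analyticOnNhd_const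

/-- The commutators with a family of matrices, together with the trace. It is injective if and only
if the family has trivial commutant. -/
def commutatorMap {ι τ : Type*} [Fintype ι] [DecidableEq ι] (g : τ → Matrix ι ι ℂ) :
    Matrix ι ι ℂ →ₗ[ℂ] (τ → Matrix ι ι ℂ) × ℂ :=
  (LinearMap.pi fun s => LinearMap.mulRight ℂ (g s) - LinearMap.mulLeft ℂ (g s)).prod
    (traceLinearMap ι ℂ ℂ)

theorem commutatorMap_apply {ι τ : Type*} [Fintype ι] [DecidableEq ι] (g : τ → Matrix ι ι ℂ)
    (X : Matrix ι ι ℂ) : commutatorMap g X = (fun s => X * g s - g s * X, X.trace) := rfl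

/-- Along an analytic path of families of matrices, injectivity of the commutator map at one
point implies injectivity near any other point, with the possible exception of the point itself:
if `S` is a left inverse at `1`, the determinant of the composition with `S` is analytic and
nonzero at `1`, so that its zeros are isolated. -/
theorem eventually_injective_commutatorMap {ι τ : Type*} [Fintype ι] [DecidableEq ι] [Finite τ]
    (g : ℝ → τ → Matrix ι ι ℂ) (hg : ∀ s p q, AnalyticOnNhd ℝ (fun t => g t s p q) Set.univ)
    (h1 : Function.Injective (commutatorMap (g 1))) :
    ∀ᶠ t in nhdsWithin 0 {(0 : ℝ)}ᶜ, Function.Injective (commutatorMap (g t)) := by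
  have := Fintype.ofFinite τ
  obtain ⟨S, hS⟩ := (commutatorMap (g 1)).exists_leftInverse_of_injective (LinearMap.ker_eq_bot.2 h1)
  let b := Module.finBasis ℂ (Matrix ι ι ℂ)
  let D : ℝ → ℂ := fun t => (LinearMap.toMatrix b b (S.comp (commutatorMap (g t)))).det
  have hD : AnalyticOnNhd ℝ D Set.univ := by
    have hentry : ∀ i j, AnalyticOnNhd ℝ
        (fun t => LinearMap.toMatrix b b (S.comp (commutatorMap (g t))) i j) Set.univ := by
      intro i j
      let L : ((τ → Matrix ι ι ℂ) × ℂ) →L[ℂ] ℂ := LinearMap.toContinuousLinearMap ((b.coord i).comp S)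
      have e : (fun t => LinearMap.toMatrix b b (S.comp (commutatorMap (g t))) i j)
          = fun t => L (commutatorMap (g t) (b j)) := by
        funext t
        rw [LinearMap.toMatrix_apply]
        rfl
      rw [e]
      refine ((L.restrictScalars ℝ).analyticOnNhd Set.univ).comp ?_ fun _ _ => Set.mem_univ _
      simp only [commutatorMap_apply]
      refine AnalyticOnNhd.prod (analyticOnNhd_pi_iff.2 fun s => ?_) analyticOnNhd_const
      have h2 : AnalyticOnNhd ℝ (fun t => g t s) Set.univ := analyticOnNhd_matrix (hg s)
      exact (analyticOnNhd_const.mul h2).sub (h2.mul analyticOnNhd_const)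
    simp only [D, det_apply]
    refine Finset.analyticOnNhd_fun_sum _ fun σ _ => ?_
    have h3 : AnalyticOnNhd ℝ (fun t => ∏ i, LinearMap.toMatrix b b
        (S.comp (commutatorMap (g t))) (σ i) i) Set.univ :=
      Finset.analyticOnNhd_fun_prod _ fun i _ => hentry _ _
    rcases Int.units_eq_one_or (Equiv.Perm.sign σ) with h | h
    · simpa [h] using h3
    · simp only [h, Units.smul_def, Units.val_neg, Units.val_one, neg_smul, one_smul]
      exact h3.neg
  have hD1 : D 1 = 1 := by
    simp only [D, hS]
    rw [LinearMap.toMatrix_id, det_one]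
  have h2 : ∀ᶠ t in nhdsWithin 0 {(0 : ℝ)}ᶜ, D t ≠ 0 := by
    by_contra hcon
    have h3 : ∃ᶠ t in nhdsWithin 0 {(0 : ℝ)}ᶜ, D t = 0 := by
      simpa [Filter.not_eventually] using hcon
    have h4 := hD.eqOn_zero_of_preconnected_of_frequently_eq_zero isPreconnected_univ
      (Set.mem_univ 0) h3 (Set.mem_univ 1)
    rw [hD1] at h4
    exact one_ne_zero h4
  filter_upwards [h2] with t ht
  have h3 : (S.comp (commutatorMap (g t))).det ≠ 0 := by rwa [← LinearMap.det_toMatrix b]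
  have h4 : Function.Injective (S.comp (commutatorMap (g t))) :=
    ((Module.End.isUnit_iff _).1 ((LinearMap.isUnit_iff_isUnit_det _).2 h3.isUnit)).injective
  intro X Y hXY
  exact h4 (congrArg S hXY)

variable {A : Type*} [CStarAlgebra A] {d n : ℕ}

theorem continuous_rep_apply {ι : Type*} [Fintype ι] [DecidableEq ι]
    (π : A →⋆ₐ[ℂ] Matrix ι ι ℂ) (i j : ι) : Continuous fun a => π a i j := by
  let f : A →ₗ[ℂ] ℂ :=
    { toFun := fun a => π a i j
      map_add' := fun a b => by rw [map_add]; rfl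
      map_smul' := fun c a => by rw [map_smul]; rfl }
  exact (f.mkContinuous 1 fun a => by rw [one_mul]; exact norm_rep_apply_le π a i j).continuous

/-- Commutation with the generators and their adjoints is commutation with the representation. -/
theorem commute_rep_of_dense {ι : Type*} [Fintype ι] [DecidableEq ι]
    (π : A →⋆ₐ[ℂ] Matrix ι ι ℂ) {s : Set A} (hs : Dense (StarAlgebra.adjoin ℂ s : Set A))
    {X : Matrix ι ι ℂ} (h : ∀ a ∈ s, X * π a = π a * X) (h' : ∀ a ∈ s, X * (π a)ᴴ = (π a)ᴴ * X)
    (a : A) : X * π a = π a * X := by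
  have h1 : ∀ a ∈ StarAlgebra.adjoin ℂ s, X * π a = π a * X ∧ X * (π a)ᴴ = (π a)ᴴ * X := by
    intro a ha
    induction ha using StarAlgebra.adjoin_induction with
    | mem x hx => exact ⟨h x hx, h' x hx⟩
    | algebraMap r =>
      rw [Algebra.algebraMap_eq_smul_one, map_smul, map_one, conjTranspose_smul, conjTranspose_one]
      simp
    | add x y _ _ hx hy =>
      rw [map_add, conjTranspose_add, Matrix.mul_add, Matrix.add_mul, Matrix.mul_add,
        Matrix.add_mul, hx.1, hx.2, hy.1, hy.2]
      exact ⟨rfl, rfl⟩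
    | mul x y _ _ hx hy =>
      rw [map_mul, conjTranspose_mul, ← Matrix.mul_assoc, hx.1, Matrix.mul_assoc, hy.1,
        Matrix.mul_assoc, ← Matrix.mul_assoc X, hy.2, Matrix.mul_assoc, hx.2, Matrix.mul_assoc]
      exact ⟨rfl, rfl⟩
    | star x _ hx =>
      rw [map_star, star_eq_conjTranspose, conjTranspose_conjTranspose]
      exact ⟨hx.2, hx.1⟩
  have hcl : IsClosed {a : A | X * π a = π a * X} := by
    have e : {a : A | X * π a = π a * X}
        = ⋂ p, ⋂ q, {a : A | ∑ r, X p r * π a r q = ∑ r, π a p r * X r q} := by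
      ext a
      simp only [Set.mem_iInter]
      constructor
      · intro h p q
        have := congrFun (congrFun (show X * π a = π a * X from h) p) q
        rwa [mul_apply, mul_apply] at this
      · intro h
        change X * π a = π a * X
        ext p q
        rw [mul_apply, mul_apply]
        exact h p q
    rw [e]
    refine isClosed_iInter fun p => isClosed_iInter fun q => isClosed_eq ?_ ?_
    · exact continuous_finsetSum _ fun r _ => (continuous_rep_apply π r q).const_mul _
    · exact continuous_finsetSum _ fun r _ => (continuous_rep_apply π p r).mul_const _
  exact hcl.closure_subset_iff.2 (fun a ha => (h1 a ha).1) (hs a)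

namespace MatrixModel

variable (𝓜 : MatrixModel A d n)

/-- Tuples of unitaries defining an irreducible representation are dense: an analytic path joins any
tuple to one that defines an irreducible representation. -/
theorem exists_irreducible_near {κ : Type} [Fintype κ] [DecidableEq κ] [Nonempty κ]
    (u : Fin d → unitaryGroup (Fin n × κ) ℂ) {ε : ℝ} (hε : 0 < ε) :
    ∃ v : Fin d → unitaryGroup (Fin n × κ) ℂ, (∀ i, ‖(v i).1 - (u i).1‖ < ε) ∧
      ∀ X, (∀ a, X * 𝓜.rep κ v a = 𝓜.rep κ v a * X) → ∃ c : ℂ, X = c • 1 := by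
  obtain ⟨u₀, hu₀⟩ := 𝓜.irreducible κ
  choose γ hγ0 hγ1 hγ using fun i => exists_analytic_unitary_path ((u i)⁻¹ * u₀ i)
  let w : ℝ → Fin d → unitaryGroup (Fin n × κ) ℂ := fun t i => u i * γ i t
  have hw : ∀ i p q, AnalyticOnNhd ℝ (fun t => (w t i).1 p q) Set.univ := fun i p q => by
    have e : (fun t => (w t i).1 p q) = fun t => ∑ r, (u i).1 p r * (γ i t).1 r q := by
      funext t
      exact mul_apply
    rw [e]
    exact Finset.analyticOnNhd_fun_sum _ fun r _ => analyticOnNhd_const.mul (hγ i r q)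
  have hw0 : w 0 = u := by
    funext i
    simp [w, hγ0]
  have hw1 : w 1 = u₀ := by
    funext i
    simp [w, hγ1]
  have := 𝓜.finite
  let g : ℝ → 𝓜.σ × Bool → Matrix (Fin n × κ) (Fin n × κ) ℂ := fun t s =>
    if s.2 then (𝓜.rep κ (w t) (𝓜.gen s.1))ᴴ else 𝓜.rep κ (w t) (𝓜.gen s.1)
  have hg : ∀ s p q, AnalyticOnNhd ℝ (fun t => g t s p q) Set.univ := by
    rintro ⟨s, _ | _⟩ p q
    · exact 𝓜.analytic κ w hw s p q
    · exact (Complex.conjCLE.toContinuousLinearMap.analyticOnNhd Set.univ).comp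
        (𝓜.analytic κ w hw s q p) fun _ _ => Set.mem_univ _
  have : Nonempty (Fin n) := ⟨⟨0, 𝓜.pos⟩⟩
  have h1 : Function.Injective (commutatorMap (g 1)) := by
    rw [injective_iff_map_eq_zero]
    intro X hX
    rw [commutatorMap_apply, Prod.mk_eq_zero] at hX
    have hc : ∀ s, X * g 1 s = g 1 s * X := fun s => sub_eq_zero.1 (congrFun hX.1 s)
    obtain ⟨c, rfl⟩ := hu₀ X (commute_rep_of_dense _ 𝓜.dense (by
        rintro _ ⟨s, rfl⟩
        have := hc (s, false)
        simp only [g, hw1] at this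
        exact this) (by
        rintro _ ⟨s, rfl⟩
        have := hc (s, true)
        simp only [g, hw1] at this
        exact this))
    have h2 := hX.2
    rw [trace_smul, Matrix.trace_one, smul_eq_mul, mul_eq_zero, or_iff_left
      (by exact_mod_cast Fintype.card_ne_zero)] at h2
    rw [h2, zero_smul]
  have h2 : ∀ᶠ t in nhdsWithin 0 {(0 : ℝ)}ᶜ, ∀ i, ‖(w t i).1 - (u i).1‖ < ε := by
    refine nhdsWithin_le_nhds (Filter.eventually_all.2 fun i => ?_)
    have h3 : AnalyticOnNhd ℝ (fun t => (w t i).1) Set.univ := analyticOnNhd_matrix (hw i)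
    have h4 : Continuous fun t => (w t i).1 := continuousOn_univ.1 h3.continuousOn
    have h5 : Continuous fun t => ‖(w t i).1 - (u i).1‖ := (h4.sub continuous_const).norm
    have h5 := h5.tendsto 0
    rw [hw0, sub_self, norm_zero] at h5
    exact h5.eventually (gt_mem_nhds hε)
  obtain ⟨t, ht1, ht2⟩ := ((eventually_injective_commutatorMap g hg h1).and h2).exists
  -- A matrix in the commutant has the same image as the scalar matrix with the same trace.
  refine ⟨w t, ht2, fun X hX => ⟨(Fintype.card (Fin n × κ) : ℂ)⁻¹ * X.trace, ht1 ?_⟩⟩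
  have hcard : (Fintype.card (Fin n × κ) : ℂ) ≠ 0 := by exact_mod_cast Fintype.card_ne_zero
  rw [commutatorMap_apply, commutatorMap_apply, trace_smul, Matrix.trace_one, smul_eq_mul,
    mul_right_comm, inv_mul_cancel₀ hcard, one_mul]
  congr 1
  funext s
  have h6 : X * g t s = g t s * X := by
    obtain ⟨s, _ | _⟩ := s
    · exact hX _
    · have := hX (star (𝓜.gen s))
      rwa [map_star] at this
  rw [h6, sub_self, smul_mul_assoc, mul_smul_comm, Matrix.one_mul, Matrix.mul_one, sub_self]

/-- Traces of irreducible representations of large dimension are dense in the matrix traces. A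
representation is amplified, which makes the dimension large and does not change the trace, and
then perturbed to an irreducible one. -/
theorem matrixTraces_subset_closure_extreme (𝓜 : MatrixModel A d n) (m : ℕ) :
    matrixTraces A ⊆ closure (extremeFiniteDimensionalTraces A m) := by
  rintro _ ⟨ι, _, _, _, π, rfl⟩
  obtain ⟨κ, _, _, _, u, hu⟩ := 𝓜.complete ι π
  have : Nonempty (Fin n) := ⟨⟨0, 𝓜.pos⟩⟩
  refine mem_closure_of_approx (fun φ hφ => hφ.1.1) (matrixTrace_mem π) 𝓜.dense fun F hF ε hε => ?_
  choose C hC0 hC using fun a : {a // a ∈ F} => 𝓜.defect_adjoin (hF a.2)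
  let U : Fin d → unitaryGroup (Fin n × (κ × Fin (m + 1))) ℂ := fun i => amplUnitary (m + 1) (u i)
  have hU : ∀ a ∈ F, matrixTrace (𝓜.rep _ U) a = matrixTrace π a := fun a ha => by
    rw [hu, matrixTrace_apply, matrixTrace_apply, trace, trace]
    simp only [diag_apply]
    rw [Finset.sum_congr rfl fun x _ => 𝓜.rep_amplUnitary_diag (hF ha) (m + 1) u x,
      Fintype.sum_prod_type, Fintype.sum_prod_type]
    simp only [Fintype.sum_prod_type, Finset.sum_const, Finset.card_univ, Fintype.card_fin,
      Fintype.card_prod, nsmul_eq_mul, ← Finset.mul_sum]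
    have h1 : (n : ℂ) ≠ 0 := by exact_mod_cast 𝓜.pos.ne'
    have h2 : (Fintype.card κ : ℂ) ≠ 0 := by exact_mod_cast Fintype.card_ne_zero
    have h3 : ((m : ℂ) + 1) ≠ 0 := by exact_mod_cast Nat.succ_ne_zero m
    push_cast
    field_simp
  have hδ : ∃ δ > 0, ∀ a, C a * (d * δ) < ε := by
    have h1 : ∀ᶠ δ in nhdsWithin (0 : ℝ) (Set.Ioi 0), ∀ a, C a * (d * δ) < ε := by
      refine nhdsWithin_le_nhds (Filter.eventually_all.2 fun a => ?_)
      have h2 : Continuous fun δ : ℝ => C a * (d * δ) := by fun_prop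
      have h3 := h2.tendsto 0
      simp only [mul_zero] at h3
      exact h3.eventually (gt_mem_nhds hε)
    obtain ⟨δ, h2, h3⟩ := (h1.and self_mem_nhdsWithin).exists
    exact ⟨δ, h3, h2⟩
  obtain ⟨δ, hδ, hδC⟩ := hδ
  obtain ⟨v, hv, hirr⟩ := 𝓜.exists_irreducible_near U hδ
  refine ⟨_, matrixTrace_mem_extremeFiniteDimensionalTraces (𝓜.rep _ v)
    (surjective_of_irreducible _ hirr) ?_, fun a ha => ?_⟩
  · rw [Fintype.card_prod, Fintype.card_prod, Fintype.card_fin, Fintype.card_fin]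
    have h1 := 𝓜.pos
    have h2 : 0 < Fintype.card κ := Fintype.card_pos
    nlinarith [Nat.mul_pos h1 h2]
  · have h1 := hC ⟨a, ha⟩ _ _ 1 v U
    simp only [ampl_one, Matrix.mul_one, Matrix.one_mul] at h1
    have h2 : ‖𝓜.rep _ v a - 𝓜.rep _ U a‖ < ε := by
      refine (h1.trans (mul_le_mul_of_nonneg_left (b := ∑ i, _) (c := d * δ) ?_ (hC0 _))).trans_lt
        (hδC ⟨a, ha⟩)
      refine (Finset.sum_le_sum fun i _ => (hv i).le).trans ?_
      simp
    rw [← hU a ha, matrixTrace_apply, matrixTrace_apply, ← mul_sub, ← trace_sub, norm_mul, norm_inv,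
      Complex.norm_natCast]
    have hpos : (0 : ℝ) < Fintype.card (Fin n × (κ × Fin (m + 1))) := by
      exact_mod_cast Fintype.card_pos
    have h3 := norm_trace_mul_le_frobenius (𝓜.rep _ v a - 𝓜.rep _ U a) 1
    rw [Matrix.mul_one] at h3
    have h4 : ‖(1 : Matrix (Fin n × (κ × Fin (m + 1))) (Fin n × (κ × Fin (m + 1))) ℂ)‖
        ≤ Fintype.card (Fin n × (κ × Fin (m + 1))) := by
      have h5 := frobenius_one_sq (ι := Fin n × (κ × Fin (m + 1)))
      have h6 : (1 : ℝ) ≤ Fintype.card (Fin n × (κ × Fin (m + 1))) := by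
        exact_mod_cast Fintype.card_pos
      nlinarith [norm_nonneg (1 : Matrix (Fin n × (κ × Fin (m + 1)))
        (Fin n × (κ × Fin (m + 1))) ℂ)]
    rw [inv_mul_lt_iff₀ hpos]
    refine h3.trans_lt ?_
    nlinarith [norm_nonneg (𝓜.rep _ v a - 𝓜.rep _ U a)]

end MatrixModel

end Density

/-! ### The universal property of universal C⋆-algebras -/

section Lift

variable {B : Type*} [Ring B] [StarRing B] [Algebra ℂ B] [hB : IsCStarBounded B]
  {C : Type*} [CStarAlgebra C]

theorem norm_hom_le_maxCStarSeminorm (f : B →⋆ₐ[ℂ] C) (b : B) :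
    ‖f b‖ ≤ (maxCStarSeminorm B).toSeminorm b :=
  le_ciSup (hB.bddAbove b)
    { toSeminorm := (normSeminorm ℂ C).comp f.toAlgHom.toLinearMap
      mul_le' := fun a b => by
        change ‖f (a * b)‖ ≤ ‖f a‖ * ‖f b‖
        rw [map_mul]
        exact norm_mul_le _ _
      star_mul_self' := fun a => by
        change ‖f (star a * a)‖ = ‖f a‖ * ‖f a‖
        rw [map_mul, map_star, CStarRing.norm_star_mul_self] }

theorem uniformContinuous_hom (f : B →⋆ₐ[ℂ] C) :
    UniformContinuous (fun b : (maxCStarSeminorm B).Carrier => f b) :=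
  (LipschitzWith.of_dist_le_mul (K := 1) fun a b => by
    rw [dist_eq_norm, dist_eq_norm, NNReal.coe_one, one_mul]
    have h := norm_hom_le_maxCStarSeminorm f ((show B from a) - (show B from b))
    rw [map_sub] at h
    exact h).uniformContinuous

/-- The extension of a star homomorphism into a C⋆-algebra to the universal C⋆-algebra. -/
noncomputable def universalLift (f : B →⋆ₐ[ℂ] C) : UniversalCStar B →⋆ₐ[ℂ] C :=
  let F : UniversalCStar B → C :=
    UniformSpace.Completion.extension (fun b : (maxCStarSeminorm B).Carrier => f b)
  have hF : ∀ b, F (CStarSeminorm.Completion.of _ b) = f b := fun b =>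
    UniformSpace.Completion.extension_coe (uniformContinuous_hom f) b
  have hc : Continuous F := UniformSpace.Completion.continuous_extension
  { toFun := F
    map_one' := by rw [← map_one (CStarSeminorm.Completion.of _), hF, map_one]
    map_mul' := fun x y => by
      refine CStarSeminorm.Completion.induction _ (P := fun x => F (x * y) = F x * F y) x
        (isClosed_eq (hc.comp (continuous_mul_const y)) (hc.mul continuous_const)) fun a => ?_
      refine CStarSeminorm.Completion.induction _ (P := fun y => F (_ * y) = F _ * F y) y
        (isClosed_eq (hc.comp (continuous_const_mul _)) (continuous_const.mul hc)) fun b => ?_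
      rw [← map_mul, hF, hF, hF, map_mul]
    map_zero' := by rw [← map_zero (CStarSeminorm.Completion.of _), hF, map_zero]
    map_add' := fun x y => by
      refine CStarSeminorm.Completion.induction _ (P := fun x => F (x + y) = F x + F y) x
        (isClosed_eq (hc.comp (continuous_add_const y)) (hc.add continuous_const)) fun a => ?_
      refine CStarSeminorm.Completion.induction _ (P := fun y => F (_ + y) = F _ + F y) y
        (isClosed_eq (hc.comp (continuous_const_add _)) (continuous_const.add hc)) fun b => ?_
      rw [← map_add, hF, hF, hF, map_add]
    commutes' := fun c => by
      rw [Algebra.algebraMap_eq_smul_one, ← map_one (CStarSeminorm.Completion.of _),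
        ← CStarSeminorm.Completion.of_smul, hF, map_smul, map_one, Algebra.algebraMap_eq_smul_one]
    map_star' := fun x => by
      refine CStarSeminorm.Completion.induction _ (P := fun x => F (star x) = star (F x)) x
        (isClosed_eq (hc.comp continuous_star) (continuous_star.comp hc)) fun a => ?_
      rw [CStarSeminorm.Completion.star_of, hF, hF, map_star] }

theorem universalLift_of (f : B →⋆ₐ[ℂ] C) (b : B) :
    universalLift f (CStarSeminorm.Completion.of _ b) = f b :=
  UniformSpace.Completion.extension_coe (uniformContinuous_hom f) b

variable (B) in
/-- The canonical map of a star algebra into its universal C⋆-algebra. -/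
noncomputable def universalOf : B →⋆ₐ[ℂ] UniversalCStar B :=
  { CStarSeminorm.Completion.of (maxCStarSeminorm B) with
    commutes' := fun z => by
      change CStarSeminorm.Completion.of _ (algebraMap ℂ B z) = algebraMap ℂ (UniversalCStar B) z
      rw [Algebra.algebraMap_eq_smul_one, CStarSeminorm.Completion.of_smul, map_one,
        Algebra.algebraMap_eq_smul_one]
    map_star' := fun a => (CStarSeminorm.Completion.star_of _ a).symm }

theorem universalLift_universalOf (f : B →⋆ₐ[ℂ] C) (b : B) :
    universalLift f (universalOf B b) = f b := universalLift_of f b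

theorem denseRange_universalOf : DenseRange (universalOf B) :=
  UniformSpace.Completion.denseRange_coe (α := (maxCStarSeminorm B).Carrier)

variable [StarModule ℂ B]

/-- If `s` generates `B` as a star algebra, then its image generates a dense star subalgebra. -/
theorem dense_adjoin_universalOf {s : Set B} (hs : ∀ b, b ∈ StarAlgebra.adjoin ℂ s) :
    Dense (StarAlgebra.adjoin ℂ (universalOf B '' s) : Set (UniversalCStar B)) := by
  refine denseRange_universalOf.mono ?_
  rintro _ ⟨b, rfl⟩
  have h : StarAlgebra.adjoin ℂ s ≤
      (StarAlgebra.adjoin ℂ (universalOf B '' s)).comap (universalOf B) :=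
    StarAlgebra.adjoin_le fun x hx => StarAlgebra.subset_adjoin ℂ _ ⟨x, hx, rfl⟩
  exact h (hs b)

end Lift

/-! ### Operations on matrix representations -/

section Reps

open Matrix
open scoped Matrix.Norms.Frobenius

variable {A : Type*} [CStarAlgebra A] {ι κ : Type*} [Fintype ι] [DecidableEq ι] [Fintype κ]
  [DecidableEq κ]

/-- Representations that agree on generators are equal. -/
theorem rep_ext {s : Set A} (hs : Dense (StarAlgebra.adjoin ℂ s : Set A))
    {π ρ : A →⋆ₐ[ℂ] Matrix ι ι ℂ} (h : ∀ a ∈ s, π a = ρ a) : π = ρ := by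
  have h1 : ∀ a ∈ StarAlgebra.adjoin ℂ s, π a = ρ a := by
    intro a ha
    induction ha using StarAlgebra.adjoin_induction with
    | mem x hx => exact h x hx
    | algebraMap r => rw [AlgHomClass.commutes, AlgHomClass.commutes]
    | add x y _ _ hx hy => rw [map_add, map_add, hx, hy]
    | mul x y _ _ hx hy => rw [map_mul, map_mul, hx, hy]
    | star x _ hx => rw [map_star, map_star, hx]
  refine StarAlgHom.ext fun a => ?_
  ext i j
  have hcl : IsClosed {a : A | π a i j = ρ a i j} :=
    isClosed_eq (continuous_rep_apply π i j) (continuous_rep_apply ρ i j)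
  exact hcl.closure_subset_iff.2 (fun a ha => by
    change π a i j = ρ a i j
    rw [h1 a ha]) (hs a)

/-- The representation obtained by relabelling the coordinates. -/
def reindexRep (e : ι ≃ κ) (π : A →⋆ₐ[ℂ] Matrix ι ι ℂ) : A →⋆ₐ[ℂ] Matrix κ κ ℂ where
  toFun a := (π a).submatrix e.symm e.symm
  map_one' := by rw [map_one, submatrix_one_equiv]
  map_mul' a b := by rw [map_mul, submatrix_mul_equiv]
  map_zero' := by rw [map_zero]; rfl
  map_add' a b := by rw [map_add]; rfl
  commutes' c := by
    rw [Algebra.algebraMap_eq_smul_one, map_smul, map_one, Algebra.algebraMap_eq_smul_one,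
      ← submatrix_one_equiv e.symm]
    rfl
  map_star' a := by
    rw [map_star, star_eq_conjTranspose, star_eq_conjTranspose, conjTranspose_submatrix]

theorem reindexRep_apply (e : ι ≃ κ) (π : A →⋆ₐ[ℂ] Matrix ι ι ℂ) (a : A) :
    reindexRep e π a = (π a).submatrix e.symm e.symm := rfl

theorem matrixTrace_reindexRep (e : ι ≃ κ) (π : A →⋆ₐ[ℂ] Matrix ι ι ℂ) :
    matrixTrace (reindexRep e π) = matrixTrace π := by
  refine weakDual_ext fun a => ?_
  rw [matrixTrace_apply, matrixTrace_apply, Fintype.card_congr e, reindexRep_apply, trace, trace]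
  congr 1
  exact e.symm.sum_comp fun i => π a i i

/-- The representation obtained by conjugation with a unitary. -/
def conjRep (w : unitaryGroup ι ℂ) (π : A →⋆ₐ[ℂ] Matrix ι ι ℂ) : A →⋆ₐ[ℂ] Matrix ι ι ℂ where
  toFun a := w.1 * π a * w.1ᴴ
  map_one' := by rw [map_one, Matrix.mul_one, unitary_mul_conjTranspose]
  map_mul' a b := by
    rw [map_mul]
    simp only [Matrix.mul_assoc]
    rw [← Matrix.mul_assoc w.1ᴴ w.1, unitary_conjTranspose_mul, Matrix.one_mul]
  map_zero' := by rw [map_zero, Matrix.mul_zero, Matrix.zero_mul]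
  map_add' a b := by rw [map_add, Matrix.mul_add, Matrix.add_mul]
  commutes' c := by
    rw [Algebra.algebraMap_eq_smul_one, map_smul, map_one, Algebra.algebraMap_eq_smul_one,
      Matrix.mul_smul, Matrix.mul_one, Matrix.smul_mul, unitary_mul_conjTranspose]
  map_star' a := by
    rw [map_star, star_eq_conjTranspose, star_eq_conjTranspose, conjTranspose_mul,
      conjTranspose_mul, conjTranspose_conjTranspose, Matrix.mul_assoc]

theorem conjRep_apply (w : unitaryGroup ι ℂ) (π : A →⋆ₐ[ℂ] Matrix ι ι ℂ) (a : A) :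
    conjRep w π a = w.1 * π a * w.1ᴴ := rfl

/-- A positive contraction is unitarily diagonalised, with eigenvalues between `0` and `1`. -/
theorem exists_diagonal_of_posSemidef {B : Matrix ι ι ℂ} (h0 : B.PosSemidef)
    (h1 : (1 - B).PosSemidef) : ∃ (Q : unitaryGroup ι ℂ) (l : ι → ℝ), (∀ k, 0 ≤ l k ∧ l k ≤ 1) ∧
      B = Q.1 * diagonal (fun k => (l k : ℂ)) * Q.1ᴴ := by
  obtain ⟨Q, l, hl0, hspec⟩ : ∃ (Q : unitaryGroup ι ℂ) (l : ι → ℝ), (∀ k, 0 ≤ l k) ∧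
      B = Q.1 * diagonal (fun k => (l k : ℂ)) * Q.1ᴴ := by
    have hB := h0.isHermitian
    refine ⟨hB.eigenvectorUnitary, hB.eigenvalues, fun k => h0.eigenvalues_nonneg k, ?_⟩
    conv_lhs => rw [hB.spectral_theorem]
    rfl
  refine ⟨Q, l, fun k => ⟨hl0 k, ?_⟩, hspec⟩
  have h2 := h1.conjTranspose_mul_mul_same Q.1
  have h3 : Q.1ᴴ * (1 - B) * Q.1 = diagonal fun k => ((1 - l k : ℝ) : ℂ) := by
    rw [Matrix.mul_sub, Matrix.sub_mul, Matrix.mul_one, unitary_conjTranspose_mul, hspec]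
    simp only [Matrix.mul_assoc]
    rw [unitary_conjTranspose_mul, Matrix.mul_one, ← Matrix.mul_assoc, unitary_conjTranspose_mul,
      Matrix.one_mul, ← diagonal_one, diagonal_sub]
    push_cast
    rfl
  rw [h3] at h2
  have h4 := h2.diag_nonneg (i := k)
  rw [diagonal_apply_eq] at h4
  have h5 : 0 ≤ 1 - l k := by exact_mod_cast h4
  linarith

/-- Two unitaries with trivial commutant: a diagonal unitary with distinct entries and a cyclic
permutation. -/
theorem exists_irreducible_pair (ι : Type*) [Fintype ι] [DecidableEq ι] [Nonempty ι] :
    ∃ U V : unitaryGroup ι ℂ, ∀ X : Matrix ι ι ℂ, X * U.1 = U.1 * X → X * V.1 = V.1 * X →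
      ∃ c : ℂ, X = c • 1 := by
  obtain ⟨σ, hσ, -⟩ := (Finset.univ : Finset ι).exists_cycleOn
  let e := Fintype.equivFin ι
  let z : ι → ℂ := fun i => Complex.exp ((((e i : ℕ) : ℝ) / Fintype.card ι : ℝ) * Complex.I)
  have hz1 : ∀ i, star (z i) * z i = 1 := fun i => by
    rw [Complex.star_def, ← Complex.normSq_eq_conj_mul_self, Complex.normSq_eq_norm_sq,
      Complex.norm_exp_ofReal_mul_I]
    norm_num
  have hcard : (0 : ℝ) < Fintype.card ι := by exact_mod_cast Fintype.card_pos
  have hz : Function.Injective z := by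
    have harg : ∀ i, (z i).arg = ((e i : ℕ) : ℝ) / Fintype.card ι := fun i => by
      have h1 : ((e i : ℕ) : ℝ) / Fintype.card ι < 1 := by
        rw [div_lt_one hcard]
        exact_mod_cast (e i).2
      have h2 : 0 ≤ ((e i : ℕ) : ℝ) / Fintype.card ι := by positivity
      rw [Complex.arg_exp_mul_I, toIocMod_eq_self]
      constructor <;> linarith [Real.pi_gt_three]
    intro i j hij
    have h1 := (harg i).symm.trans ((congrArg Complex.arg hij).trans (harg j))
    rw [div_left_inj' hcard.ne'] at h1
    exact e.injective (Fin.ext (by exact_mod_cast h1))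
  refine ⟨⟨diagonal z, ?_⟩, ⟨σ.permMatrix ℂ, ?_⟩, fun X hU hV => ?_⟩
  · rw [mem_unitaryGroup_iff', star_eq_conjTranspose, diagonal_conjTranspose, diagonal_mul_diagonal,
      ← diagonal_one]
    congr 1
    funext i
    exact hz1 i
  · rw [mem_unitaryGroup_iff', star_eq_conjTranspose, conjTranspose_permMatrix, ← permMatrix_mul]
    simp
  · have hoff : ∀ i j, i ≠ j → X i j = 0 := fun i j hij => by
      have h1 := congrFun (congrFun hU i) j
      change (X * diagonal z) i j = (diagonal z * X) i j at h1
      rw [mul_diagonal, diagonal_mul, mul_comm, ← sub_eq_zero, ← sub_mul, mul_eq_zero,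
        sub_eq_zero] at h1
      exact h1.resolve_left fun h => hij (hz h).symm
    have hdiag : ∀ i, X (σ i) (σ i) = X i i := fun i => by
      have h1 := congrFun (congrFun hV i) (σ i)
      change (X * σ.permMatrix ℂ) i (σ i) = (σ.permMatrix ℂ * X) i (σ i) at h1
      rw [Equiv.Perm.permMatrix, PEquiv.mul_toMatrix_toPEquiv, PEquiv.toMatrix_toPEquiv_mul] at h1
      simpa using h1.symm
    have hpow : ∀ (k : ℤ) i, X ((σ ^ k) i) ((σ ^ k) i) = X i i := by
      intro k
      induction k using Int.induction_on with
      | zero => intro i; simp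
      | succ k ih =>
        intro i
        rw [add_comm, _root_.zpow_add, _root_.zpow_one, Equiv.Perm.mul_apply, hdiag, ih]
      | pred k ih =>
        intro i
        have h2 := hdiag ((σ ^ (-(k : ℤ) - 1)) i)
        rw [← Equiv.Perm.mul_apply, ← _root_.zpow_one_add, add_sub_cancel, ih] at h2
        exact h2.symm
    obtain ⟨i₀⟩ := (inferInstance : Nonempty ι)
    refine ⟨X i₀ i₀, ?_⟩
    ext i j
    rw [Matrix.smul_apply, one_apply]
    by_cases hij : i = j
    · subst hij
      obtain ⟨k, rfl⟩ := hσ.2 (Finset.mem_coe.2 (Finset.mem_univ i₀)) (Finset.mem_coe.2 (Finset.mem_univ i))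
      rw [hpow]
      simp
    · simp [hij, hoff i j hij]

end Reps

/-! ### The group C⋆-algebra of a free group -/

section GroupRep

open Matrix
open scoped Matrix.Norms.L2Operator

/-- The star homomorphism of a group algebra given by a unitary representation. -/
noncomputable def groupAlgebraRep {G : Type*} [Group G] {ι : Type*} [Fintype ι] [DecidableEq ι]
    (U : G →* unitaryGroup ι ℂ) : MonoidAlgebra ℂ G →⋆ₐ[ℂ] Matrix ι ι ℂ :=
  let f : MonoidAlgebra ℂ G →ₐ[ℂ] Matrix ι ι ℂ :=
    MonoidAlgebra.lift ℂ (Matrix ι ι ℂ) G ((unitaryGroup ι ℂ).subtype.comp U)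
  have hf : ∀ g, f (MonoidAlgebra.of ℂ G g) = (U g).1 := fun g => MonoidAlgebra.lift_of _ _
  { f with
    map_star' := fun x => by
      change f (star x) = star (f x)
      induction x using MonoidAlgebra.induction_on with
      | of g =>
        rw [star_of, hf, hf, map_inv]
        rfl
      | add x y hx hy => rw [star_add, map_add, map_add, star_add, hx, hy]
      | smul c x hx => rw [star_smul, map_smul, map_smul, star_smul, hx] }

theorem groupAlgebraRep_of {G : Type*} [Group G] {ι : Type*} [Fintype ι] [DecidableEq ι]
    (U : G →* unitaryGroup ι ℂ) (g : G) :
    groupAlgebraRep U (MonoidAlgebra.of ℂ G g) = (U g).1 := MonoidAlgebra.lift_of _ _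

/-- The matrix representation of the group C⋆-algebra given by a unitary representation. -/
noncomputable def groupCStarRep {G : Type*} [Group G] {ι : Type*} [Fintype ι] [DecidableEq ι]
    (U : G →* unitaryGroup ι ℂ) : GroupCStarAlgebra G →⋆ₐ[ℂ] Matrix ι ι ℂ :=
  universalLift (groupAlgebraRep U)

theorem groupCStarRep_universalOf {G : Type*} [Group G] {ι : Type*} [Fintype ι] [DecidableEq ι]
    (U : G →* unitaryGroup ι ℂ) (g : G) :
    groupCStarRep U (universalOf _ (MonoidAlgebra.of ℂ G g)) = (U g).1 :=
  (universalLift_universalOf _ _).trans (groupAlgebraRep_of U g)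

end GroupRep

section FreeGroup

open Matrix
open scoped Matrix.Norms.Frobenius

/-- The generators of the group C⋆-algebra of the free group. -/
noncomputable def freeGroupGen (d : ℕ) (i : Fin d) : GroupCStarAlgebra (FreeGroup (Fin d)) :=
  universalOf _ (MonoidAlgebra.of ℂ _ (FreeGroup.of i))

theorem groupCStarRep_gen {d : ℕ} {ι : Type*} [Fintype ι] [DecidableEq ι]
    (u : Fin d → unitaryGroup ι ℂ) (i : Fin d) :
    groupCStarRep (FreeGroup.lift u) (freeGroupGen d i) = (u i).1 := by
  rw [freeGroupGen, groupCStarRep_universalOf, FreeGroup.lift_apply_of]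

theorem dense_adjoin_freeGroupGen (d : ℕ) : Dense (StarAlgebra.adjoin ℂ
    (Set.range (freeGroupGen d)) : Set (GroupCStarAlgebra (FreeGroup (Fin d)))) := by
  have h := dense_adjoin_universalOf (B := MonoidAlgebra ℂ (FreeGroup (Fin d)))
    (s := Set.range fun i => MonoidAlgebra.of ℂ (FreeGroup (Fin d)) (FreeGroup.of i)) (fun b => by
      induction b using MonoidAlgebra.induction_on with
      | of g =>
        induction g using FreeGroup.induction_on with
        | C1 => rw [map_one]; exact one_mem _
        | of i => exact StarAlgebra.subset_adjoin ℂ _ ⟨i, rfl⟩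
        | inv_of i h => rw [← star_of]; exact star_mem h
        | mul x y hx hy => rw [map_mul]; exact mul_mem hx hy
      | add x y hx hy => exact add_mem hx hy
      | smul c x hx => exact SMulMemClass.smul_mem c hx)
  rwa [← Set.range_comp] at h

/-- Matrix representations of the group C⋆-algebra of the free group are tuples of unitaries. As
there is no fixed tensor factor, straightening is the diagonalisation of the matrix `B`. -/
noncomputable def freeGroupModel (d : ℕ) (hd : 2 ≤ d) :
    MatrixModel (GroupCStarAlgebra (FreeGroup (Fin d))) d 1 where
  rep κ _ _ u := groupCStarRep (FreeGroup.lift u)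
  σ := Fin d
  finite := inferInstance
  gen := freeGroupGen d
  dense := dense_adjoin_freeGroupGen d
  pos := one_pos
  defect s := by
    refine ⟨1, zero_le_one, fun κ κ' _ _ _ _ J u v => ?_⟩
    rw [groupCStarRep_gen, groupCStarRep_gen, one_mul]
    exact Finset.single_le_sum (f := fun i => ‖(u i).1 * ampl 1 J - ampl 1 J * (v i).1‖)
      (fun _ _ => norm_nonneg _) (Finset.mem_univ s)
  complete ι _ _ _ π := by
    let e : ι ≃ Fin 1 × ι := (Equiv.uniqueProd ι (Fin 1)).symm
    let u : Fin d → unitaryGroup (Fin 1 × ι) ℂ := fun i =>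
      ⟨reindexRep e π (freeGroupGen d i), by
        have h : star (freeGroupGen d i) * freeGroupGen d i = 1 := by
          rw [freeGroupGen, ← map_star, ← map_mul, star_of, ← map_mul, inv_mul_cancel, map_one,
            map_one]
        rw [mem_unitaryGroup_iff', ← map_star, ← map_mul, h, map_one]⟩
    refine ⟨ι, inferInstance, inferInstance, inferInstance, u, ?_⟩
    rw [← matrixTrace_reindexRep e]
    congr 1
    refine rep_ext (dense_adjoin_freeGroupGen d) ?_
    rintro _ ⟨i, rfl⟩
    rw [groupCStarRep_gen]
  straighten ε hε := by
    refine ⟨ε, hε, fun κ _ _ u B h0 h1 hB => ?_⟩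
    obtain ⟨Q, l, hl, hBQ⟩ := exists_diagonal_of_posSemidef h0 h1
    have hQ : (Q⁻¹).1 * B * (Q⁻¹).1ᴴ = ampl 1 (diagonal fun k => (l (0, k) : ℂ)) := by
      have e1 : (Q⁻¹).1 = Q.1ᴴ := rfl
      rw [e1, conjTranspose_conjTranspose, hBQ]
      simp only [Matrix.mul_assoc]
      rw [unitary_conjTranspose_mul, Matrix.mul_one, ← Matrix.mul_assoc, unitary_conjTranspose_mul,
        Matrix.one_mul, ampl_diagonal]
      congr 1
      funext x
      obtain ⟨a, k⟩ := x
      rw [Subsingleton.elim a 0]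
    refine ⟨fun i => Q⁻¹ * u i * Q, Q⁻¹, fun k => l (0, k), fun k => hl _, fun a => ?_, ?_,
      fun i => ?_⟩
    · rw [← conjRep_apply]
      congr 1
      refine rep_ext (dense_adjoin_freeGroupGen d) ?_
      rintro _ ⟨i, rfl⟩
      rw [conjRep_apply, groupCStarRep_gen, groupCStarRep_gen]
      have e1 : (Q⁻¹).1 = Q.1ᴴ := rfl
      change (Q⁻¹).1 * (u i).1 * Q.1 = _
      rw [e1, conjTranspose_conjTranspose]
    · rw [hQ, sub_self, norm_zero]
      positivity
    · have h2 := hB i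
      rw [groupCStarRep_gen] at h2
      rw [← hQ]
      have e2 : (Q⁻¹ * u i * Q).1 * ((Q⁻¹).1 * B * (Q⁻¹).1ᴴ)
          - (Q⁻¹).1 * B * (Q⁻¹).1ᴴ * (Q⁻¹ * u i * Q).1
          = -((Q⁻¹).1 * ((B * (u i).1 - (u i).1 * B) * Q.1)) := by
        have e1 : (Q⁻¹).1 = Q.1ᴴ := rfl
        change (Q⁻¹).1 * (u i).1 * Q.1 * ((Q⁻¹).1 * B * (Q⁻¹).1ᴴ)
          - (Q⁻¹).1 * B * (Q⁻¹).1ᴴ * ((Q⁻¹).1 * (u i).1 * Q.1) = _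
        rw [e1, conjTranspose_conjTranspose, Matrix.sub_mul, Matrix.mul_sub, neg_sub]
        simp only [Matrix.mul_assoc]
        rw [← Matrix.mul_assoc Q.1 Q.1ᴴ, unitary_mul_conjTranspose, Matrix.one_mul,
          ← Matrix.mul_assoc Q.1 Q.1ᴴ, unitary_mul_conjTranspose, Matrix.one_mul]
      rw [e2, norm_neg, frobenius_unitary_mul, frobenius_mul_unitary]
      exact h2
  irreducible κ _ _ _ := by
    obtain ⟨U, V, h⟩ := exists_irreducible_pair (Fin 1 × κ)
    refine ⟨fun i => if i = ⟨0, by omega⟩ then U else V, fun X hX => ?_⟩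
    refine h X ?_ ?_
    · have := hX (freeGroupGen d ⟨0, by omega⟩)
      rwa [groupCStarRep_gen, if_pos rfl] at this
    · have := hX (freeGroupGen d ⟨1, by omega⟩)
      rwa [groupCStarRep_gen, if_neg (by simp)] at this
  analytic κ _ _ u hu s p q := by
    simp only [groupCStarRep_gen]
    exact hu s p q

end FreeGroup

/-! ### Matrix units on `ℂⁿ ⊗ ℂᵏ` -/

section MatrixUnits

open Matrix
open scoped Matrix.Norms.Frobenius Kronecker

variable {n : ℕ} {κ κ' ι : Type*} [DecidableEq κ] [DecidableEq κ']

/-- The matrix unit `eₐᵦ ⊗ 1` on `ℂⁿ ⊗ ℂᵏ`. -/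
def matUnit (κ : Type*) [DecidableEq κ] (a b : Fin n) : Matrix (Fin n × κ) (Fin n × κ) ℂ :=
  single a b (1 : ℂ) ⊗ₖ (1 : Matrix κ κ ℂ)

theorem conjTranspose_matUnit (a b : Fin n) : (matUnit κ a b)ᴴ = matUnit κ b a := by
  rw [matUnit, conjTranspose_kronecker, conjTranspose_one, conjTranspose_single, star_one, matUnit]

variable [Fintype κ] [Fintype κ']

theorem matUnit_mul_apply (a b : Fin n) (X : Matrix (Fin n × κ) ι ℂ) (p : Fin n × κ) (q : ι) :
    (matUnit κ a b * X) p q = if a = p.1 then X (b, p.2) q else 0 := by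
  rw [mul_apply, Finset.sum_eq_single (b, p.2)]
  · simp [matUnit, kroneckerMap_apply, single_apply]
  · rintro ⟨c, k⟩ _ hne
    rw [matUnit, kroneckerMap_apply, single_apply, one_apply]
    by_cases h : b = c
    · subst h
      have h2 : p.2 ≠ k := fun h2 => hne (by rw [h2])
      simp [h2]
    · simp [h]
  · simp

theorem mul_matUnit_apply (a b : Fin n) (X : Matrix ι (Fin n × κ) ℂ) (p : ι) (q : Fin n × κ) :
    (X * matUnit κ a b) p q = if b = q.1 then X p (a, q.2) else 0 := by
  rw [mul_apply, Finset.sum_eq_single (a, q.2)]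
  · simp [matUnit, kroneckerMap_apply, single_apply]
  · rintro ⟨c, k⟩ _ hne
    rw [matUnit, kroneckerMap_apply, single_apply, one_apply]
    by_cases h : a = c
    · subst h
      have h2 : k ≠ q.2 := fun h2 => hne (by rw [h2])
      simp [h2]
    · simp [h]
  · simp

theorem matUnit_mul_ampl (a b : Fin n) (J : Matrix κ κ' ℂ) :
    matUnit κ a b * ampl n J = ampl n J * matUnit κ' a b := by
  rw [matUnit, matUnit, ampl, ← mul_kronecker_mul, ← mul_kronecker_mul, Matrix.one_mul,
    Matrix.mul_one, Matrix.one_mul, Matrix.mul_one]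

theorem frobenius_matUnit_mul_le [Fintype ι] (a b : Fin n) (X : Matrix (Fin n × κ) ι ℂ) :
    ‖matUnit κ a b * X‖ ≤ ‖X‖ := by
  refine (sq_le_sq₀ (norm_nonneg _) (norm_nonneg _)).1 ?_
  simp only [frobenius_sq, Fintype.sum_prod_type, matUnit_mul_apply]
  rw [Finset.sum_eq_single a (fun c _ hc => by simp [hc.symm]) (by simp)]
  simp only [if_true]
  exact Finset.single_le_sum (f := fun b => ∑ k, ∑ q, ‖X (b, k) q‖ ^ 2)
    (fun _ _ => by positivity) (Finset.mem_univ b)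

theorem frobenius_mul_matUnit_le [Fintype ι] (a b : Fin n) (X : Matrix ι (Fin n × κ) ℂ) :
    ‖X * matUnit κ a b‖ ≤ ‖X‖ := by
  rw [← frobenius_norm_conjTranspose, conjTranspose_mul, conjTranspose_matUnit,
    ← frobenius_norm_conjTranspose X]
  exact frobenius_matUnit_mul_le _ _ _

theorem mul_matUnit_mul_conjTranspose_apply (a b : Fin n) (W : Matrix ι (Fin n × κ) ℂ) (p q : ι) :
    (W * matUnit κ a b * Wᴴ) p q = ∑ k, W p (a, k) * star (W q (b, k)) := by
  simp only [mul_apply (M := W * matUnit κ a b), mul_matUnit_apply, conjTranspose_apply,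
    Fintype.sum_prod_type]
  rw [Finset.sum_eq_single b (fun c _ hc => by simp [hc.symm]) (by simp)]
  simp

theorem sum_matUnit_mul_mul_matUnit (c : Fin n) (B : Matrix (Fin n × κ) (Fin n × κ) ℂ) :
    ∑ a, matUnit κ a c * B * matUnit κ c a
      = ampl n (B.submatrix (fun k => (c, k)) fun k => (c, k)) := by
  ext p q
  rw [Matrix.sum_apply]
  simp only [mul_matUnit_apply, matUnit_mul_apply, ampl_apply, submatrix_apply]
  rw [Finset.sum_eq_single q.1 (fun a _ ha => by simp [ha]) (by simp)]
  simp [eq_comm]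

theorem sum_matUnit_mul_matUnit (c : Fin n) : ∑ a, matUnit κ a c * matUnit κ c a = 1 := by
  have h := sum_matUnit_mul_mul_matUnit c (1 : Matrix (Fin n × κ) (Fin n × κ) ℂ)
  simp only [Matrix.mul_one] at h
  rw [h, submatrix_one _ (Prod.mk_right_injective c), ampl_one]

/-- The commutant of `Mₙ ⊗ 1` is `1 ⊗ M_κ`. -/
theorem eq_ampl_of_commute (c : Fin n) (X : Matrix (Fin n × κ) (Fin n × κ) ℂ)
    (h : ∀ a b, X * matUnit κ a b = matUnit κ a b * X) :
    X = ampl n (X.submatrix (fun k => (c, k)) fun k => (c, k)) := by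
  rw [← sum_matUnit_mul_mul_matUnit]
  simp only [← h, Matrix.mul_assoc]
  rw [← Matrix.mul_sum, sum_matUnit_mul_matUnit, Matrix.mul_one]

/-- A matrix that almost commutes with `Mₙ ⊗ 1` is close to its compression `1 ⊗ y`. -/
theorem norm_sub_ampl_le (c : Fin n) (B : Matrix (Fin n × κ) (Fin n × κ) ℂ) {r : ℝ}
    (h : ∀ a b, ‖B * matUnit κ a b - matUnit κ a b * B‖ ≤ r) :
    ‖B - ampl n (B.submatrix (fun k => (c, k)) fun k => (c, k))‖ ≤ n * r := by
  have e : B - ampl n (B.submatrix (fun k => (c, k)) fun k => (c, k))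
      = ∑ a, (B * matUnit κ a c - matUnit κ a c * B) * matUnit κ c a := by
    rw [← sum_matUnit_mul_mul_matUnit]
    simp only [Matrix.sub_mul, Finset.sum_sub_distrib]
    congr 1
    simp only [Matrix.mul_assoc]
    rw [← Matrix.mul_sum, sum_matUnit_mul_matUnit, Matrix.mul_one]
  rw [e]
  refine (norm_sum_le _ _).trans ((Finset.sum_le_sum fun a _ =>
    (frobenius_mul_matUnit_le _ _ _).trans (h a c)).trans ?_)
  simp

end MatrixUnits

/-! ### Representations of full matrix algebras -/

section MatrixAlgebraReps

open Matrix
open scoped Matrix.Norms.Frobenius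

/-- A projection is the range projection of an isometry. -/
theorem exists_isometry_of_projection {ι : Type*} [Fintype ι] [DecidableEq ι] {P : Matrix ι ι ℂ}
    (h1 : Pᴴ = P) (h2 : P * P = P) :
    ∃ (m : ℕ) (V : Matrix ι (Fin m) ℂ), Vᴴ * V = 1 ∧ V * Vᴴ = P := by
  have hP : P.PosSemidef := by
    have h := posSemidef_conjTranspose_mul_self P
    rwa [h1, h2] at h
  have hP1 : (1 - P).PosSemidef := by
    have h := posSemidef_conjTranspose_mul_self (1 - P)
    rwa [conjTranspose_sub, h1, conjTranspose_one, Matrix.mul_sub, Matrix.mul_one, Matrix.sub_mul,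
      h2, Matrix.one_mul, sub_self, sub_zero] at h
  obtain ⟨Q, l, -, hQ⟩ := exists_diagonal_of_posSemidef hP hP1
  have hd : diagonal (fun k => (l k : ℂ)) = Q.1ᴴ * P * Q.1 := by
    rw [hQ]
    simp only [Matrix.mul_assoc]
    rw [unitary_conjTranspose_mul, Matrix.mul_one, ← Matrix.mul_assoc, unitary_conjTranspose_mul,
      Matrix.one_mul]
  have hdd : diagonal (fun k => (l k : ℂ)) * diagonal (fun k => (l k : ℂ))
      = diagonal (fun k => (l k : ℂ)) := by
    rw [hd]
    simp only [Matrix.mul_assoc]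
    rw [← Matrix.mul_assoc Q.1 Q.1ᴴ, unitary_mul_conjTranspose, Matrix.one_mul,
      ← Matrix.mul_assoc P P, h2]
  have hl : ∀ k, l k = 0 ∨ l k = 1 := fun k => by
    have h := congrFun (congrFun hdd k) k
    rw [diagonal_mul_diagonal, diagonal_apply_eq, diagonal_apply_eq] at h
    have h' : l k * l k = l k := by exact_mod_cast h
    rcases eq_or_ne (l k) 0 with h0 | h0
    · exact Or.inl h0
    · exact Or.inr (mul_left_cancel₀ h0 (by rw [h', mul_one]))
  let e := Fintype.equivFin {k // l k = 1}
  refine ⟨_, Q.1.submatrix id fun j => (e.symm j).1, ?_, ?_⟩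
  · rw [conjTranspose_submatrix, ← submatrix_mul _ _ _ _ _ Function.bijective_id,
      unitary_conjTranspose_mul]
    exact submatrix_one _ (Subtype.val_injective.comp e.symm.injective)
  · ext i j
    have h3 : ∑ k : {k // l k = 1}, Q.1 i k.1 * star (Q.1 j k.1) = P i j := by
      rw [← Finset.sum_subtype (Finset.univ.filter fun k => l k = 1) (by simp)
        fun k => Q.1 i k * star (Q.1 j k), Finset.sum_filter, hQ, mul_apply]
      refine Finset.sum_congr rfl fun k _ => ?_
      rw [mul_diagonal, conjTranspose_apply]
      rcases hl k with h | h <;> simp [h]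
    rw [← h3, ← e.symm.sum_comp]
    rfl

/-- A system of matrix units is unitarily equivalent to the matrix units `eₐᵦ ⊗ 1`. The unitary `W`
is made of the isometries `F a o * V`, where `V` is an isometry onto the range of `F o o`. -/
theorem exists_unitary_matUnit {n : ℕ} {ι : Type*} [Fintype ι] [DecidableEq ι] (hn : 0 < n)
    (F : Fin n → Fin n → Matrix ι ι ℂ) (hmul : ∀ a b c d, F a b * F c d = if b = c then F a d else 0)
    (hstar : ∀ a b, (F a b)ᴴ = F b a) (hsum : ∑ a, F a a = 1) :
    Fintype.card ι = n * (Fintype.card ι / n) ∧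
    ∃ W : Matrix ι (Fin n × Fin (Fintype.card ι / n)) ℂ, Wᴴ * W = 1 ∧ W * Wᴴ = 1 ∧
      ∀ a b, F a b * W = W * matUnit _ a b := by
  let o : Fin n := ⟨0, hn⟩
  obtain ⟨m, V, hV, hVP⟩ := exists_isometry_of_projection (hstar o o) (by rw [hmul, if_pos rfl])
  have htr : ∀ a, (F a a).trace = m := fun a => by
    have h1 : F a a = F a o * F o a := by rw [hmul, if_pos rfl]
    rw [h1, trace_mul_comm, hmul, if_pos rfl, ← hVP, trace_mul_comm, hV, Matrix.trace_one,
      Fintype.card_fin]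
  have hcard : Fintype.card ι = n * m := by
    have h1 := congrArg Matrix.trace hsum
    rw [trace_sum, Matrix.trace_one] at h1
    simp only [htr, Finset.sum_const, Finset.card_univ, Fintype.card_fin, nsmul_eq_mul] at h1
    exact_mod_cast h1.symm
  obtain rfl : m = Fintype.card ι / n := by rw [hcard, Nat.mul_div_cancel_left _ hn]
  let W : Matrix ι (Fin n × Fin (Fintype.card ι / n)) ℂ :=
    Matrix.of fun p x => (F x.1 o * V) p x.2
  refine ⟨hcard, W, ?_, ?_, fun a b => ?_⟩
  · ext x y
    have h1 : (Wᴴ * W) x y = ((F x.1 o * V)ᴴ * (F y.1 o * V)) x.2 y.2 := rfl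
    rw [h1, conjTranspose_mul, hstar, Matrix.mul_assoc, ← Matrix.mul_assoc (F o x.1), hmul]
    by_cases h : x.1 = y.1
    · rw [if_pos h, ← hVP, Matrix.mul_assoc V, hV, Matrix.mul_one, hV, one_apply, one_apply]
      simp [Prod.ext_iff, h]
    · rw [if_neg h, Matrix.zero_mul, Matrix.mul_zero, one_apply_ne fun h' => h (by rw [h'])]
      rfl
  · rw [← hsum]
    ext p q
    rw [mul_apply, Fintype.sum_prod_type, Matrix.sum_apply]
    refine Finset.sum_congr rfl fun a _ => ?_
    have h1 : ∑ k, W p (a, k) * Wᴴ (a, k) q = ((F a o * V) * (F a o * V)ᴴ) p q := rfl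
    rw [h1, conjTranspose_mul, hstar, Matrix.mul_assoc, ← Matrix.mul_assoc V, hVP, hmul,
      if_pos rfl, hmul, if_pos rfl]
  · ext p x
    refine Eq.trans ?_ (mul_matUnit_apply a b W p x).symm
    have h1 : (F a b * W) p x = (F a b * (F x.1 o * V)) p x.2 := rfl
    rw [h1, ← Matrix.mul_assoc, hmul]
    by_cases h : b = x.1
    · rw [if_pos h, if_pos h]
      rfl
    · rw [if_neg h, if_neg h, Matrix.zero_mul]
      rfl

end MatrixAlgebraReps

/-! ### Matching of spectra -/

section Matching

open Matrix
open scoped Matrix.Norms.Frobenius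

theorem frobenius_diagonal_sq {n : ℕ} {κ : Type*} [Fintype κ] [DecidableEq κ] (l : κ → ℝ) :
    ‖ampl n (diagonal fun k => (l k : ℂ))‖ ^ 2 = n * ∑ k, l k ^ 2 := by
  rw [ampl_diagonal, frobenius_sq]
  simp only [diagonal_apply]
  have h : ∀ x : Fin n × κ, ∑ y, ‖(if x = y then (l x.2 : ℂ) else 0)‖ ^ 2 = l x.2 ^ 2 := fun x => by
    rw [Finset.sum_eq_single x (fun y _ hy => by simp [hy.symm]) (by simp)]
    simp
  simp only [h, Fintype.sum_prod_type, Finset.sum_const, Finset.card_univ, Fintype.card_fin,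
    nsmul_eq_mul]

/-- An inequality of Hoffman–Wielandt type: if a unitary almost intertwines `1 ⊗ diag(l)` and
`1 ⊗ diag(l')`, then a permutation of `l` is close to `l'`. The squared norm of the defect is a mean
of the squared distances, with weights in a doubly stochastic matrix, hence, by Birkhoff's theorem,
a mean of the squared distances for permutations. -/
theorem exists_perm_near {n : ℕ} (hn : 0 < n) {κ : Type*} [Fintype κ] [DecidableEq κ]
    (S : unitaryGroup (Fin n × κ) ℂ) (l l' : κ → ℝ) :
    ∃ σ : Equiv.Perm κ, ‖ampl n (diagonal fun k => ((l (σ k) - l' k : ℝ) : ℂ))‖ ≤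
      ‖S.1 * ampl n (diagonal fun k => (l k : ℂ)) - ampl n (diagonal fun k => (l' k : ℂ)) * S.1‖ := by
  have hn' : (0 : ℝ) < n := by exact_mod_cast hn
  have hrow : ∀ p, ∑ q, ‖S.1 p q‖ ^ 2 = 1 := fun p => by
    have h := conjTranspose_mul_self_apply_self (S.1ᴴ) p
    rw [conjTranspose_conjTranspose, unitary_mul_conjTranspose, one_apply_eq] at h
    have h' : (1 : ℝ) = ∑ q, ‖S.1ᴴ q p‖ ^ 2 := by exact_mod_cast h
    rw [h']
    simp
  have hcol : ∀ q, ∑ p, ‖S.1 p q‖ ^ 2 = 1 := fun q => by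
    have h := conjTranspose_mul_self_apply_self S.1 q
    rw [unitary_conjTranspose_mul, one_apply_eq] at h
    exact_mod_cast h.symm
  let T : Matrix κ κ ℝ := fun k k' => (n : ℝ)⁻¹ * ∑ a, ∑ b, ‖S.1 (a, k) (b, k')‖ ^ 2
  have hT : T ∈ doublyStochastic ℝ κ := by
    rw [mem_doublyStochastic_iff_sum]
    refine ⟨fun k k' => by positivity, fun k => ?_, fun k' => ?_⟩
    · rw [← Finset.mul_sum, Finset.sum_comm]
      have h : ∀ a, ∑ k', ∑ b, ‖S.1 (a, k) (b, k')‖ ^ 2 = 1 := fun a => by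
        rw [Finset.sum_comm, ← Fintype.sum_prod_type']
        exact hrow (a, k)
      simp only [h, Finset.sum_const, Finset.card_univ, Fintype.card_fin, nsmul_eq_mul, mul_one]
      exact inv_mul_cancel₀ hn'.ne'
    · rw [← Finset.mul_sum]
      have h : ∑ k, ∑ a, ∑ b, ‖S.1 (a, k) (b, k')‖ ^ 2 = n := by
        rw [Finset.sum_comm]
        have h2 : ∀ a, ∑ k, ∑ b, ‖S.1 (a, k) (b, k')‖ ^ 2
            = ∑ b, ∑ k, ‖S.1 (a, k) (b, k')‖ ^ 2 := fun a => Finset.sum_comm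
        simp only [h2]
        rw [Finset.sum_comm]
        have h3 : ∀ b, ∑ a, ∑ k, ‖S.1 (a, k) (b, k')‖ ^ 2 = 1 := fun b => by
          rw [← Fintype.sum_prod_type']
          exact hcol (b, k')
        simp [h3]
      rw [h]
      exact inv_mul_cancel₀ hn'.ne'
  have hnorm : ‖S.1 * ampl n (diagonal fun k => (l k : ℂ))
      - ampl n (diagonal fun k => (l' k : ℂ)) * S.1‖ ^ 2
      = n * ∑ k, ∑ k', T k k' * (l k' - l' k) ^ 2 := by
    have h1 : ∀ p q, ‖(S.1 * ampl n (diagonal fun k => (l k : ℂ))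
        - ampl n (diagonal fun k => (l' k : ℂ)) * S.1) p q‖ ^ 2
        = ‖S.1 p q‖ ^ 2 * (l q.2 - l' p.2) ^ 2 := fun p q => by
      rw [Matrix.sub_apply, ampl_diagonal, ampl_diagonal, mul_diagonal, diagonal_mul,
        mul_comm (l' p.2 : ℂ), ← mul_sub, norm_mul, mul_pow, ← Complex.ofReal_sub,
        Complex.norm_real, Real.norm_eq_abs, sq_abs]
    rw [frobenius_sq]
    simp only [h1, Fintype.sum_prod_type]
    rw [Finset.sum_comm, Finset.mul_sum]
    refine Finset.sum_congr rfl fun k _ => ?_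
    have h2 : ∀ a, ∑ b, ∑ k', ‖S.1 (a, k) (b, k')‖ ^ 2 * (l k' - l' k) ^ 2
        = ∑ k', ∑ b, ‖S.1 (a, k) (b, k')‖ ^ 2 * (l k' - l' k) ^ 2 := fun a => Finset.sum_comm
    simp only [h2]
    rw [Finset.sum_comm, Finset.mul_sum]
    refine Finset.sum_congr rfl fun k' _ => ?_
    simp only [← Finset.sum_mul, T]
    field_simp
  obtain ⟨w, hw0, hw1, hwT⟩ := exists_eq_sum_perm_of_mem_doublyStochastic hT
  have hconv : ∑ k, ∑ k', T k k' * (l k' - l' k) ^ 2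
      = ∑ σ : Equiv.Perm κ, w σ * ∑ k, (l (σ k) - l' k) ^ 2 := by
    have h1 : ∀ k, ∑ k', T k k' * (l k' - l' k) ^ 2
        = ∑ σ : Equiv.Perm κ, w σ * (l (σ k) - l' k) ^ 2 := fun k => by
      simp only [← hwT, Matrix.sum_apply, Matrix.smul_apply, smul_eq_mul, Finset.sum_mul]
      rw [Finset.sum_comm]
      refine Finset.sum_congr rfl fun σ _ => ?_
      rw [Finset.sum_eq_single (σ k)]
      · simp [Equiv.toPEquiv_apply]
      · intro k' _ hk'
        simp [Equiv.toPEquiv_apply, hk'.symm]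
      · simp
    simp only [h1, Finset.mul_sum]
    exact Finset.sum_comm
  -- A weighted mean of the values at the permutations is at least one of them.
  obtain ⟨σ, hσ⟩ : ∃ σ : Equiv.Perm κ, ∑ k, (l (σ k) - l' k) ^ 2
      ≤ ∑ τ : Equiv.Perm κ, w τ * ∑ k, (l (τ k) - l' k) ^ 2 := by
    by_contra! hcon
    obtain ⟨σ, -, hσ⟩ := Finset.exists_min_image (Finset.univ : Finset (Equiv.Perm κ))
      (fun σ => ∑ k, (l (σ k) - l' k) ^ 2) Finset.univ_nonempty
    refine (hcon σ).not_ge ?_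
    calc ∑ k, (l (σ k) - l' k) ^ 2
        = ∑ τ : Equiv.Perm κ, w τ * ∑ k, (l (σ k) - l' k) ^ 2 := by
          rw [← Finset.sum_mul, hw1, one_mul]
      _ ≤ _ := Finset.sum_le_sum fun τ _ =>
          mul_le_mul_of_nonneg_left (hσ τ (Finset.mem_univ _)) (hw0 τ)
  refine ⟨σ, (sq_le_sq₀ (norm_nonneg _) (norm_nonneg _)).1 ?_⟩
  rw [frobenius_diagonal_sq, hnorm, hconv]
  exact mul_le_mul_of_nonneg_left hσ hn'.le

end Matching

/-! ### The universal free product of matrix algebras -/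

section FreeProductRep

open Matrix
open scoped Kronecker Matrix.Norms.L2Operator

/-- The star homomorphism of an algebraic free product given by star homomorphisms of the
factors. -/
noncomputable def freeProductStarLift {I : Type*} [DecidableEq I] {A : I → Type*}
    [∀ i, Ring (A i)] [∀ i, Algebra ℂ (A i)] [∀ i, StarRing (A i)] [∀ i, StarModule ℂ (A i)]
    {C : Type*} [Ring C] [Algebra ℂ C] [StarRing C] [StarModule ℂ C]
    (f : ∀ i, A i →⋆ₐ[ℂ] C) : AlgFreeProduct A →⋆ₐ[ℂ] C :=
  let g : AlgFreeProduct A →ₐ[ℂ] C :=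
    LinearAlgebra.FreeProduct.lift ℂ A (fun {i} => (f i).toAlgHom)
  have hg : ∀ i a, g (AlgFreeProduct.ι A i a) = f i a := fun i a =>
    DFunLike.congr_fun (LinearAlgebra.FreeProduct.lift_comp_ι (i := i) ℂ A
      (maps := fun {i} => (f i).toAlgHom)) a
  let S : Subalgebra ℂ (AlgFreeProduct A) :=
    { carrier := {x | g (star x) = star (g x)}
      mul_mem' := fun {x y} hx hy => by
        change g (star (x * y)) = star (g (x * y))
        rw [star_mul, map_mul, map_mul, star_mul, hx, hy]
      add_mem' := fun {x y} hx hy => by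
        change g (star (x + y)) = star (g (x + y))
        rw [star_add, map_add, map_add, star_add, hx, hy]
      algebraMap_mem' := fun c => by
        change g (star (algebraMap ℂ _ c)) = star (g (algebraMap ℂ _ c))
        rw [← algebraMap_star_comm, AlgHom.commutes, AlgHom.commutes, algebraMap_star_comm] }
  { g with
    map_star' := AlgFreeProduct.mem_of_ι_mem S fun i a => by
      change g (star (AlgFreeProduct.ι A i a)) = star (g (AlgFreeProduct.ι A i a))
      rw [star_ι, hg, hg, map_star] }

theorem freeProductStarLift_ι {I : Type*} [DecidableEq I] {A : I → Type*}
    [∀ i, Ring (A i)] [∀ i, Algebra ℂ (A i)] [∀ i, StarRing (A i)] [∀ i, StarModule ℂ (A i)]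
    {C : Type*} [Ring C] [Algebra ℂ C] [StarRing C] [StarModule ℂ C]
    (f : ∀ i, A i →⋆ₐ[ℂ] C) (i : I) (a : A i) :
    freeProductStarLift f (AlgFreeProduct.ι A i a) = f i a :=
  DFunLike.congr_fun (LinearAlgebra.FreeProduct.lift_comp_ι (i := i) ℂ A
      (maps := fun {i} => (f i).toAlgHom)) a

/-- The representation `x ↦ x ⊗ 1` of a matrix algebra. -/
def kronRep (n : ℕ) (κ : Type*) [Fintype κ] [DecidableEq κ] :
    CStarMatrix (Fin n) (Fin n) ℂ →⋆ₐ[ℂ] Matrix (Fin n × κ) (Fin n × κ) ℂ where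
  toFun x := CStarMatrix.ofMatrix.symm x ⊗ₖ (1 : Matrix κ κ ℂ)
  map_one' := one_kronecker_one
  map_mul' x y := by
    rw [← mul_kronecker_mul, Matrix.one_mul]
    rfl
  map_zero' := zero_kronecker _
  map_add' x y := add_kronecker _ _ _
  commutes' c := by
    rw [Algebra.algebraMap_eq_smul_one, Algebra.algebraMap_eq_smul_one, ← one_kronecker_one,
      ← smul_kronecker]
    rfl
  map_star' x := by
    rw [star_eq_conjTranspose, conjTranspose_kronecker, conjTranspose_one]
    rfl

/-- The free product of `d` copies of the algebra of `n × n` matrices. -/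
abbrev MatrixFreeProduct (n d : ℕ) : Type :=
  CStarFreeProduct fun _ : Fin d => CStarMatrix (Fin n) (Fin n) ℂ

/-- The representation of `Mₙ * ⋯ * Mₙ` which is `x ↦ uᵢ (x ⊗ 1) uᵢ*` on the `i`th factor. -/
noncomputable def matrixFreeProductRep {n d : ℕ} {κ : Type*} [Fintype κ] [DecidableEq κ]
    (u : Fin d → unitaryGroup (Fin n × κ) ℂ) :
    MatrixFreeProduct n d →⋆ₐ[ℂ] Matrix (Fin n × κ) (Fin n × κ) ℂ :=
  universalLift (freeProductStarLift fun i => conjRep (u i) (kronRep n κ))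

/-- The matrix unit `eₐᵦ` of the `i`th factor of `Mₙ * ⋯ * Mₙ`. -/
noncomputable def matrixFreeProductGen (n d : ℕ) (s : Fin d × Fin n × Fin n) :
    MatrixFreeProduct n d :=
  universalOf _ (AlgFreeProduct.ι (fun _ : Fin d => CStarMatrix (Fin n) (Fin n) ℂ) s.1
    (CStarMatrix.ofMatrix (single s.2.1 s.2.2 1)))

theorem matrixFreeProductRep_gen {n d : ℕ} {κ : Type*} [Fintype κ] [DecidableEq κ]
    (u : Fin d → unitaryGroup (Fin n × κ) ℂ) (i : Fin d) (a b : Fin n) :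
    matrixFreeProductRep u (matrixFreeProductGen n d (i, a, b))
      = (u i).1 * matUnit κ a b * (u i).1ᴴ := by
  refine (universalLift_universalOf _ _).trans ?_
  exact freeProductStarLift_ι (A := fun _ : Fin d => CStarMatrix (Fin n) (Fin n) ℂ) _ _ _

theorem dense_adjoin_matrixFreeProductGen (n d : ℕ) : Dense (StarAlgebra.adjoin ℂ
    (Set.range (matrixFreeProductGen n d)) : Set (MatrixFreeProduct n d)) := by
  have h := dense_adjoin_universalOf
    (B := AlgFreeProduct fun _ : Fin d => CStarMatrix (Fin n) (Fin n) ℂ)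
    (s := Set.range fun s : Fin d × Fin n × Fin n =>
      AlgFreeProduct.ι (fun _ : Fin d => CStarMatrix (Fin n) (Fin n) ℂ) s.1
        (CStarMatrix.ofMatrix (single s.2.1 s.2.2 1)))
    (AlgFreeProduct.mem_of_ι_mem (StarAlgebra.adjoin ℂ _).toSubalgebra fun i x => by
      have hx : x = ∑ a, ∑ b, (x a b : ℂ) • CStarMatrix.ofMatrix (single a b (1 : ℂ)) := by
        refine (matrix_eq_sum_single (CStarMatrix.ofMatrix.symm x)).trans ?_
        refine Finset.sum_congr rfl fun a _ => Finset.sum_congr rfl fun b _ => ?_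
        change _ = (x a b : ℂ) • single a b (1 : ℂ)
        rw [smul_single, smul_eq_mul, mul_one]
        rfl
      rw [hx, map_sum]
      refine sum_mem fun a _ => ?_
      rw [map_sum]
      refine sum_mem fun b _ => ?_
      rw [map_smul]
      refine Subalgebra.smul_mem _ ?_ _
      exact StarAlgebra.subset_adjoin ℂ _ (Set.mem_range_self (i, a, b)))
  rwa [← Set.range_comp] at h

theorem matrixFreeProductGen_mul (n d : ℕ) (i : Fin d) (a b a' b' : Fin n) :
    matrixFreeProductGen n d (i, a, b) * matrixFreeProductGen n d (i, a', b')
      = if b = a' then matrixFreeProductGen n d (i, a, b') else 0 := by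
  have h : CStarMatrix.ofMatrix (single a b (1 : ℂ)) * CStarMatrix.ofMatrix (single a' b' (1 : ℂ))
      = if b = a' then CStarMatrix.ofMatrix (single a b' (1 : ℂ)) else 0 := by
    change single a b (1 : ℂ) * single a' b' (1 : ℂ) = _
    split_ifs with hb
    · subst hb
      rw [single_mul_single_same, mul_one]
      rfl
    · rw [single_mul_single_of_ne _ _ _ _ hb]
      rfl
  rw [matrixFreeProductGen, matrixFreeProductGen, ← map_mul, ← map_mul, h]
  split_ifs
  · rfl
  · rw [map_zero, map_zero]

theorem star_matrixFreeProductGen (n d : ℕ) (i : Fin d) (a b : Fin n) :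
    star (matrixFreeProductGen n d (i, a, b)) = matrixFreeProductGen n d (i, b, a) := by
  have h : star (CStarMatrix.ofMatrix (single a b (1 : ℂ)))
      = CStarMatrix.ofMatrix (single b a (1 : ℂ)) := by
    change (single a b (1 : ℂ))ᴴ = single b a (1 : ℂ)
    rw [conjTranspose_single, star_one]
  rw [matrixFreeProductGen, ← map_star, star_ι, h]
  rfl

theorem sum_matrixFreeProductGen (n d : ℕ) (i : Fin d) :
    ∑ a, matrixFreeProductGen n d (i, a, a) = 1 := by
  have h : ∑ a : Fin n, CStarMatrix.ofMatrix (single a a (1 : ℂ)) = 1 := by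
    change ∑ a : Fin n, single a a (1 : ℂ) = 1
    exact sum_single_one
  simp only [matrixFreeProductGen]
  rw [← map_sum, ← map_sum, h, map_one, map_one]

end FreeProductRep

/-! ### Representations of free products of matrix algebras -/

section FreeProductModel

open Matrix
open scoped Kronecker Matrix.Norms.Frobenius

variable {n d : ℕ}

/-- The defect estimate for the matrix units `u (eₐᵦ ⊗ 1) u*`: as `1 ⊗ J` intertwines the matrix
units exactly, only the defects of `u` and of `u*` contribute. -/
theorem matUnit_conj_defect {κ κ' : Type*} [Fintype κ] [DecidableEq κ] [Fintype κ']
    [DecidableEq κ'] (J : Matrix κ κ' ℂ) (u : unitaryGroup (Fin n × κ) ℂ)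
    (v : unitaryGroup (Fin n × κ') ℂ) (a b : Fin n) :
    ‖u.1 * matUnit κ a b * u.1ᴴ * ampl n J - ampl n J * (v.1 * matUnit κ' a b * v.1ᴴ)‖ ≤
      2 * ‖u.1 * ampl n J - ampl n J * v.1‖ := by
  have e1 : u.1 * matUnit κ a b * u.1ᴴ * ampl n J - ampl n J * (v.1 * matUnit κ' a b * v.1ᴴ)
      = -(u.1 * (matUnit κ a b * (u.1ᴴ * ((u.1 * ampl n J - ampl n J * v.1) * (v⁻¹).1))))
        + (u.1 * ampl n J - ampl n J * v.1) * matUnit κ' a b * (v⁻¹).1 := by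
    have hv : (v⁻¹).1 = v.1ᴴ := rfl
    rw [hv]
    simp only [Matrix.sub_mul, Matrix.mul_sub, Matrix.mul_assoc]
    rw [unitary_mul_conjTranspose, Matrix.mul_one, ← Matrix.mul_assoc u.1ᴴ u.1,
      unitary_conjTranspose_mul, Matrix.one_mul, ← Matrix.mul_assoc (matUnit κ a b) (ampl n J),
      matUnit_mul_ampl, Matrix.mul_assoc]
    abel
  have h1 : ‖u.1 * (matUnit κ a b * (u.1ᴴ * ((u.1 * ampl n J - ampl n J * v.1) * (v⁻¹).1)))‖
      ≤ ‖u.1 * ampl n J - ampl n J * v.1‖ := by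
    rw [frobenius_unitary_mul]
    refine (frobenius_matUnit_mul_le _ _ _).trans ?_
    change ‖(u⁻¹).1 * _‖ ≤ _
    rw [frobenius_unitary_mul, frobenius_mul_unitary]
  have h2 : ‖(u.1 * ampl n J - ampl n J * v.1) * matUnit κ' a b * (v⁻¹).1‖
      ≤ ‖u.1 * ampl n J - ampl n J * v.1‖ := by
    rw [frobenius_mul_unitary]
    exact frobenius_mul_matUnit_le _ _ _
  rw [e1]
  refine (norm_add_le _ _).trans ?_
  rw [norm_neg]
  linarith

/-- Every matrix representation of `Mₙ * ⋯ * Mₙ` is equivalent to some `matrixFreeProductRep u`: the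
restriction to the `i`th factor is `x ↦ Wᵢ (x ⊗ 1) Wᵢ*`. -/
theorem exists_rep_of_matrixFreeProduct (hn : 0 < n) (hd : 0 < d) {ι : Type} [Fintype ι]
    [DecidableEq ι] [Nonempty ι] (π : MatrixFreeProduct n d →⋆ₐ[ℂ] Matrix ι ι ℂ) :
    ∃ (κ : Type) (_ : Fintype κ) (_ : DecidableEq κ) (_ : Nonempty κ)
      (u : Fin d → unitaryGroup (Fin n × κ) ℂ),
      matrixTrace π = matrixTrace (matrixFreeProductRep u) := by
  have h := fun i => exists_unitary_matUnit hn (fun a b => π (matrixFreeProductGen n d (i, a, b)))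
    (fun a b a' b' => by
      rw [← map_mul, matrixFreeProductGen_mul]
      split_ifs
      · rfl
      · rw [map_zero])
    (fun a b => by rw [← star_eq_conjTranspose, ← map_star, star_matrixFreeProductGen])
    (by rw [← map_sum, sum_matrixFreeProductGen, map_one])
  have hcard : Fintype.card ι = n * (Fintype.card ι / n) := (h ⟨0, hd⟩).1
  choose W hW1 hW2 hW using fun i => (h i).2
  let e : ι ≃ Fin n × Fin (Fintype.card ι / n) :=
    Fintype.equivOfCardEq (by rw [Fintype.card_prod, Fintype.card_fin, Fintype.card_fin, ← hcard])
  let u : Fin d → unitaryGroup (Fin n × Fin (Fintype.card ι / n)) ℂ := fun i =>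
    ⟨(W i).submatrix e.symm id, by
      rw [mem_unitaryGroup_iff, star_eq_conjTranspose, conjTranspose_submatrix,
        ← submatrix_mul _ _ _ _ _ Function.bijective_id, hW2, submatrix_one_equiv]⟩
  have hpos : 0 < Fintype.card ι / n := by
    have h1 : 0 < Fintype.card ι := Fintype.card_pos
    rw [hcard] at h1
    exact Nat.pos_of_mul_pos_left h1
  refine ⟨Fin (Fintype.card ι / n), inferInstance, inferInstance, ⟨⟨0, hpos⟩⟩, u, ?_⟩
  rw [← matrixTrace_reindexRep e]
  congr 1
  refine rep_ext (dense_adjoin_matrixFreeProductGen n d) ?_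
  rintro _ ⟨⟨i, a, b⟩, rfl⟩
  rw [matrixFreeProductRep_gen, reindexRep_apply]
  have h1 : π (matrixFreeProductGen n d (i, a, b)) =
      (W i * matUnit _ a b : Matrix ι (Fin n × Fin (Fintype.card ι / n)) ℂ) * (W i)ᴴ := by
    rw [← hW, Matrix.mul_assoc, hW2, Matrix.mul_one]
  rw [h1]
  rfl

theorem ampl_sub {κ κ' : Type*} (J J' : Matrix κ κ' ℂ) :
    ampl n (J - J') = ampl n J - ampl n J' := by
  ext x y
  simp only [Matrix.sub_apply, ampl_apply]
  split_ifs <;> simp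

/-- The unitary `1 ⊗ Q`. -/
def unitaryAmpl (n : ℕ) {κ : Type*} [Fintype κ] [DecidableEq κ] (Q : unitaryGroup κ ℂ) :
    unitaryGroup (Fin n × κ) ℂ :=
  ⟨ampl n Q.1, by
    rw [mem_unitaryGroup_iff, star_eq_conjTranspose, conjTranspose_ampl, ← ampl_mul,
      unitary_mul_conjTranspose, ampl_one]⟩

/-- A unitary representation of a permutation. -/
def permUnitary {κ : Type*} [Fintype κ] [DecidableEq κ] (σ : Equiv.Perm κ) : unitaryGroup κ ℂ :=
  ⟨σ.permMatrix ℂ, by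
    rw [mem_unitaryGroup_iff', star_eq_conjTranspose, conjTranspose_permMatrix, ← permMatrix_mul]
    simp⟩

theorem permUnitary_mul_diagonal {κ : Type*} [Fintype κ] [DecidableEq κ] (σ : Equiv.Perm κ)
    (l : κ → ℂ) : (permUnitary σ).1 * diagonal l
      = diagonal (fun k => l (σ k)) * (permUnitary σ).1 := by
  ext i j
  rw [mul_diagonal, diagonal_mul]
  simp only [permUnitary, Equiv.Perm.permMatrix, PEquiv.toMatrix_apply, Equiv.toPEquiv_apply,
    Option.mem_def, Option.some.injEq]
  by_cases h : σ i = j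
  · subst h; simp
  · simp [h]

/-- A matrix `B` that almost commutes with one copy `u (Mₙ ⊗ 1) u*` of `Mₙ` is close to an element
of the commutant `u (1 ⊗ M_κ) u*`; the unitary `Q` diagonalises the compression of `u* B u` to
`e₀ ⊗ ℂᵏ`. -/
theorem straighten_matUnit (hn : 0 < n) {κ : Type*} [Fintype κ] [DecidableEq κ]
    (u : unitaryGroup (Fin n × κ) ℂ)
    (B : Matrix (Fin n × κ) (Fin n × κ) ℂ) (h0 : B.PosSemidef) (h1 : (1 - B).PosSemidef) {r : ℝ}
    (hB : ∀ a b, ‖B * (u.1 * matUnit κ a b * u.1ᴴ) - u.1 * matUnit κ a b * u.1ᴴ * B‖ ≤ r) :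
    ∃ (Q : unitaryGroup κ ℂ) (l : κ → ℝ), (∀ k, 0 ≤ l k ∧ l k ≤ 1) ∧
      ‖(u * unitaryAmpl n Q)⁻¹.1 * B * (u * unitaryAmpl n Q).1 -
        ampl n (diagonal fun k => (l k : ℂ))‖ ≤ n * r := by
  let B' := u.1ᴴ * B * u.1
  have h0' : B'.PosSemidef := h0.conjTranspose_mul_mul_same u.1
  have e1 : 1 - B' = u.1ᴴ * (1 - B) * u.1 := by
    rw [Matrix.mul_sub, Matrix.sub_mul, Matrix.mul_one, unitary_conjTranspose_mul]
  have h1' : (1 - B').PosSemidef := e1 ▸ h1.conjTranspose_mul_mul_same u.1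
  let f : κ → Fin n × κ := fun k => (⟨0, hn⟩, k)
  have hf : Function.Injective f := Prod.mk_right_injective _
  obtain ⟨Q, l, hl, hQ⟩ := exists_diagonal_of_posSemidef (h0'.submatrix f) (B := B'.submatrix f f)
    (by
      have := h1'.submatrix f
      rwa [submatrix_sub, Pi.sub_apply, Pi.sub_apply, submatrix_one _ hf] at this)
  refine ⟨Q, l, hl, ?_⟩
  have h2 := norm_sub_ampl_le ⟨0, hn⟩ B' (r := r) fun a b => by
    refine le_of_eq_of_le ?_ (hB a b)
    rw [← frobenius_unitary_mul u, ← frobenius_mul_unitary u⁻¹]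
    congr 1
    change u.1 * (u.1ᴴ * B * u.1 * matUnit κ a b - matUnit κ a b * (u.1ᴴ * B * u.1)) * u.1ᴴ = _
    simp only [Matrix.mul_sub, Matrix.sub_mul, Matrix.mul_assoc]
    rw [← Matrix.mul_assoc u.1 u.1ᴴ, unitary_mul_conjTranspose, Matrix.one_mul, Matrix.mul_one]
  have e2 : (u * unitaryAmpl n Q)⁻¹.1 * B * (u * unitaryAmpl n Q).1
      - ampl n (diagonal fun k => (l k : ℂ))
      = (unitaryAmpl n Q)⁻¹.1 * (B' - ampl n (B'.submatrix f f)) * (unitaryAmpl n Q).1 := by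
    have e3 : ampl n (diagonal fun k => (l k : ℂ))
        = (unitaryAmpl n Q)⁻¹.1 * ampl n (B'.submatrix f f) * (unitaryAmpl n Q).1 := by
      change _ = (ampl n Q.1)ᴴ * _ * ampl n Q.1
      rw [hQ, conjTranspose_ampl, ← ampl_mul, ← ampl_mul]
      congr 1
      simp only [Matrix.mul_assoc]
      rw [unitary_conjTranspose_mul, Matrix.mul_one, ← Matrix.mul_assoc, unitary_conjTranspose_mul,
        Matrix.one_mul]
    rw [Matrix.mul_sub, Matrix.sub_mul, ← e3]
    congr 1
    rw [_root_.mul_inv_rev]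
    change (unitaryAmpl n Q)⁻¹.1 * u.1ᴴ * B * (u.1 * (unitaryAmpl n Q).1) = _
    simp only [B', Matrix.mul_assoc]
  rw [e2, frobenius_mul_unitary, frobenius_unitary_mul]
  exact h2

/-- Straightening for several copies of `Mₙ`. For the `i`th copy, `straighten_matUnit` makes `B`
close to `zᵢ (1 ⊗ Λᵢ) zᵢ*`, where `zᵢ` defines the same copy of `Mₙ` as `uᵢ`. By
`exists_perm_near` the diagonals agree approximately, after a permutation, with `Λ₀`, and a
permutation `1 ⊗ σ` does not change the copy of `Mₙ` either. -/
theorem exists_straightening (hn : 0 < n) (hd : 0 < d) {κ : Type*} [Fintype κ] [DecidableEq κ]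
    (u : Fin d → unitaryGroup (Fin n × κ) ℂ)
    (B : Matrix (Fin n × κ) (Fin n × κ) ℂ) (h0 : B.PosSemidef) (h1 : (1 - B).PosSemidef) {r : ℝ}
    (hr : 0 ≤ r)
    (hB : ∀ i a b, ‖B * ((u i).1 * matUnit κ a b * (u i).1ᴴ)
      - (u i).1 * matUnit κ a b * (u i).1ᴴ * B‖ ≤ r) :
    ∃ (v : Fin d → unitaryGroup (Fin n × κ) ℂ) (w : unitaryGroup (Fin n × κ) ℂ) (l : κ → ℝ),
      (∀ k, 0 ≤ l k ∧ l k ≤ 1) ∧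
      (∀ a, matrixFreeProductRep v a = w.1 * matrixFreeProductRep u a * w.1ᴴ) ∧
      ‖w.1 * B * w.1ᴴ - ampl n (diagonal fun k => (l k : ℂ))‖ ≤ 4 * (n * r) ∧
      ∀ i, ‖(v i).1 * ampl n (diagonal fun k => (l k : ℂ)) -
        ampl n (diagonal fun k => (l k : ℂ)) * (v i).1‖ ≤ 4 * (n * r) := by
  choose Q l hl hQ using fun i => straighten_matUnit hn (u i) B h0 h1 (hB i)
  let z : Fin d → unitaryGroup (Fin n × κ) ℂ := fun i => u i * unitaryAmpl n (Q i)
  let o : Fin d := ⟨0, hd⟩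
  let Λ : Fin d → Matrix (Fin n × κ) (Fin n × κ) ℂ := fun i => ampl n (diagonal fun k => (l i k : ℂ))
  let S : Fin d → unitaryGroup (Fin n × κ) ℂ := fun i => (z o)⁻¹ * z i
  have hz : ∀ i, ‖(z i)⁻¹.1 * B * (z i).1 - Λ i‖ ≤ n * r := hQ
  have hS : ∀ i, ‖(S i).1 * Λ i - Λ o * (S i).1‖ ≤ 2 * (n * r) := fun i => by
    have e : (S i).1 * Λ i - Λ o * (S i).1
        = ((z o)⁻¹.1 * B * (z o).1 - Λ o) * (S i).1
          - (S i).1 * ((z i)⁻¹.1 * B * (z i).1 - Λ i) := by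
      have hSi : (S i).1 = (z o).1ᴴ * (z i).1 := rfl
      have e1 : (z o)⁻¹.1 = (z o).1ᴴ := rfl
      have e2 : (z i)⁻¹.1 = (z i).1ᴴ := rfl
      rw [hSi, e1, e2]
      simp only [Matrix.mul_sub, Matrix.sub_mul, Matrix.mul_assoc]
      rw [← Matrix.mul_assoc (z o).1 (z o).1ᴴ, unitary_mul_conjTranspose, Matrix.one_mul,
        ← Matrix.mul_assoc (z i).1 (z i).1ᴴ, unitary_mul_conjTranspose, Matrix.one_mul]
      abel
    rw [e]
    refine (norm_sub_le _ _).trans ?_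
    rw [frobenius_mul_unitary, frobenius_unitary_mul]
    linarith [hz i, hz o]
  choose σ hσ using fun i => exists_perm_near hn (S i) (l i) (l o)
  let P : Fin d → unitaryGroup (Fin n × κ) ℂ := fun i => unitaryAmpl n (permUnitary (σ i))⁻¹
  have hP : ∀ i, Λ i * (P i).1 = (P i).1 * ampl n (diagonal fun k => (l i (σ i k) : ℂ)) := fun i => by
    change ampl n _ * ampl n _ = ampl n _ * ampl n _
    rw [← ampl_mul, ← ampl_mul]
    congr 1
    have h := permUnitary_mul_diagonal (σ i) fun k => (l i k : ℂ)
    have e : (permUnitary (σ i))⁻¹.1 = (permUnitary (σ i)).1ᴴ := rfl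
    rw [e, ← Matrix.one_mul (diagonal fun k => (l i k : ℂ)),
      ← unitary_conjTranspose_mul (permUnitary (σ i)), Matrix.mul_assoc, Matrix.mul_assoc,
      ← Matrix.mul_assoc _ (diagonal fun k => (l i k : ℂ)), h, Matrix.mul_assoc,
      unitary_mul_conjTranspose, Matrix.mul_one]
  refine ⟨fun i => S i * P i, (z o)⁻¹, l o, hl o, fun a => ?_, ?_, fun i => ?_⟩
  · rw [← conjRep_apply]
    congr 1
    refine rep_ext (dense_adjoin_matrixFreeProductGen n d) ?_
    rintro _ ⟨⟨i, a, b⟩, rfl⟩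
    rw [conjRep_apply, matrixFreeProductRep_gen, matrixFreeProductRep_gen]
    -- The unitaries `v i` and `w * u i` differ by a unitary in the commutant of `Mₙ ⊗ 1`.
    have e : S i * P i = (z o)⁻¹ * u i * unitaryAmpl n (Q i * (permUnitary (σ i))⁻¹) := by
      have e1 : unitaryAmpl n (Q i * (permUnitary (σ i))⁻¹) = unitaryAmpl n (Q i) * P i :=
        Subtype.ext (ampl_mul _ _)
      rw [e1]
      simp only [S, z, mul_assoc]
    rw [e]
    set R := unitaryAmpl n (Q i * (permUnitary (σ i))⁻¹) with hR
    have h2 : R.1 * matUnit κ a b * R.1ᴴ = matUnit κ a b := by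
      have h3 : R.1 * matUnit κ a b = matUnit κ a b * R.1 := (matUnit_mul_ampl _ _ _).symm
      rw [h3, Matrix.mul_assoc, unitary_mul_conjTranspose, Matrix.mul_one]
    change (z o)⁻¹.1 * (u i).1 * R.1 * matUnit κ a b * ((z o)⁻¹.1 * (u i).1 * R.1)ᴴ = _
    rw [conjTranspose_mul, conjTranspose_mul]
    nth_rewrite 2 [← h2]
    simp only [Matrix.mul_assoc]
  · have e : ((z o)⁻¹.1)ᴴ = (z o).1 := conjTranspose_conjTranspose _
    rw [e]
    have h3 := hz o
    have : 0 ≤ n * r := by positivity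
    linarith
  · have e : (S i * P i).1 * Λ o - Λ o * (S i * P i).1
        = ((S i).1 * Λ i - Λ o * (S i).1) * (P i).1
          - (S i * P i).1 * ampl n (diagonal fun k => ((l i (σ i k) - l o k : ℝ) : ℂ)) := by
      have e1 : ampl n (diagonal fun k => ((l i (σ i k) - l o k : ℝ) : ℂ))
          = ampl n (diagonal fun k => (l i (σ i k) : ℂ)) - Λ o := by
        rw [← ampl_sub, diagonal_sub]
        push_cast
        rfl
      change (S i).1 * (P i).1 * Λ o - Λ o * ((S i).1 * (P i).1) = _ - (S i).1 * (P i).1 * _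
      rw [e1]
      simp only [Matrix.mul_sub, Matrix.sub_mul, Matrix.mul_assoc]
      rw [hP]
      abel
    refine (congrArg norm e).trans_le ((norm_sub_le _ _).trans ?_)
    rw [frobenius_mul_unitary, frobenius_unitary_mul]
    linarith [hS i, hσ i]

/-- For `n ≥ 3` and `d ≥ 2` there are irreducible representations of every dimension `n k`: the
first factor is `Mₙ ⊗ 1`, and the second one its conjugate by a block diagonal unitary with the
blocks `1`, `U`, `V`, where `U` and `V` have trivial commutant. Three blocks are used, hence `n ≥ 3`. -/
theorem exists_irreducible_matrixFreeProductRep (hn : 3 ≤ n) (hd : 2 ≤ d) (κ : Type*) [Fintype κ]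
    [DecidableEq κ] [Nonempty κ] :
    ∃ u : Fin d → unitaryGroup (Fin n × κ) ℂ, ∀ X : Matrix (Fin n × κ) (Fin n × κ) ℂ,
      (∀ a, X * matrixFreeProductRep u a = matrixFreeProductRep u a * X) → ∃ c : ℂ, X = c • 1 := by
  obtain ⟨U, V, hUV⟩ := exists_irreducible_pair κ
  let w : Fin n → unitaryGroup κ ℂ := fun a => if a.1 = 1 then U else if a.1 = 2 then V else 1
  let D : unitaryGroup (Fin n × κ) ℂ :=
    ⟨(blockDiagonal fun a => (w a).1).submatrix (Equiv.prodComm _ _) (Equiv.prodComm _ _), by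
      rw [mem_unitaryGroup_iff, star_eq_conjTranspose, conjTranspose_submatrix,
        submatrix_mul_equiv, blockDiagonal_conjTranspose, ← blockDiagonal_mul]
      simp only [unitary_mul_conjTranspose]
      rw [← Pi.one_def, blockDiagonal_one, submatrix_one_equiv]⟩
  let o : Fin d := ⟨0, by omega⟩
  let o' : Fin d := ⟨1, by omega⟩
  let c₀ : Fin n := ⟨0, by omega⟩
  have hD : ∀ a k b l, D.1 (a, k) (b, l) = if a = b then (w a).1 k l else 0 :=
    fun a k b l => blockDiagonal_apply (fun a => (w a).1) (k, a) (l, b)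
  refine ⟨fun i => if i = o then 1 else D, fun X hX => ?_⟩
  have h1 : ∀ a b, X * matUnit κ a b = matUnit κ a b * X := fun a b => by
    have h := hX (matrixFreeProductGen n d (o, a, b))
    rw [matrixFreeProductRep_gen, if_pos rfl] at h
    have e : (1 : unitaryGroup (Fin n × κ) ℂ).1 = 1 := rfl
    rwa [e, conjTranspose_one, Matrix.one_mul, Matrix.mul_one] at h
  have h2 : ∀ a b, (D.1ᴴ * X * D.1) * matUnit κ a b = matUnit κ a b * (D.1ᴴ * X * D.1) :=
    fun a b => by
      have h := hX (matrixFreeProductGen n d (o', a, b))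
      rw [matrixFreeProductRep_gen, if_neg (by simp [o, o'])] at h
      have h' := congrArg (fun Z => D.1ᴴ * Z * D.1) h
      simp only [Matrix.mul_assoc] at h' ⊢
      rwa [unitary_conjTranspose_mul, Matrix.mul_one, ← Matrix.mul_assoc D.1ᴴ D.1,
        unitary_conjTranspose_mul, Matrix.one_mul] at h'
  have h3 := eq_ampl_of_commute c₀ X h1
  have h4 := eq_ampl_of_commute c₀ _ h2
  set Y := X.submatrix (fun k => (c₀, k)) fun k => (c₀, k)
  set Z := (D.1ᴴ * X * D.1).submatrix (fun k => (c₀, k)) fun k => (c₀, k)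
  have h5 : ampl n Y * D.1 = D.1 * ampl n Z := by
    rw [← h3, ← h4, Matrix.mul_assoc, ← Matrix.mul_assoc, unitary_mul_conjTranspose, Matrix.one_mul]
  -- `X = 1 ⊗ Y` and `D* X D = 1 ⊗ Z`; the blocks of `D` intertwine `Y` and `Z`, and the block `1`
  -- gives `Y = Z`.
  have h6 : ∀ a, Y * (w a).1 = (w a).1 * Z := fun a => by
    ext k l
    have h := congrFun (congrFun h5 (a, k)) (a, l)
    rw [mul_apply, mul_apply, Fintype.sum_prod_type, Fintype.sum_prod_type,
      Finset.sum_eq_single a (fun b _ hb => by simp [hD, hb]) (by simp),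
      Finset.sum_eq_single a (fun b _ hb => by simp [hD, hb.symm]) (by simp)] at h
    simpa only [hD, ampl_apply, if_true, mul_apply] using h
  have h7 : Y = Z := by
    have h := h6 c₀
    have e : (w c₀).1 = 1 := rfl
    rwa [e, Matrix.mul_one, Matrix.one_mul] at h
  obtain ⟨c, hc⟩ := hUV Y
    (by have h := h6 ⟨1, by omega⟩; rw [← h7] at h; exact h)
    (by have h := h6 ⟨2, by omega⟩; rw [← h7] at h; exact h)
  refine ⟨c, ?_⟩
  rw [h3, hc]
  ext x y
  rw [ampl_apply, Matrix.smul_apply, Matrix.smul_apply, one_apply, one_apply]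
  simp only [Prod.ext_iff]
  split_ifs <;> simp_all

theorem analyticOnNhd_matrixFreeProductRep {κ : Type*} [Fintype κ] [DecidableEq κ]
    (u : ℝ → Fin d → unitaryGroup (Fin n × κ) ℂ)
    (hu : ∀ i p q, AnalyticOnNhd ℝ (fun t => (u t i).1 p q) Set.univ)
    (s : Fin d × Fin n × Fin n) (p q : Fin n × κ) :
    AnalyticOnNhd ℝ (fun t => matrixFreeProductRep (u t) (matrixFreeProductGen n d s) p q)
      Set.univ := by
  obtain ⟨i, a, b⟩ := s
  simp only [matrixFreeProductRep_gen, mul_matUnit_mul_conjTranspose_apply]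
  refine Finset.analyticOnNhd_fun_sum _ fun k _ => (hu i p (a, k)).mul ?_
  exact Complex.conjCLE.toContinuousLinearMap.comp_analyticOnNhd (hu i q (b, k))

/-- Matrix representations of `Mₙ * ⋯ * Mₙ` are given by tuples of unitaries on `ℂⁿ ⊗ ℂᵏ`. -/
noncomputable def matrixFreeProductModel (n d : ℕ) (hn : 3 ≤ n) (hd : 2 ≤ d) :
    MatrixModel (MatrixFreeProduct n d) d n where
  rep κ _ _ u := matrixFreeProductRep u
  σ := Fin d × Fin n × Fin n
  finite := inferInstance
  gen := matrixFreeProductGen n d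
  dense := dense_adjoin_matrixFreeProductGen n d
  pos := by omega
  defect := by
    rintro ⟨i, a, b⟩
    refine ⟨2, zero_le_two, fun κ κ' _ _ _ _ J u v => ?_⟩
    rw [matrixFreeProductRep_gen, matrixFreeProductRep_gen]
    refine (matUnit_conj_defect J (u i) (v i) a b).trans ?_
    gcongr
    exact Finset.single_le_sum (f := fun i => ‖(u i).1 * ampl n J - ampl n J * (v i).1‖)
      (fun _ _ => norm_nonneg _) (Finset.mem_univ i)
  complete ι _ _ _ π := exists_rep_of_matrixFreeProduct (by omega) (by omega) π
  straighten ε hε := by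
    have hn' : (0 : ℝ) < n := by exact_mod_cast (by omega : 0 < n)
    refine ⟨ε / (4 * n), by positivity, fun κ _ _ u B h0 h1 hB => ?_⟩
    have e : 4 * (n * (ε / (4 * n) * ‖(1 : Matrix (Fin n × κ) (Fin n × κ) ℂ)‖))
        = ε * ‖(1 : Matrix (Fin n × κ) (Fin n × κ) ℂ)‖ := by
      field_simp
    have h := exists_straightening (by omega) (by omega) u B h0 h1
      (r := ε / (4 * n) * ‖(1 : Matrix (Fin n × κ) (Fin n × κ) ℂ)‖) (by positivity) fun i a b => by
        have h := hB (i, a, b)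
        rwa [matrixFreeProductRep_gen] at h
    rwa [e] at h
  irreducible κ _ _ _ := exists_irreducible_matrixFreeProductRep hn hd κ
  analytic κ _ _ u hu s p q := analyticOnNhd_matrixFreeProductRep u hu s p q

end FreeProductModel

/-! ### The closure of the finite-dimensional traces -/

section Conclusion

namespace MatrixModel

variable {A : Type*} [CStarAlgebra A] {d n : ℕ}

/-- A C⋆-algebra with a finite generating set is separable. -/
theorem separableSpace (𝓜 : MatrixModel A d n) : TopologicalSpace.SeparableSpace A := by
  have := 𝓜.finite
  have hfin : (Set.range 𝓜.gen ∪ star (Set.range 𝓜.gen)).Finite :=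
    (Set.finite_range _).union (Set.finite_range _).star
  have hcount : (Submonoid.closure (Set.range 𝓜.gen ∪ star (Set.range 𝓜.gen)) : Set A).Countable := by
    have := hfin.countable.to_subtype
    rw [Submonoid.closure_eq_mrange]
    exact Set.countable_range (ι := List _) _
  have hsep := (hcount.isSeparable.span (R := ℂ)).closure
  rw [← Algebra.adjoin_eq_span] at hsep
  have hd : closure ((Algebra.adjoin ℂ (Set.range 𝓜.gen ∪ star (Set.range 𝓜.gen))).toSubmodule :
      Set A) = Set.univ := 𝓜.dense.closure_eq
  rw [hd] at hsep
  exact TopologicalSpace.isSeparable_univ_iff.1 hsep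

theorem closure_finiteDimensionalTraces (𝓜 : MatrixModel A d n) :
    closure (finiteDimensionalTraces A) = closure (matrixTraces A) :=
  (closure_minimal (finiteDimensionalTraces_subset_closure 𝓜) isClosed_closure).antisymm
    (closure_minimal ((𝓜.matrixTraces_subset_closure_extreme 0).trans
      (closure_mono fun _ h => h.2.1)) isClosed_closure)

theorem finiteDimensionalTraces_subset_closure_extreme (𝓜 : MatrixModel A d n) (m : ℕ) :
    finiteDimensionalTraces A ⊆ closure (extremeFiniteDimensionalTraces A m) :=
  (finiteDimensionalTraces_subset_closure 𝓜).trans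
    (closure_minimal (𝓜.matrixTraces_subset_closure_extreme m) isClosed_closure)

theorem isFace_closure (𝓜 : MatrixModel A d n) :
    IsFace (traceSpace A) (closure (finiteDimensionalTraces A)) := by
  rw [𝓜.closure_finiteDimensionalTraces]
  exact ⟨convex_closure_matrixTraces 𝓜, isExtreme_closure_matrixTraces 𝓜⟩

theorem nonempty_extremeFiniteDimensionalTraces (𝓜 : MatrixModel A d n) (m : ℕ) :
    (extremeFiniteDimensionalTraces A m).Nonempty := by
  have : Nonempty (Fin n × Fin 1) := ⟨(⟨0, 𝓜.pos⟩, 0)⟩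
  exact closure_nonempty_iff.1 ⟨_, 𝓜.matrixTraces_subset_closure_extreme m
    ⟨Fin n × Fin 1, inferInstance, inferInstance, this, 𝓜.rep (Fin 1) fun _ => 1, rfl⟩⟩

theorem _root_.TraceSimplex.HasMatrixDimension.unique {φ : traceSpace A} {k l : ℕ}
    (hk : HasMatrixDimension φ k) (hl : HasMatrixDimension φ l) : k = l := by
  obtain ⟨e⟩ := hk
  obtain ⟨f⟩ := hl
  have h := (e.symm.trans f).toAlgEquiv.toLinearEquiv.finrank_eq
  simp only [Module.finrank_matrix, Fintype.card_fin, Module.finrank_self, mul_one] at h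
  exact Nat.mul_self_inj.1 h

/-- The finite-dimensional traces are infinitely many, as the extreme ones have arbitrarily large
dimension. -/
theorem infinite_finiteDimensionalTraces (𝓜 : MatrixModel A d n) :
    (finiteDimensionalTraces A).Infinite := by
  intro hfin
  have h1 : (⋃ φ ∈ finiteDimensionalTraces A,
      {k | ∃ h : φ ∈ traceSpace A, HasMatrixDimension ⟨φ, h⟩ k}).Finite :=
    hfin.biUnion fun φ _ => Set.Subsingleton.finite fun k hk l hl => hk.2.unique hl.2
  obtain ⟨M, hM⟩ := h1.bddAbove
  obtain ⟨φ, -, hφ, h, k, hk, hdim⟩ := 𝓜.nonempty_extremeFiniteDimensionalTraces (M + 1)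
  have := hM (Set.mem_biUnion hφ ⟨h, hdim⟩)
  omega

theorem isPoulsenSimplex_closure (𝓜 : MatrixModel A d n) :
    IsPoulsenSimplex (closure (finiteDimensionalTraces A)) := by
  have := 𝓜.separableSpace
  have hface := 𝓜.isFace_closure
  have hsub : finiteDimensionalTraces A ⊆ traceSpace A := fun _ h => h.1
  have hcl : closure (finiteDimensionalTraces A) ⊆ traceSpace A :=
    closure_minimal hsub isClosed_traceSpace
  refine ⟨isMetrizableChoquetSimplex_of_isExtreme
    (isCompact_traceSpace.of_isClosed_subset isClosed_closure hcl) hface.1 hface.2,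
    𝓜.infinite_finiteDimensionalTraces.mono subset_closure, ?_⟩
  refine closure_minimal ((𝓜.finiteDimensionalTraces_subset_closure_extreme 0).trans
    (closure_mono fun φ hφ => ?_)) isClosed_closure
  exact inter_extremePoints_subset_extremePoints_of_subset hcl ⟨subset_closure hφ.2.1, hφ.1⟩

end MatrixModel

end Conclusion

end TraceSimplex

theorem mainTheorem10 :
    (∀ d : ℕ, 2 ≤ d →
      (∀ m : ℕ,
        extremeFiniteDimensionalTraces (GroupCStarAlgebra (FreeGroup (Fin d))) m ⊆
          finiteDimensionalTraces (GroupCStarAlgebra (FreeGroup (Fin d))) ∧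
        finiteDimensionalTraces (GroupCStarAlgebra (FreeGroup (Fin d))) ⊆
          closure (extremeFiniteDimensionalTraces (GroupCStarAlgebra (FreeGroup (Fin d))) m)) ∧
      IsFace (traceSpace (GroupCStarAlgebra (FreeGroup (Fin d))))
        (closure (finiteDimensionalTraces (GroupCStarAlgebra (FreeGroup (Fin d))))) ∧
      IsPoulsenSimplex
        (closure (finiteDimensionalTraces (GroupCStarAlgebra (FreeGroup (Fin d)))))) ∧
    (∀ n d : ℕ, 3 ≤ n → 2 ≤ d →
      (∀ m : ℕ,
        extremeFiniteDimensionalTraces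
            (CStarFreeProduct fun _ : Fin d => CStarMatrix (Fin n) (Fin n) ℂ) m ⊆
          finiteDimensionalTraces
            (CStarFreeProduct fun _ : Fin d => CStarMatrix (Fin n) (Fin n) ℂ) ∧
        finiteDimensionalTraces
            (CStarFreeProduct fun _ : Fin d => CStarMatrix (Fin n) (Fin n) ℂ) ⊆
          closure (extremeFiniteDimensionalTraces
            (CStarFreeProduct fun _ : Fin d => CStarMatrix (Fin n) (Fin n) ℂ) m)) ∧
      IsFace
        (traceSpace (CStarFreeProduct fun _ : Fin d => CStarMatrix (Fin n) (Fin n) ℂ))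
        (closure (finiteDimensionalTraces
          (CStarFreeProduct fun _ : Fin d => CStarMatrix (Fin n) (Fin n) ℂ))) ∧
      IsPoulsenSimplex
        (closure (finiteDimensionalTraces
          (CStarFreeProduct fun _ : Fin d => CStarMatrix (Fin n) (Fin n) ℂ)))) := by
  refine ⟨fun d hd => ?_, fun n d hn hd => ?_⟩
  · let 𝓜 := freeGroupModel d hd
    exact ⟨fun m => ⟨fun _ h => h.2.1, 𝓜.finiteDimensionalTraces_subset_closure_extreme m⟩,
      𝓜.isFace_closure, 𝓜.isPoulsenSimplex_closure⟩
  · let 𝓜 := matrixFreeProductModel n d hn hd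
    exact ⟨fun m => ⟨fun _ h => h.2.1, 𝓜.finiteDimensionalTraces_subset_closure_extreme m⟩,
      𝓜.isFace_closure, 𝓜.isPoulsenSimplex_closure⟩
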